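/- Let $T^2=\mathbb{C}/(\mathbb{Z}+i\mathbb{Z})$ be the flat unit square torus and let $M_2$ be the moduli space of degree $2$ static solutions of the $\mathbb{C}P^1$ model on $T^2$, that is, the space of elliptic functions of degree $2$ (holomorphic maps $W:T^2\to S^2=\mathbb{C}\cup\{\infty\}$ of degree $2$), with the topology of uniform convergence. Let $\wp$ be the Weierstrass function of the lattice $\mathbb{Z}+i\mathbb{Z}$. The group $PSL(2,\mathbb{C})\times T^2$ acts transitively on $M_2$, with finite stabilizers, by $W\mapsto M\odot W(\cdot-s)$, where $M\odot$ is the Möbius transformation of $S^2$ given by $M$; $M_2$ carries the differentiable structure for which $(M,s)\mapsto M\odot\wp(\cdot-s)$ is a smooth covering $PSL(2,\mathbb{C})\times T^2\to M_2$. Let $g$ be the Riemannian metric on $M_2$ defined by the kinetic energy, $$g(\dot W,\dot W)=\int_{T^2}\frac{|\dot W|^2}{(1+|W|^2)^2},$$ and let $d(W,W')$ be the infimum of the lengths with respect to $g$ of the piecewise $C^1$ paths in $M_2$ connecting $W$ and $W'$. Then $M_2$ is noncompact, and $(M_2,g)$ has finite diameter: $$\operatorname{diam}(M_2,g)=\sup_{W,W'\in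 M_2}d(W,W')<\infty .$$ -/

import Mathlib

open Set Filter Topology MeasureTheory
open scoped ENNReal MatrixGroups

noncomputable section

namespace TorusLump

/-- The periods `1` and `i` of the unit square torus `T² = ℂ / (ℤ + iℤ)`. -/
def squarePeriods : PeriodPair where
  ω₁ := 1
  ω₂ := Complex.I
  indep := by
    rw [← Complex.coe_basisOneI]
    exact Complex.basisOneI.linearIndependent

/-- The unit square `[0,1) × [0,1)`, a fundamental domain of `T²`. Integrals over `T²` are
Lebesgue integrals over it. -/
def unitCell : Set ℂ := Ico (0 : ℝ) 1 ×ℂ Ico (0 : ℝ) 1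

/-- The inhomogeneous coordinate `w` on the sphere `ℂ ∪ {∞}`; its value at `∞` is a dummy. -/
def coord (p : OnePoint ℂ) : ℂ := p.elim 0 (fun w => w)

/-- The coordinate `1 / w` on the sphere, with value `0` at `∞`; its value at `0` is a dummy. -/
def recipCoord (p : OnePoint ℂ) : ℂ := p.elim 0 (fun w => w⁻¹)

/-- Holomorphy of a (continuous) map from `ℂ` to the Riemann sphere, read in the two standard
charts of the sphere. -/
def IsHolomorphicToSphere (W : ℂ → OnePoint ℂ) : Prop :=
  (∀ z, W z ≠ OnePoint.infty → AnalyticAt ℂ (fun y => coord (W y)) z) ∧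
  (∀ z, W z ≠ ((0 : ℂ) : OnePoint ℂ) → AnalyticAt ℂ (fun y => recipCoord (W y)) z)

/-- The degree of an elliptic function: the number of its poles in the period square, counted
with multiplicity. -/
def ellipticDegree (W : ℂ → OnePoint ℂ) : ℕ∞ :=
  ∑ᶠ z ∈ {z | z ∈ unitCell ∧ W z = OnePoint.infty},
    analyticOrderAt (fun y => recipCoord (W y)) z

/-- Elliptic functions of degree `2` on `T²`, i.e. holomorphic maps `T² → S²` of degree `2`, as
doubly periodic continuous maps from `ℂ` to the Riemann sphere. -/
def IsDegreeTwoElliptic (W : C(ℂ, OnePoint ℂ)) : Prop :=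
  (∀ z, W (z + 1) = W z) ∧ (∀ z, W (z + Complex.I) = W z) ∧
    IsHolomorphicToSphere W ∧ ellipticDegree W = 2

/-- The moduli space `M₂`. Its topology is induced by the compact-open topology; since all members
are doubly periodic this is the topology of uniform convergence of maps `T² → S²`. -/
abbrev ModuliSpace : Type := {W : C(ℂ, OnePoint ℂ) // IsDegreeTwoElliptic W}

/-- The Weierstrass function `℘` of the lattice `ℤ + iℤ` as a map to the Riemann sphere. -/
def wp (z : ℂ) : OnePoint ℂ :=
  open Classical in
  if z ∈ squarePeriods.lattice then OnePoint.infty else ((squarePeriods.weierstrassP z : ℂ))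

/-- The function `z ↦ M ⊙ ℘(z - s)`, where `⊙` is the action by Möbius transformations. -/
def orbitMap (M : SL(2, ℂ)) (s : ℂ) (z : ℂ) : OnePoint ℂ := (M : GL (Fin 2) ℂ) • wp (z - s)

/-- `γ` is continuously differentiable on `[a, b]` as a curve in `M₂`, for the differentiable
structure that `M₂` has as a quotient of `PSL(2, ℂ) × T²` (equivalently of its covering
`SL(2, ℂ) × ℂ`) under `(M, s) ↦ M ⊙ ℘(· - s)`: near each time, `γ` has a lift that is `C¹`. -/
def IsC1On (γ : ℝ → ModuliSpace) (a b : ℝ) : Prop :=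
  ∀ t ∈ Icc a b, ∃ (M : ℝ → SL(2, ℂ)) (s : ℝ → ℂ),
    (∀ i j, ContDiffWithinAt ℝ 1 (fun τ => M τ i j) (Icc a b) t) ∧
    ContDiffWithinAt ℝ 1 s (Icc a b) t ∧
    ∀ᶠ τ in 𝓝[Icc a b] t, ∀ z, (γ τ).1 z = orbitMap (M τ) (s τ) z

/-- The squared length `∫_{T²} |V|² / (1 + |W|²)²` of a tangent vector `V` at `W`, both read in the
inhomogeneous coordinate (which is defined off the finite set of poles of `W`). This quadratic form
is the metric `g` of the kinetic energy functional. -/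
def metricSq (W V : ℂ → ℂ) : ℝ≥0∞ :=
  ∫⁻ z in unitCell, ENNReal.ofReal (‖V z‖ ^ 2 / (1 + ‖W z‖ ^ 2) ^ 2)

/-- The speed at time `t` of a curve in `M₂`: the square root of its kinetic energy, the velocity
being the partial derivative of the field with respect to time. -/
def speed (γ : ℝ → ModuliSpace) (t : ℝ) : ℝ≥0∞ :=
  metricSq (fun z => coord ((γ t).1 z)) (fun z => deriv (fun τ => coord ((γ τ).1 z)) t) ^
    (1 / 2 : ℝ)

/-- Piecewise `C¹` paths in `M₂` from `W` to `W'`: a curve together with a finite partition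
`p 0 < p 1 < ... < p n` of its parameter interval such that it is `C¹` on every closed piece. -/
structure PiecewiseC1Path (W W' : ModuliSpace) where
  /-- the curve; only its values on `[p 0, p n]` matter -/
  γ : ℝ → ModuliSpace
  /-- the number of pieces -/
  n : ℕ
  /-- the points of the partition -/
  p : ℕ → ℝ
  lt_succ : ∀ i < n, p i < p (i + 1)
  c1 : ∀ i < n, IsC1On γ (p i) (p (i + 1))
  source : γ (p 0) = W
  target : γ (p n) = W'

/-- The length of a piecewise `C¹` path with respect to `g`. -/
def PiecewiseC1Path.length {W W' : ModuliSpace} (c : PiecewiseC1Path W W') : ℝ≥0∞ :=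
  ∫⁻ t in Icc (c.p 0) (c.p c.n), speed c.γ t

/-- The Riemannian distance `d` of `(M₂, g)`: the infimum of the lengths of piecewise `C¹` paths
(`∞` if there are none). -/
def riemDist (W W' : ModuliSpace) : ℝ≥0∞ := ⨅ c : PiecewiseC1Path W W', c.length

/-- The diameter of `(M₂, g)`. -/
def diameter : ℝ≥0∞ := ⨆ (W : ModuliSpace) (W' : ModuliSpace), riemDist W W'

end TorusLump

end

/-! Every `W` in `M₂` is `M ⊙ ℘(· - s)` (`exists_eq_lump`), and `M` factors as a unitary matrix
times `w ↦ exp (2 r) (w - c)` (`exists_eq_suMat_mul_triMat`). The unitary factor and `s` modulo the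
lattice have compact range and contribute bounded lengths (`exists_segment_rotation`,
`exists_segment_translation`). The unitary factor also drops out of the energy density
(`speed_le_of_affine`), so only the noncompact parameters `r` and `c` matter.

For fixed `c`, take `f = exp (T τ) (℘ - c) / √(1 + ‖c‖²)`. With `u = ‖f‖` its energy density is `T²
u² / (1 + u²)²`, which is at most `T² √u` and at most `T² / √u`. A large dilation in either
direction therefore costs a speed of order `|T| exp (-|T| τ / 4)`, and the integral of this is at
most `4` whatever `T` is (`exists_segment_dilation`). This needs the integrals over the torus of
`√(1 + ‖℘‖)` and of `√(√(1 + ‖c‖²) / ‖℘ - c‖)` to be bounded uniformly in `c`. They are, because `℘`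
has double poles and takes each value with multiplicity at most two. Hence `‖℘ z - ℘ a‖` is bounded
below locally by a multiple of `‖z - a - ω‖ ‖z + a - ω'‖ √(1 + ‖℘ a‖²)`
(`exists_local_lower_bound`), and the square root of its inverse is no worse than a sum of functions
`1 / ‖z - b‖`, which are locally integrable in the plane.

To reach a given `c`, one follows `(℘ - t c) / √(1 + t² ‖c‖²)`. The accompanying contraction makes
the speed decay like `‖c‖ (1 + t ‖c‖) ^ (-5/4)`, whose integral is again bounded independently of
`c` (`exists_segment_shift`). Four stages of bounded length thus join a base point to every point of
`M₂`.

Transitivity rests on two facts about elliptic functions: those without poles are constant, and none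
has a single simple pole. Subtracting from `W` a multiple of `℘(· - p)`, or of `1 / (℘(· - s) - ℘
a)`, leaves at most one simple pole, hence a constant.

Noncompactness: along `exp (2 r) ℘` with `r → ∞`, a cluster point would be `∞` off a countable set,
whereas an element of `M₂` has finitely many poles in the period square. -/

/-! ### Orders of meromorphic functions -/

section MeromorphicOrder

variable {f g : ℂ → ℂ} {x : ℂ}

/-- A multiple of one function can be subtracted from another one of the same order so as to
raise the order. -/
lemma exists_meromorphicOrderAt_sub_const_mul {n : ℤ} (hf : MeromorphicAt f x)
    (hg : MeromorphicAt g x)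
    (hfn : meromorphicOrderAt f x = n) (hgn : meromorphicOrderAt g x = n) :
    ∃ α : ℂ, α ≠ 0 ∧ ((n + 1 : ℤ) : WithTop ℤ) ≤ meromorphicOrderAt (fun z => f z - α * g z) x := by
  obtain ⟨u, hu, hu0, hfu⟩ := (meromorphicOrderAt_eq_int_iff hf).1 hfn
  obtain ⟨v, hv, hv0, hgv⟩ := (meromorphicOrderAt_eq_int_iff hg).1 hgn
  -- The quotient of the leading coefficients cancels the terms of lowest order.
  refine ⟨u x / v x, div_ne_zero hu0 hv0, ?_⟩
  have hw : AnalyticAt ℂ (fun z => u z - u x / v x * v z) x := by fun_prop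
  have hw1 : (1 : WithTop ℤ) ≤ meromorphicOrderAt (fun z => u z - u x / v x * v z) x := by
    have h0 : analyticOrderAt (fun z => u z - u x / v x * v z) x ≠ 0 := by
      rw [hw.analyticOrderAt_ne_zero]; field_simp; ring
    rw [hw.meromorphicOrderAt_eq]
    have : ((1 : ℕ) : ℕ∞) ≤ analyticOrderAt (fun z => u z - u x / v x * v z) x := by
      simpa using Order.one_le_iff_ne_zero.2 h0
    exact ENat.monotone_map_iff.mpr Nat.mono_cast this
  have heq : (fun z => f z - u x / v x * g z) =ᶠ[𝓝[≠] x]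
      (fun z => (z - x) ^ n) * (fun z => u z - u x / v x * v z) := by
    filter_upwards [hfu, hgv] with z h1 h2
    simp only [h1, h2, smul_eq_mul, Pi.mul_apply]; ring
  rw [meromorphicOrderAt_congr heq, meromorphicOrderAt_mul (by fun_prop) hw.meromorphicAt,
    fun_meromorphicOrderAt_zpow_id_sub_const]
  push_cast
  gcongr

/-- An even meromorphic function does not have a simple pole at the origin. -/
lemma meromorphicOrderAt_ne_neg_one_of_even (hf : MeromorphicAt f 0)
    (he : ∀ z, f (-z) = f z) : meromorphicOrderAt f 0 ≠ ((-1 : ℤ) : WithTop ℤ) := by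
  intro h
  obtain ⟨u, hu, hu0, hfu⟩ := (meromorphicOrderAt_eq_int_iff hf).1 h
  have hneg : Tendsto (fun z : ℂ => -z) (𝓝[≠] 0) (𝓝[≠] 0) := by
    refine tendsto_nhdsWithin_iff.2 ⟨?_, ?_⟩
    · simpa using (tendsto_neg (0 : ℂ)).mono_left nhdsWithin_le_nhds
    · filter_upwards [self_mem_nhdsWithin] with z hz
      simpa using hz
  have h1 : ∀ᶠ z in 𝓝[≠] (0 : ℂ), u (-z) + u z = 0 := by
    filter_upwards [hfu, hneg.eventually hfu, self_mem_nhdsWithin] with z h1 h2 hz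
    have hz : z ≠ 0 := hz
    have := he z
    rw [h1, h2] at this
    simp only [sub_zero, zpow_neg, zpow_one, smul_eq_mul] at this
    field_simp at this
    linear_combination -this
  have hu' : Tendsto u (𝓝[≠] 0) (𝓝 (u 0)) := hu.continuousAt.tendsto.mono_left nhdsWithin_le_nhds
  have h2 : Tendsto (fun z => u (-z) + u z) (𝓝[≠] 0) (𝓝 (u 0 + u 0)) :=
    (hu'.comp hneg).add hu'
  have h3 := tendsto_nhds_unique (h2.congr' h1) tendsto_const_nhds
  exact hu0 (by linear_combination h3 / 2)

/-- An odd function without a pole at the origin has a zero there. -/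
lemma meromorphicOrderAt_pos_of_odd (hf : MeromorphicAt f 0)
    (h0 : 0 ≤ meromorphicOrderAt f 0) (ho : ∀ z, f (-z) = -f z) :
    0 < meromorphicOrderAt f 0 := by
  rw [← tendsto_zero_iff_meromorphicOrderAt_pos hf]
  obtain ⟨c, hc⟩ := (tendsto_nhds_iff_meromorphicOrderAt_nonneg hf).2 h0
  have hneg : Tendsto (fun z : ℂ => -z) (𝓝[≠] 0) (𝓝[≠] 0) := by
    refine tendsto_nhdsWithin_iff.2 ⟨?_, ?_⟩
    · simpa using (tendsto_neg (0 : ℂ)).mono_left nhdsWithin_le_nhds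
    · filter_upwards [self_mem_nhdsWithin] with z hz
      simpa using hz
  have h2 : Tendsto (fun z => f (-z)) (𝓝[≠] 0) (𝓝 c) := hc.comp hneg
  simp only [ho] at h2
  have h3 := tendsto_nhds_unique h2 hc.neg
  have : c = 0 := by linear_combination h3 / 2
  rwa [this] at hc

/-- The order of a meromorphic function which is infinite at one point is infinite everywhere. -/
lemma Meromorphic.eventually_eq_zero_of_order_eq_top (hf : Meromorphic f)
    (h : meromorphicOrderAt f x = ⊤) (y : ℂ) : meromorphicOrderAt f y = ⊤ := by
  by_contra hy
  exact MeromorphicOn.meromorphicOrderAt_ne_top_of_isPreconnected (U := univ)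
    (fun z _ => hf z) isPreconnected_univ (mem_univ y) (mem_univ x) hy h

/-- Translates of meromorphic functions. -/
lemma Meromorphic.comp_add_const (hf : Meromorphic f) (c : ℂ) :
    Meromorphic (fun z => f (z + c)) := fun z =>
  (hf (z + c)).comp_analyticAt (g := fun z => z + c) (by fun_prop)

lemma meromorphicOrderAt_comp_add (f : ℂ → ℂ) (c x : ℂ) :
    meromorphicOrderAt (fun z => f (z + c)) x = meromorphicOrderAt f (x + c) :=
  meromorphicOrderAt_comp_add_const_eq_meromorphicOrderAt

end MeromorphicOrder

/-! ### Elliptic functions: Liouville's theorem and the exclusion of a single simple pole. -/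

namespace PeriodPair

variable (L : PeriodPair)

/-- Liouville's theorem for elliptic functions. -/
theorem exists_eq_const_of_order_nonneg {f : ℂ → ℂ} (hf : Meromorphic f)
    (hper : ∀ l ∈ L.lattice, ∀ z, f (z + l) = f z) (hord : ∀ z, 0 ≤ meromorphicOrderAt f z) :
    ∃ c, ∀ z, f =ᶠ[𝓝[≠] z] fun _ => c := by
  -- The values of `f` at isolated points carry no information. Replacing them by punctured limits
  -- removes all singularities, and the result `g` is entire and periodic, hence bounded.
  set g : ℂ → ℂ := fun z => limUnder (𝓝[≠] z) f with hg
  have key : ∀ z, ∃ h : ℂ → ℂ, AnalyticAt ℂ h z ∧ f =ᶠ[𝓝[≠] z] h ∧ g =ᶠ[𝓝 z] h := by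
    intro z
    obtain ⟨h, hh, hfh⟩ := (hf z).meromorphicOrderAt_nonneg_iff.1 (hord z)
    refine ⟨h, hh, hfh, ?_⟩
    have h1 : ∀ᶠ w in 𝓝 z, ∀ᶠ y in 𝓝[≠] w, f y = h y := by
      have h2 : ∀ᶠ w in 𝓝[≠] z, ∀ᶠ y in 𝓝[≠] w, f y = h y := by
        have := eventually_eventually_nhdsWithin.2 hfh
        filter_upwards [this, self_mem_nhdsWithin] with w hw hwz
        rw [(isOpen_compl_singleton (x := z)).nhdsWithin_eq hwz] at hw
        exact hw.filter_mono nhdsWithin_le_nhds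
      rw [eventually_nhdsWithin_iff] at h2
      filter_upwards [h2] with w hw
      by_cases hwz : w = z
      · subst hwz; exact hfh
      · exact hw hwz
    filter_upwards [h1, hh.eventually_analyticAt] with w hw hwa
    exact ((hwa.continuousAt.tendsto.mono_left nhdsWithin_le_nhds).congr'
      (hw.mono fun y hy => hy.symm)).limUnder_eq
  have hgd : Differentiable ℂ g := fun z => by
    obtain ⟨h, hh, -, hgh⟩ := key z
    exact (hh.congr hgh.symm).differentiableAt
  have hgper : ∀ z w : ℂ, w ∈ L.lattice → g (z + w) = g z := by
    intro z w hw
    obtain ⟨h, hh, hfh, hgh⟩ := key z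
    rw [hgh.self_of_nhds]
    have hmap : Tendsto (fun y => y - w) (𝓝[≠] (z + w)) (𝓝[≠] z) := by
      refine tendsto_nhdsWithin_iff.2 ⟨?_, ?_⟩
      · have : ContinuousAt (fun y : ℂ => y - w) (z + w) := by fun_prop
        simpa [ContinuousAt] using this.tendsto.mono_left nhdsWithin_le_nhds
      · filter_upwards [self_mem_nhdsWithin] with y hy
        intro h; apply hy; simp only [mem_singleton_iff] at h ⊢; linear_combination h
    have ht : Tendsto f (𝓝[≠] z) (𝓝 (h z)) :=
      (hh.continuousAt.tendsto.mono_left nhdsWithin_le_nhds).congr' (hfh.mono fun y hy => hy.symm)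
    refine ((ht.comp hmap).congr fun y => ?_).limUnder_eq
    have := hper w hw (y - w)
    simpa using this.symm
  have hb := (IsZLattice.isCompact_range_of_periodic L.lattice g hgd.continuous hgper).isBounded
  refine ⟨g 0, fun z => ?_⟩
  obtain ⟨h, -, hfh, hgh⟩ := key z
  filter_upwards [hfh, hgh.filter_mono nhdsWithin_le_nhds] with w h1 h2
  rw [h1, ← h2, hgd.apply_eq_apply_of_bounded hb w 0]

lemma order_weierstrassP_nonneg {z : ℂ} (hz : z ∉ L.lattice) :
    0 ≤ meromorphicOrderAt L.weierstrassP z :=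
  (L.analyticOnNhd_weierstrassP z hz).meromorphicOrderAt_nonneg

lemma mem_lattice_of_order_neg {z : ℂ} (hz : meromorphicOrderAt L.weierstrassP z < 0) :
    z ∈ L.lattice := by
  by_contra h
  exact absurd (L.order_weierstrassP_nonneg h) (not_le.2 hz)

/-- An elliptic function does not have exactly one pole of order one: the case of an odd function
with its pole at the origin. -/
theorem order_ne_neg_one_of_odd {E : ℂ → ℂ} (hE : Meromorphic E)
    (hper : ∀ l ∈ L.lattice, ∀ z, E (z + l) = E z) (hodd : ∀ z, E (-z) = -E z)
    (hord : ∀ z, z ∉ L.lattice → 0 ≤ meromorphicOrderAt E z) :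
    meromorphicOrderAt E 0 ≠ ((-1 : ℤ) : WithTop ℤ) := by
  -- An argument without residues. `E²` and `E'` are even with double poles, hence affine in `℘`, so
  -- `E` solves a Riccati equation. The translates of `E` by two half periods are solutions
  -- vanishing at `0`, so they agree, which gives `E` a period outside the lattice.
  intro hE0
  have hP0 : meromorphicOrderAt L.weierstrassP 0 = ((-2 : ℤ) : WithTop ℤ) := by
    simpa using L.order_weierstrassP 0 (zero_mem _)
  have hPper : ∀ l ∈ L.lattice, ∀ z, L.weierstrassP (z + l) = L.weierstrassP z :=
    fun l hl z => L.weierstrassP_add_coe z ⟨l, hl⟩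
  -- an even function with poles in the lattice of order at most two is a multiple of `℘`
  have main : ∀ F : ℂ → ℂ, Meromorphic F → (∀ l ∈ L.lattice, ∀ z, F (z + l) = F z) →
      (∀ z, F (-z) = F z) → (∀ z, z ∉ L.lattice → 0 ≤ meromorphicOrderAt F z) →
      meromorphicOrderAt F 0 = ((-2 : ℤ) : WithTop ℤ) →
      ∃ α c : ℂ, α ≠ 0 ∧ ∀ z, ∀ᶠ y in 𝓝[≠] z, F y - α * L.weierstrassP y = c := by
    intro F hF hFper hFe hFo hF0
    obtain ⟨α, hα, hα1⟩ := exists_meromorphicOrderAt_sub_const_mul (hF 0)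
      (L.meromorphic_weierstrassP 0) hF0 hP0
    have hm : Meromorphic (fun z => F z - α * L.weierstrassP z) := by fun_prop
    have h0 : 0 ≤ meromorphicOrderAt (fun z => F z - α * L.weierstrassP z) 0 := by
      have h1 := meromorphicOrderAt_ne_neg_one_of_even (hm 0) (fun z => by
        simp [hFe, L.weierstrassP_neg])
      generalize meromorphicOrderAt (fun z => F z - α * L.weierstrassP z) 0 = o at hα1 h1
      induction o with
      | top => simp
      | coe n =>
        have h2 : (-2 + 1 : ℤ) ≤ n := by exact_mod_cast hα1
        have h3 : n ≠ -1 := by exact_mod_cast h1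
        have : (0 : ℤ) ≤ n := by omega
        exact_mod_cast this
    obtain ⟨c, hc⟩ := L.exists_eq_const_of_order_nonneg hm
      (fun l hl z => by rw [hFper l hl, hPper l hl]) (fun z => by
        by_cases hz : z ∈ L.lattice
        · have := meromorphicOrderAt_comp_add (fun z => F z - α * L.weierstrassP z) z 0
          simp only [hFper z hz, hPper z hz, zero_add] at this
          rw [← this]; exact h0
        · have h1 := hFo z hz
          have h2 : 0 ≤ meromorphicOrderAt (fun y => -α * L.weierstrassP y) z :=
            AnalyticAt.meromorphicOrderAt_nonneg
              (analyticAt_const.mul (L.analyticOnNhd_weierstrassP z hz))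
          have h3 : MeromorphicAt (fun y => -α * L.weierstrassP y) z := by
            have := L.meromorphic_weierstrassP z
            fun_prop
          have h4 := meromorphicOrderAt_add (hF z) h3
          have : F + (fun y => -α * L.weierstrassP y) = fun z => F z - α * L.weierstrassP z := by
            ext y; simp; ring
          rw [this] at h4
          exact (le_min h1 h2).trans h4)
    exact ⟨α, c, hα, hc⟩
  have hEE : meromorphicOrderAt (fun z => E z * E z) 0 = ((-2 : ℤ) : WithTop ℤ) := by
    rw [fun_meromorphicOrderAt_mul (hE 0) (hE 0), hE0]; rfl
  have hdE : meromorphicOrderAt (deriv E) 0 = ((-2 : ℤ) : WithTop ℤ) :=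
    meromorphicOrderAt_deriv_eq_sub_one (n := -1) (by norm_num) hE0
  obtain ⟨α, c₁, hα, h₁⟩ := main (fun z => E z * E z) (by fun_prop)
    (fun l hl z => by simp only [hper l hl]) (fun z => by simp only [hodd]; ring)
    (fun z hz => by
      rw [fun_meromorphicOrderAt_mul (hE z) (hE z)]
      exact add_nonneg (hord z hz) (hord z hz)) hEE
  obtain ⟨β, c₂, hβ, h₂⟩ := main (deriv E) (by fun_prop)
    (fun l hl z => by
      rw [← deriv_comp_add_const]
      simp only [hper l hl])
    (fun z => by
      have h := deriv_comp_neg (f := E) (x := z)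
      have h2 : (fun x => E (-x)) = fun x => -E x := funext hodd
      rw [h2, deriv.fun_neg] at h
      linear_combination h)
    (fun z hz => by
      obtain ⟨h, hh, hEh⟩ := (hE z).meromorphicOrderAt_nonneg_iff.1 (hord z hz)
      rw [meromorphicOrderAt_congr hEh.nhdsNE_deriv]
      exact hh.deriv.meromorphicOrderAt_nonneg) hdE
  -- the Riccati equation
  have hric : ∀ z, ∀ᶠ y in 𝓝[≠] z, deriv E y = β / α * (E y * E y) + (c₂ - β / α * c₁) := by
    intro z
    filter_upwards [h₁ z, h₂ z] with y hy1 hy2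
    field_simp
    linear_combination α * hy2 - β * hy1
  -- Since `2 w` is a period, `E` is also odd about the half period `w`, where it has no pole; so it
  -- vanishes there.
  have hu : ∀ w : ℂ, w + w ∈ L.lattice → w ∉ L.lattice →
      0 < meromorphicOrderAt (fun z => E (z + w)) 0 := by
    intro w hw hw'
    refine meromorphicOrderAt_pos_of_odd (hE.comp_add_const w 0) ?_ ?_
    · rw [meromorphicOrderAt_comp_add, zero_add]; exact hord w hw'
    · intro z
      rw [← hodd, ← hper _ hw (-(z + w))]
      congr 1; ring
  have half : ∀ w : ℂ, w / 2 + w / 2 = w := fun w => by ring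
  have hu₁ := hu (L.ω₁ / 2) (by rw [half]; exact L.ω₁_mem_lattice) L.ω₁_div_two_notMem_lattice
  have hu₂ := hu (L.ω₂ / 2) (by rw [half]; exact L.ω₂_mem_lattice) L.ω₂_div_two_notMem_lattice
  set u₁ := fun z => E (z + L.ω₁ / 2) with hu₁def
  set u₂ := fun z => E (z + L.ω₂ / 2) with hu₂def
  have hm₁ : Meromorphic u₁ := hE.comp_add_const _
  have hm₂ : Meromorphic u₂ := hE.comp_add_const _
  have hmD : Meromorphic (u₁ - u₂) := hm₁.sub hm₂
  have shift : ∀ w, Tendsto (fun z : ℂ => z + w) (𝓝[≠] 0) (𝓝[≠] w) := by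
    intro w
    refine tendsto_nhdsWithin_iff.2 ⟨?_, ?_⟩
    · have : ContinuousAt (fun y : ℂ => y + w) 0 := by fun_prop
      simpa [ContinuousAt] using this.tendsto.mono_left nhdsWithin_le_nhds
    · filter_upwards [self_mem_nhdsWithin] with y hy
      simpa using hy
  have hDtop : meromorphicOrderAt (u₁ - u₂) 0 = ⊤ := by
    by_contra htop
    obtain ⟨n, hn⟩ := WithTop.ne_top_iff_exists.1 htop
    have hDpos : 0 < meromorphicOrderAt (u₁ - u₂) 0 := by
      rw [sub_eq_add_neg]
      refine lt_of_lt_of_le (lt_min hu₁ ?_) (meromorphicOrderAt_add (hm₁ 0) (hm₂ 0).neg)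
      rwa [← meromorphicOrderAt_neg]
    have hSpos : 0 < meromorphicOrderAt (u₁ + u₂) 0 :=
      lt_of_lt_of_le (lt_min hu₁ hu₂) (meromorphicOrderAt_add (hm₁ 0) (hm₂ 0))
    have hn0 : 0 < n := by rw [← hn] at hDpos; exact_mod_cast hDpos
    have hd := meromorphicOrderAt_deriv_eq_sub_one (n := n) (by exact_mod_cast hn0.ne') hn.symm
    -- Difference of the two Riccati equations. The left side has order `n - 1` at `0`, the right
    -- side order greater than `n`: a difference of finite order is impossible.
    have hDE : deriv (u₁ - u₂) =ᶠ[𝓝[≠] 0] (fun _ => β / α) * (u₁ + u₂) * (u₁ - u₂) := by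
      filter_upwards [(shift _).eventually (hric (L.ω₁ / 2)),
        (shift _).eventually (hric (L.ω₂ / 2)),
        (hm₁ 0).eventually_analyticAt, (hm₂ 0).eventually_analyticAt] with z h1 h2 h3 h4
      rw [deriv_sub h3.differentiableAt h4.differentiableAt, hu₁def, hu₂def,
        deriv_comp_add_const, deriv_comp_add_const, h1, h2]
      simp only [Pi.mul_apply, Pi.add_apply, Pi.sub_apply]; ring
    have hne : (fun _ : ℂ => β / α) 0 ≠ 0 := div_ne_zero hβ hα
    rw [meromorphicOrderAt_congr hDE, mul_assoc,
      meromorphicOrderAt_mul_of_ne_zero analyticAt_const hne,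
      meromorphicOrderAt_mul ((hm₁ 0).add (hm₂ 0)) (hmD 0), ← hn] at hd
    generalize meromorphicOrderAt (u₁ + u₂) 0 = o at hd hSpos
    induction o with
    | top => exact WithTop.coe_ne_top ((top_add _).symm.trans hd).symm
    | coe m =>
      have h5 : 0 < m := by exact_mod_cast hSpos
      have h6 : m + n = n - 1 := by exact_mod_cast hd
      omega
  -- Equality of the translates carries the pole at `0` to `(ω₁ - ω₂) / 2`, which is not a lattice
  -- point.
  have hcon : meromorphicOrderAt E (L.ω₁ / 2 - L.ω₂ / 2) = meromorphicOrderAt E 0 := by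
    have h1 := hmD.eventually_eq_zero_of_order_eq_top hDtop (-(L.ω₂ / 2))
    rw [meromorphicOrderAt_eq_top_iff] at h1
    have h2 : u₁ =ᶠ[𝓝[≠] (-(L.ω₂ / 2))] u₂ := h1.mono fun z hz => sub_eq_zero.1 hz
    have h3 := meromorphicOrderAt_congr h2
    rw [hu₁def, hu₂def, meromorphicOrderAt_comp_add, meromorphicOrderAt_comp_add] at h3
    rw [neg_add_cancel] at h3
    rw [← h3]; congr 1; ring
  have hmem : L.ω₁ / 2 - L.ω₂ / 2 ∉ L.lattice := by
    have := (L.mul_ω₁_add_mul_ω₂_mem_lattice (α := 1 / 2) (β := -1 / 2)).not.2 (by norm_num)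
    intro h; apply this; convert h using 1; push_cast; ring
  have := hord _ hmem
  rw [hcon, hE0] at this
  have h7 : (0 : ℤ) ≤ -1 := by exact_mod_cast this
  omega

/-- An elliptic function whose only poles are at the translates of one point `p`, and of order at
most one, is constant. -/
theorem exists_eq_const_of_order_ge_neg_one {f : ℂ → ℂ} (hf : Meromorphic f)
    (hper : ∀ l ∈ L.lattice, ∀ z, f (z + l) = f z) (p : ℂ)
    (hord : ∀ z, z - p ∉ L.lattice → 0 ≤ meromorphicOrderAt f z)
    (hp : ((-1 : ℤ) : WithTop ℤ) ≤ meromorphicOrderAt f p) :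
    ∃ c, ∀ z, f =ᶠ[𝓝[≠] z] fun _ => c := by
  refine L.exists_eq_const_of_order_nonneg hf hper ?_
  suffices h : 0 ≤ meromorphicOrderAt f p by
    intro z
    by_cases hz : z - p ∈ L.lattice
    · have := meromorphicOrderAt_comp_add f (z - p) p
      simp only [hper _ hz, add_sub_cancel] at this
      rwa [← this]
    · exact hord z hz
  have hne : meromorphicOrderAt f p ≠ ((-1 : ℤ) : WithTop ℤ) := by
    intro h
    -- The antisymmetrisation about `p` still has a simple pole, with twice the leading coefficient.
    set E : ℂ → ℂ := fun z => f (z + p) - f (-z + p) with hEdef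
    have hm1 : Meromorphic (fun z => f (z + p)) := hf.comp_add_const p
    have hm2 : Meromorphic (fun z => f (-z + p)) := fun z =>
      (hf (-z + p)).comp_analyticAt (g := fun z => -z + p) (by fun_prop)
    have hm : Meromorphic E := hm1.sub hm2
    refine L.order_ne_neg_one_of_odd hm ?_ ?_ ?_ ?_
    · intro l hl z
      simp only [hEdef]
      rw [show z + l + p = (z + p) + l by ring, hper l hl,
        ← hper l hl (-(z + l) + p)]
      congr 2; ring
    · intro z; simp only [hEdef, neg_neg]; ring
    · intro z hz
      rw [hEdef, show (fun z => f (z + p) - f (-z + p))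
        = (fun z => f (z + p)) + -(fun z => f (-z + p)) from rfl]
      refine (le_min ?_ ?_).trans (meromorphicOrderAt_add (hm1 z) (hm2 z).neg)
      · rw [meromorphicOrderAt_comp_add]; exact hord _ (by simpa using hz)
      · rw [← meromorphicOrderAt_neg]
        have := meromorphicOrderAt_comp_of_deriv_ne_zero (f := f) (g := fun z => -z + p) (x := z)
          (by fun_prop) (by simp)
        rw [show (fun z => f (-z + p)) = f ∘ (fun z => -z + p) from rfl, this]
        exact hord _ (by simpa using hz)
    · obtain ⟨u, hu, hu0, hfu⟩ := (meromorphicOrderAt_eq_int_iff (hf p)).1 h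
      rw [meromorphicOrderAt_eq_int_iff (hm 0)]
      refine ⟨fun z => u (z + p) + u (-z + p), ?_, ?_, ?_⟩
      · have h1 : AnalyticAt ℂ (fun z => u (z + p)) 0 :=
          AnalyticAt.fun_comp (by simpa using hu) (by fun_prop)
        have h2 : AnalyticAt ℂ (fun z => u (-z + p)) 0 :=
          AnalyticAt.fun_comp (g := u) (f := fun z => -z + p) (by simpa using hu) (by fun_prop)
        exact h1.add h2
      · simpa [← two_mul] using hu0
      · have t1 : Tendsto (fun z : ℂ => z + p) (𝓝[≠] 0) (𝓝[≠] p) := by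
          refine tendsto_nhdsWithin_iff.2 ⟨?_, ?_⟩
          · have : ContinuousAt (fun y : ℂ => y + p) 0 := by fun_prop
            simpa [ContinuousAt] using this.tendsto.mono_left nhdsWithin_le_nhds
          · filter_upwards [self_mem_nhdsWithin] with y hy
            simpa using hy
        have t2 : Tendsto (fun z : ℂ => -z + p) (𝓝[≠] 0) (𝓝[≠] p) := by
          refine tendsto_nhdsWithin_iff.2 ⟨?_, ?_⟩
          · have : ContinuousAt (fun y : ℂ => -y + p) 0 := by fun_prop
            simpa [ContinuousAt] using this.tendsto.mono_left nhdsWithin_le_nhds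
          · filter_upwards [self_mem_nhdsWithin] with y hy
            simpa using hy
        filter_upwards [t1.eventually hfu, t2.eventually hfu, self_mem_nhdsWithin] with z h1 h2 hz
        have hz : z ≠ 0 := hz
        simp only [hEdef, h1, h2, add_sub_cancel_right, sub_zero, zpow_neg, zpow_one, smul_eq_mul]
        field_simp
        ring
  generalize meromorphicOrderAt f p = o at hp hne
  induction o with
  | top => simp
  | coe n =>
    have h2 : (-1 : ℤ) ≤ n := by exact_mod_cast hp
    have h3 : n ≠ -1 := by exact_mod_cast hne
    have : (0 : ℤ) ≤ n := by omega
    exact_mod_cast this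

end PeriodPair

/-- Uniqueness for linear second order differential equations, in the analytic setting. -/
lemma eventually_eq_zero_of_deriv_deriv_eq_mul {h q : ℂ → ℂ} {x : ℂ} (hh : AnalyticAt ℂ h x)
    (hq : AnalyticAt ℂ q x) (hode : deriv (deriv h) =ᶠ[𝓝 x] q * h) (h0 : h x = 0)
    (h1 : deriv h x = 0) : ∀ᶠ z in 𝓝 x, h z = 0 := by
  rw [← analyticOrderAt_eq_top]
  -- By the initial conditions each of two derivatives lowers the order by exactly one, while `q *
  -- h` has order at least that of `h`. So the order is infinite.
  have e1 := hh.analyticOrderAt_deriv_add_one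
  have e2 := hh.deriv.analyticOrderAt_deriv_add_one
  simp only [h0, h1, sub_zero] at e1 e2
  rw [analyticOrderAt_congr hode, analyticOrderAt_mul hq hh] at e2
  rw [← e2] at e1
  generalize analyticOrderAt q x = m at *
  generalize analyticOrderAt h x = n at *
  by_contra hn
  lift n to ℕ using hn
  induction m with
  | top => simp at e1
  | coe m =>
    have : m + n + 1 + 1 = n := by exact_mod_cast e1
    omega

/-! ### Values of `℘` and their multiplicities. -/

namespace PeriodPair

variable (L : PeriodPair)

lemma analyticAt_weierstrassP {z : ℂ} (hz : z ∉ L.lattice) : AnalyticAt ℂ L.weierstrassP z :=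
  L.analyticOnNhd_weierstrassP z hz

lemma eventually_notMem_lattice {z : ℂ} (hz : z ∉ L.lattice) : ∀ᶠ y in 𝓝 z, y ∉ L.lattice :=
  L.isClosed_lattice.isOpen_compl.mem_nhds hz

lemma order_weierstrassP_ne_top (z : ℂ) : meromorphicOrderAt L.weierstrassP z ≠ ⊤ := by
  intro h
  have := L.meromorphic_weierstrassP.eventually_eq_zero_of_order_eq_top h 0
  rw [L.order_weierstrassP 0 (zero_mem _)] at this
  exact absurd this (WithTop.coe_ne_top (a := (-2 : ℤ)))

lemma order_derivWeierstrassP_zero :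
    meromorphicOrderAt L.derivWeierstrassP 0 = ((-3 : ℤ) : WithTop ℤ) := by
  have := meromorphicOrderAt_deriv_eq_sub_one (n := -2) (by norm_num)
    (L.order_weierstrassP 0 (zero_mem _))
  rwa [L.deriv_weierstrassP] at this

/-- `℘'' = 6 ℘² - g₂ / 2`. -/
lemma deriv_derivWeierstrassP {z : ℂ} (hz : z ∉ L.lattice) :
    deriv L.derivWeierstrassP z = 6 * L.weierstrassP z ^ 2 - L.g₂ / 2 := by
  -- Differentiating `℘'² = 4 ℘³ - g₂ ℘ - g₃` and cancelling `2 ℘'` proves the formula off the zeros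
  -- of `℘'`; continuity gives the rest.
  have key : ∀ y, y ∉ L.lattice → L.derivWeierstrassP y ≠ 0 →
      deriv L.derivWeierstrassP y = 6 * L.weierstrassP y ^ 2 - L.g₂ / 2 := by
    intro y hy hy0
    have h1 : (fun w => L.derivWeierstrassP w ^ 2) =ᶠ[𝓝 y]
        fun w => 4 * L.weierstrassP w ^ 3 - L.g₂ * L.weierstrassP w - L.g₃ := by
      filter_upwards [L.eventually_notMem_lattice hy] with w hw using L.derivWeierstrassP_sq w hw
    have hP : HasDerivAt L.weierstrassP (L.derivWeierstrassP y) y := by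
      rw [← L.deriv_weierstrassP]
      exact (L.analyticAt_weierstrassP hy).differentiableAt.hasDerivAt
    have hP' : HasDerivAt L.derivWeierstrassP (deriv L.derivWeierstrassP y) y :=
      (L.analyticOnNhd_derivWeierstrassP y hy).differentiableAt.hasDerivAt
    have h2 := (hP'.pow 2).congr_of_eventuallyEq h1.symm
    have h3 := (((hP.pow 3).const_mul 4).sub (hP.const_mul L.g₂)).sub_const L.g₃
    have h4 := h2.unique h3
    norm_num at h4
    have h5 : L.derivWeierstrassP y * (deriv L.derivWeierstrassP y
      - (6 * L.weierstrassP y ^ 2 - L.g₂ / 2)) = 0 := by linear_combination h4 / 2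
    exact sub_eq_zero.1 ((mul_eq_zero.1 h5).resolve_left hy0)
  have hne : ∀ᶠ y in 𝓝[≠] z, L.derivWeierstrassP y ≠ 0 := by
    rw [← meromorphicOrderAt_ne_top_iff_eventually_ne_zero (L.meromorphic_derivWeierstrassP z)]
    intro h
    have := L.meromorphic_derivWeierstrassP.eventually_eq_zero_of_order_eq_top h 0
    rw [L.order_derivWeierstrassP_zero] at this
    exact absurd this WithTop.coe_ne_top
  have hev : deriv L.derivWeierstrassP =ᶠ[𝓝[≠] z]
      fun y => 6 * L.weierstrassP y ^ 2 - L.g₂ / 2 := by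
    filter_upwards [hne, (L.eventually_notMem_lattice hz).filter_mono nhdsWithin_le_nhds]
      with y h1 h2 using key y h2 h1
  have hc1 : ContinuousAt (deriv L.derivWeierstrassP) z :=
    (L.analyticOnNhd_derivWeierstrassP z hz).deriv.continuousAt
  have hc2 : ContinuousAt (fun y => 6 * L.weierstrassP y ^ 2 - L.g₂ / 2) z := by
    have := (L.analyticAt_weierstrassP hz).continuousAt
    fun_prop
  exact tendsto_nhds_unique (hc1.tendsto.mono_left nhdsWithin_le_nhds)
    ((hc2.tendsto.mono_left nhdsWithin_le_nhds).congr' (hev.mono fun y hy => hy.symm))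

/-- A point off the lattice is determined modulo the lattice by the values of `℘` and `℘'`. -/
lemma sub_mem_lattice_of_eq_of_deriv_eq {a b : ℂ} (ha : a ∉ L.lattice) (hb : b ∉ L.lattice)
    (h : L.weierstrassP a = L.weierstrassP b)
    (h' : L.derivWeierstrassP a = L.derivWeierstrassP b) : a - b ∈ L.lattice := by
  -- `D` and `D'` vanish at `0` and `D'' = 6 (℘(z + b) + ℘(z + a)) D`, so `D` vanishes identically.
  -- The pole of `℘(z + b)` at `-b` is then one of `℘(z + a)`.
  set D : ℂ → ℂ := fun z => L.weierstrassP (z + b) - L.weierstrassP (z + a) with hD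
  have hac : Tendsto (fun z : ℂ => z + a) (𝓝 0) (𝓝 a) := by
    have : ContinuousAt (fun y : ℂ => y + a) 0 := by fun_prop
    simpa [ContinuousAt] using this.tendsto
  have hbc : Tendsto (fun z : ℂ => z + b) (𝓝 0) (𝓝 b) := by
    have : ContinuousAt (fun y : ℂ => y + b) 0 := by fun_prop
    simpa [ContinuousAt] using this.tendsto
  have aa : AnalyticAt ℂ (fun z => L.weierstrassP (z + a)) 0 :=
    AnalyticAt.fun_comp (by simpa using L.analyticAt_weierstrassP ha) (by fun_prop)
  have ab : AnalyticAt ℂ (fun z => L.weierstrassP (z + b)) 0 :=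
    AnalyticAt.fun_comp (by simpa using L.analyticAt_weierstrassP hb) (by fun_prop)
  have hD1 : deriv D =ᶠ[𝓝 0] fun z => L.derivWeierstrassP (z + b) - L.derivWeierstrassP (z + a) := by
    filter_upwards [aa.eventually_analyticAt, ab.eventually_analyticAt] with z h1 h2
    rw [hD, deriv_fun_sub h2.differentiableAt h1.differentiableAt, deriv_comp_add_const,
      deriv_comp_add_const, L.deriv_weierstrassP]
  have hD2 : deriv (deriv D) =ᶠ[𝓝 0]
      (fun z => 6 * (L.weierstrassP (z + b) + L.weierstrassP (z + a))) * D := by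
    refine hD1.deriv.trans ?_
    filter_upwards [hac.eventually (L.eventually_notMem_lattice ha),
      hbc.eventually (L.eventually_notMem_lattice hb)] with z h1 h2
    have d1 : DifferentiableAt ℂ (fun z => L.derivWeierstrassP (z + a)) z :=
      ((L.analyticOnNhd_derivWeierstrassP _ h1).fun_comp (f := fun z => z + a)
        (by fun_prop)).differentiableAt
    have d2 : DifferentiableAt ℂ (fun z => L.derivWeierstrassP (z + b)) z :=
      ((L.analyticOnNhd_derivWeierstrassP _ h2).fun_comp (f := fun z => z + b)
        (by fun_prop)).differentiableAt
    rw [deriv_fun_sub d2 d1, deriv_comp_add_const, deriv_comp_add_const,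
      L.deriv_derivWeierstrassP h1, L.deriv_derivWeierstrassP h2, hD]
    simp only [Pi.mul_apply]; ring
  have hz := eventually_eq_zero_of_deriv_deriv_eq_mul (ab.sub aa)
    (by fun_prop : AnalyticAt ℂ (fun z => 6 * (L.weierstrassP (z + b) + L.weierstrassP (z + a))) 0)
    hD2 (by simp [h]) (by change deriv D 0 = 0; rw [hD1.self_of_nhds]; simp [h'])
  have mm : Meromorphic D :=
    (L.meromorphic_weierstrassP.comp_add_const b).sub (L.meromorphic_weierstrassP.comp_add_const a)
  have htop : meromorphicOrderAt D 0 = ⊤ :=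
    meromorphicOrderAt_eq_top_iff.2 (hz.filter_mono nhdsWithin_le_nhds)
  have h1 := mm.eventually_eq_zero_of_order_eq_top htop (-b)
  rw [meromorphicOrderAt_eq_top_iff] at h1
  have h2 := meromorphicOrderAt_congr (h1.mono fun z hz => sub_eq_zero.1 hz)
  rw [meromorphicOrderAt_comp_add, meromorphicOrderAt_comp_add, neg_add_cancel,
    L.order_weierstrassP 0 (zero_mem _)] at h2
  apply L.mem_lattice_of_order_neg
  rw [show a - b = -b + a by ring, ← h2]
  exact WithTop.coe_lt_coe.2 (by norm_num : (-2 : ℤ) < 0)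

/-- `℘` takes equal values only at points which agree up to sign modulo the lattice. -/
lemma weierstrassP_eq_iff {a b : ℂ} (ha : a ∉ L.lattice) (hb : b ∉ L.lattice) :
    L.weierstrassP a = L.weierstrassP b ↔ a - b ∈ L.lattice ∨ a + b ∈ L.lattice := by
  constructor
  · intro h
    have hsq : L.derivWeierstrassP a ^ 2 = L.derivWeierstrassP b ^ 2 := by
      rw [L.derivWeierstrassP_sq a ha, L.derivWeierstrassP_sq b hb, h]
    rcases sq_eq_sq_iff_eq_or_eq_neg.1 hsq with h' | h'
    · exact Or.inl (L.sub_mem_lattice_of_eq_of_deriv_eq ha hb h h')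
    · right
      have := L.sub_mem_lattice_of_eq_of_deriv_eq (b := -b) ha (by simpa using hb)
        (by rwa [L.weierstrassP_neg]) (by rwa [L.derivWeierstrassP_neg])
      simpa using this
  · rintro (h | h)
    · have := L.weierstrassP_add_coe b ⟨a - b, h⟩
      simpa using this
    · have := L.weierstrassP_add_coe (-b) ⟨a + b, h⟩
      rw [L.weierstrassP_neg] at this
      rw [← this]; congr 1; simp

lemma derivWeierstrassP_eq_zero_iff {a : ℂ} (ha : a ∉ L.lattice) :
    L.derivWeierstrassP a = 0 ↔ a + a ∈ L.lattice := by
  constructor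
  · intro h
    have := L.sub_mem_lattice_of_eq_of_deriv_eq (b := -a) ha (by simpa using ha)
      (by rw [L.weierstrassP_neg]) (by rw [L.derivWeierstrassP_neg, h, neg_zero])
    simpa using this
  · intro h
    have := L.derivWeierstrassP_add_coe (-a) ⟨a + a, h⟩
    rw [L.derivWeierstrassP_neg] at this
    simp only [neg_add_cancel_left] at this
    linear_combination this / 2

lemma not_eventually_weierstrassP_eq_const (a c : ℂ) : ¬ ∀ᶠ z in 𝓝[≠] a, L.weierstrassP z = c := by
  intro h
  have hm : Meromorphic (fun z => L.weierstrassP z - c) := by fun_prop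
  have h1 : meromorphicOrderAt (fun z => L.weierstrassP z - c) a = ⊤ :=
    meromorphicOrderAt_eq_top_iff.2 (h.mono fun z hz => sub_eq_zero.2 hz)
  have h2 := hm.eventually_eq_zero_of_order_eq_top h1 0
  rw [meromorphicOrderAt_eq_top_iff] at h2
  have h3 := meromorphicOrderAt_congr (f₂ := fun _ => c) (h2.mono fun z hz => sub_eq_zero.1 hz)
  rw [show meromorphicOrderAt L.weierstrassP 0 = ((-2 : ℤ) : WithTop ℤ) from
    L.order_weierstrassP 0 (zero_mem _)] at h3
  have h4 : (0 : WithTop ℤ) ≤ meromorphicOrderAt (fun _ : ℂ => c) 0 :=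
    analyticAt_const.meromorphicOrderAt_nonneg
  rw [← h3] at h4
  exact absurd (WithTop.coe_le_coe.1 h4) (by norm_num)

/-- Otherwise `6 ℘(a)² = g₂ / 2`, and `h = ℘ - ℘(a)` solves `h'' = 6 (℘ + ℘(a)) h` with zero initial
data, which makes `℘` constant. -/
lemma deriv_derivWeierstrassP_ne_zero {a : ℂ} (ha : a ∉ L.lattice) (haa : a + a ∈ L.lattice) :
    deriv L.derivWeierstrassP a ≠ 0 := by
  intro h
  have hP := L.analyticAt_weierstrassP ha
  have h6 := L.deriv_derivWeierstrassP ha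
  rw [h] at h6
  have hd : deriv (fun z => L.weierstrassP z - L.weierstrassP a) = L.derivWeierstrassP := by
    ext z; rw [deriv_sub_const, L.deriv_weierstrassP]
  have := eventually_eq_zero_of_deriv_deriv_eq_mul (x := a)
    (h := fun z => L.weierstrassP z - L.weierstrassP a)
    (q := fun z => 6 * (L.weierstrassP z + L.weierstrassP a)) (by fun_prop) (by fun_prop)
    (by
      rw [hd]
      filter_upwards [L.eventually_notMem_lattice ha] with z hz
      rw [L.deriv_derivWeierstrassP hz]
      simp only [Pi.mul_apply]
      linear_combination -h6)
    (by simp) (by rw [hd]; exact (L.derivWeierstrassP_eq_zero_iff ha).2 haa)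
  exact L.not_eventually_weierstrassP_eq_const a (L.weierstrassP a)
    ((this.mono fun z hz => sub_eq_zero.1 hz).filter_mono nhdsWithin_le_nhds)

/-- The multiplicity of the values of `℘` off the half periods. -/
lemma analyticOrderAt_weierstrassP_sub_eq_one {a : ℂ} (ha : a ∉ L.lattice)
    (haa : a + a ∉ L.lattice) :
    analyticOrderAt (fun z => L.weierstrassP z - L.weierstrassP a) a = 1 := by
  refine (L.analyticAt_weierstrassP ha).analyticOrderAt_sub_eq_one_of_deriv_ne_zero ?_
  rw [L.deriv_weierstrassP]
  exact fun h => haa ((L.derivWeierstrassP_eq_zero_iff ha).1 h)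

/-- The multiplicity of the values of `℘` at the half periods. -/
lemma analyticOrderAt_weierstrassP_sub_eq_two {a : ℂ} (ha : a ∉ L.lattice)
    (haa : a + a ∈ L.lattice) :
    analyticOrderAt (fun z => L.weierstrassP z - L.weierstrassP a) a = 2 := by
  have hP := L.analyticAt_weierstrassP ha
  rw [← hP.analyticOrderAt_deriv_add_one, L.deriv_weierstrassP]
  have := (L.analyticOnNhd_derivWeierstrassP a ha).analyticOrderAt_sub_eq_one_of_deriv_ne_zero
    (L.deriv_derivWeierstrassP_ne_zero ha haa)
  rw [(L.derivWeierstrassP_eq_zero_iff ha).2 haa] at this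
  simp only [sub_zero] at this
  rw [this]; rfl

/-- `℘` is surjective. -/
lemma exists_weierstrassP_eq (c : ℂ) : ∃ a, a ∉ L.lattice ∧ L.weierstrassP a = c := by
  by_contra! h
  have hm : Meromorphic (fun z => L.weierstrassP z - c) := by fun_prop
  have hm0 : meromorphicOrderAt (fun z => L.weierstrassP z - c) 0 = ((-2 : ℤ) : WithTop ℤ) := by
    have h1 : (0 : WithTop ℤ) ≤ meromorphicOrderAt (fun _ : ℂ => -c) 0 :=
      analyticAt_const.meromorphicOrderAt_nonneg
    have h2 : meromorphicOrderAt L.weierstrassP 0 = ((-2 : ℤ) : WithTop ℤ) :=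
      L.order_weierstrassP 0 (zero_mem _)
    have := meromorphicOrderAt_add_eq_left_of_lt (f₁ := L.weierstrassP) (f₂ := fun _ => -c) (x := 0)
      (by fun_prop) (by
        rw [h2]
        exact lt_of_lt_of_le (WithTop.coe_lt_coe.2 (by norm_num : (-2 : ℤ) < 0)) h1)
    rw [← h2, ← this]
    congr 1
  have hper : ∀ l ∈ L.lattice, ∀ z, L.weierstrassP (z + l) = L.weierstrassP z :=
    fun l hl z => L.weierstrassP_add_coe z ⟨l, hl⟩
  -- If `c` is omitted, `1 / (℘ - c)` is elliptic without poles, hence constant.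
  obtain ⟨k, hk⟩ := L.exists_eq_const_of_order_nonneg (f := fun z => (L.weierstrassP z - c)⁻¹)
    (by fun_prop) (fun l hl z => by rw [hper l hl]) (fun z => by
      by_cases hz : z ∈ L.lattice
      · have := meromorphicOrderAt_comp_add (fun z => (L.weierstrassP z - c)⁻¹) z 0
        simp only [hper z hz, zero_add] at this
        rw [← this, fun_meromorphicOrderAt_inv, hm0]
        exact WithTop.coe_le_coe.2 (by norm_num : (0 : ℤ) ≤ - -2)
      · have := L.analyticAt_weierstrassP hz
        exact ((this.sub analyticAt_const).inv (sub_ne_zero.2 (h z hz))).meromorphicOrderAt_nonneg)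
  refine L.not_eventually_weierstrassP_eq_const 0 (c + k⁻¹) ((hk 0).mono fun z hz => ?_)
  have := congrArg (fun x => x⁻¹) hz
  simp only [inv_inv] at this
  linear_combination this

/-- The reciprocal of `℘` is analytic at the lattice points, with double zeros. -/
lemma analyticAt_inv_weierstrassP {l : ℂ} (hl : l ∈ L.lattice) :
    AnalyticAt ℂ (fun z => (L.weierstrassP z)⁻¹) l ∧
      analyticOrderAt (fun z => (L.weierstrassP z)⁻¹) l = 2 := by
  have ho : meromorphicOrderAt (fun z => (L.weierstrassP z)⁻¹) l = ((2 : ℤ) : WithTop ℤ) := by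
    rw [fun_meromorphicOrderAt_inv, L.order_weierstrassP l hl]; rfl
  have ha : AnalyticAt ℂ (fun z => (L.weierstrassP z)⁻¹) l := by
    refine AnalyticAt.of_meromorphicOrderAt_pos ?_ ?_
    · rw [ho]; exact WithTop.coe_lt_coe.2 (by norm_num : (0 : ℤ) < 2)
    -- The conventional value `℘ l = 0` gives the reciprocal the value `0`, which is its true limit.
    · rw [L.weierstrassP_coe ⟨l, hl⟩, inv_zero]
  refine ⟨ha, ?_⟩
  rw [ha.meromorphicOrderAt_eq] at ho
  generalize analyticOrderAt (fun z => (L.weierstrassP z)⁻¹) l = n at ho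
  induction n with
  | top => exact absurd ho.symm WithTop.coe_ne_top
  | coe n =>
    have : (n : ℤ) = 2 := WithTop.coe_injective ho
    have : n = 2 := by omega
    rw [this]; rfl

lemma countable_lattice : (L.lattice : Set ℂ).Countable := by
  refine (countable_range fun p : ℤ × ℤ => (p.1 * L.ω₁ + p.2 * L.ω₂ : ℂ)).mono ?_
  intro x hx
  obtain ⟨m, n, h⟩ := mem_lattice.1 hx
  exact ⟨(m, n), h⟩

/-- The set of points where `℘` takes a given value is countable. -/
lemma countable_weierstrassP_fiber (c : ℂ) : {z | L.weierstrassP z = c}.Countable := by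
  obtain ⟨a, ha, rfl⟩ := L.exists_weierstrassP_eq c
  refine (L.countable_lattice.union ((L.countable_lattice.image fun z => z + a).union
    (L.countable_lattice.image fun z => z - a))).mono ?_
  intro z hz
  by_cases hzL : z ∈ L.lattice
  · exact Or.inl hzL
  · right
    rcases (L.weierstrassP_eq_iff hzL ha).1 hz with h | h
    · exact Or.inl ⟨_, h, by simp⟩
    · exact Or.inr ⟨_, h, by simp⟩

end PeriodPair

noncomputable section

namespace TorusLump

/-! ### Homogeneous coordinates on the sphere -/

/-- The point of the sphere with homogeneous coordinates `[y₁ : y₂]`. -/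
def ofHomog (y₁ y₂ : ℂ) : OnePoint ℂ := if y₂ = 0 then OnePoint.infty else ((y₁ / y₂ : ℂ))

lemma coord_infty : coord OnePoint.infty = 0 := rfl

lemma coord_coe (w : ℂ) : coord (w : OnePoint ℂ) = w := rfl

lemma recipCoord_infty : recipCoord OnePoint.infty = 0 := rfl

lemma recipCoord_coe (w : ℂ) : recipCoord (w : OnePoint ℂ) = w⁻¹ := rfl

lemma coord_ofHomog (y₁ y₂ : ℂ) : coord (ofHomog y₁ y₂) = y₁ / y₂ := by
  unfold ofHomog
  split_ifs with h
  · simp [h, coord_infty]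
  · rw [coord_coe]

lemma recipCoord_ofHomog (y₁ y₂ : ℂ) : recipCoord (ofHomog y₁ y₂) = y₂ / y₁ := by
  unfold ofHomog
  split_ifs with h
  · simp [h, recipCoord_infty]
  · rw [recipCoord_coe, inv_div]

lemma ofHomog_eq_infty {y₁ y₂ : ℂ} : ofHomog y₁ y₂ = OnePoint.infty ↔ y₂ = 0 := by
  unfold ofHomog; split_ifs with h <;> simp [h]

lemma ofHomog_ne_zero {y₁ y₂ : ℂ} (h : ofHomog y₁ y₂ ≠ ((0 : ℂ) : OnePoint ℂ))
    (h0 : y₁ ≠ 0 ∨ y₂ ≠ 0) : y₁ ≠ 0 := by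
  rintro rfl
  have h2 : y₂ ≠ 0 := by simpa using h0
  simp [ofHomog, h2] at h

lemma ofHomog_one (w : ℂ) : ofHomog w 1 = (w : OnePoint ℂ) := by simp [ofHomog]

lemma smul_ofHomog (M : SL(2, ℂ)) {y₁ y₂ : ℂ} (h : y₁ ≠ 0 ∨ y₂ ≠ 0) :
    (M : GL (Fin 2) ℂ) • ofHomog y₁ y₂ =
      ofHomog (M 0 0 * y₁ + M 0 1 * y₂) (M 1 0 * y₁ + M 1 1 * y₂) := by
  have hM : ∀ i j, (M : GL (Fin 2) ℂ) i j = M i j := fun _ _ => rfl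
  by_cases h2 : y₂ = 0
  · have h1 : y₁ ≠ 0 := by simpa [h2] using h
    subst h2
    rw [ofHomog, if_pos rfl, OnePoint.smul_infty_eq_ite, ofHomog]
    simp only [hM, mul_zero, add_zero, mul_eq_zero, h1, or_false]
    split_ifs with h3
    · rfl
    · congr 1; field_simp
  · rw [ofHomog, if_neg h2, OnePoint.smul_some_eq_ite, ofHomog]
    have e : ∀ a b : ℂ, a * (y₁ / y₂) + b = (a * y₁ + b * y₂) / y₂ := fun a b => by field_simp
    simp only [hM, e, div_eq_zero_iff, h2, or_false]
    split_ifs with h3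
    · rfl
    · congr 1; field_simp

lemma SL_mulVec_ne_zero (M : SL(2, ℂ)) {y₁ y₂ : ℂ} (h : y₁ ≠ 0 ∨ y₂ ≠ 0) :
    M 0 0 * y₁ + M 0 1 * y₂ ≠ 0 ∨ M 1 0 * y₁ + M 1 1 * y₂ ≠ 0 := by
  have hd : M 0 0 * M 1 1 - M 0 1 * M 1 0 = 1 := by
    have := M.2; rwa [Matrix.det_fin_two] at this
  by_contra! hc
  have e1 : y₁ = 0 := by linear_combination (-y₁) * hd + M 1 1 * hc.1 - M 0 1 * hc.2
  have e2 : y₂ = 0 := by linear_combination (-y₂) * hd + M 0 0 * hc.2 - M 1 0 * hc.1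
  rcases h with h | h
  · exact h e1
  · exact h e2

/-- `W` is given near `z₀` by the analytic homogeneous coordinates `[y₁ : y₂]`. -/
structure HasHomogLift (W : ℂ → OnePoint ℂ) (y₁ y₂ : ℂ → ℂ) (z₀ : ℂ) : Prop where
  fst : AnalyticAt ℂ y₁ z₀
  snd : AnalyticAt ℂ y₂ z₀
  ne_zero : y₁ z₀ ≠ 0 ∨ y₂ z₀ ≠ 0
  eq : ∀ᶠ z in 𝓝 z₀, W z = ofHomog (y₁ z) (y₂ z)

namespace HasHomogLift

variable {W : ℂ → OnePoint ℂ} {y₁ y₂ : ℂ → ℂ} {z₀ : ℂ}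

lemma eventually_ne_zero (h : HasHomogLift W y₁ y₂ z₀) : ∀ᶠ z in 𝓝 z₀, y₁ z ≠ 0 ∨ y₂ z ≠ 0 := by
  rcases h.ne_zero with h1 | h1
  · exact (h.fst.continuousAt.eventually_ne h1).mono fun z hz => Or.inl hz
  · exact (h.snd.continuousAt.eventually_ne h1).mono fun z hz => Or.inr hz

lemma analyticAt_coord (h : HasHomogLift W y₁ y₂ z₀) (hW : W z₀ ≠ OnePoint.infty) :
    AnalyticAt ℂ (fun z => coord (W z)) z₀ := by
  rw [h.eq.self_of_nhds, Ne, ofHomog_eq_infty] at hW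
  refine (h.fst.div h.snd hW).congr ?_
  filter_upwards [h.eq] with z hz
  rw [hz, coord_ofHomog]; rfl

lemma analyticAt_recipCoord (h : HasHomogLift W y₁ y₂ z₀)
    (hW : W z₀ ≠ ((0 : ℂ) : OnePoint ℂ)) : AnalyticAt ℂ (fun z => recipCoord (W z)) z₀ := by
  rw [h.eq.self_of_nhds] at hW
  refine (h.snd.div h.fst (ofHomog_ne_zero hW h.ne_zero)).congr ?_
  filter_upwards [h.eq] with z hz
  rw [hz, recipCoord_ofHomog]; rfl

/-- The multiplicity of a pole is the order of vanishing of the second coordinate. -/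
lemma order_recipCoord (h : HasHomogLift W y₁ y₂ z₀) (hW : W z₀ = OnePoint.infty) :
    analyticOrderAt (fun z => recipCoord (W z)) z₀ = analyticOrderAt y₂ z₀ := by
  rw [h.eq.self_of_nhds, ofHomog_eq_infty] at hW
  have h1 : y₁ z₀ ≠ 0 := by simpa [hW] using h.ne_zero
  have hi : AnalyticAt ℂ (fun z => (y₁ z)⁻¹) z₀ := h.fst.inv h1
  have : (fun z => recipCoord (W z)) =ᶠ[𝓝 z₀] y₂ * fun z => (y₁ z)⁻¹ := by
    filter_upwards [h.eq] with z hz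
    rw [hz, recipCoord_ofHomog]; rfl
  rw [analyticOrderAt_congr this, analyticOrderAt_mul h.snd hi,
    hi.analyticOrderAt_eq_zero.2 (inv_ne_zero h1), add_zero]

lemma continuousAt (h : HasHomogLift W y₁ y₂ z₀) : ContinuousAt W z₀ := by
  refine ContinuousAt.congr (f := fun z => ofHomog (y₁ z) (y₂ z)) ?_
    (h.eq.mono fun z hz => hz.symm)
  by_cases h2 : y₂ z₀ = 0
  · have h1 : y₁ z₀ ≠ 0 := by simpa [h2] using h.ne_zero
    have he : ofHomog (y₁ z₀) (y₂ z₀) = OnePoint.infty := ofHomog_eq_infty.2 h2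
    unfold ContinuousAt
    simp only [he]
    intro s hs
    rw [OnePoint.nhds_infty_eq, mem_sup, mem_map, coclosedCompact_eq_cocompact,
      ← Metric.cobounded_eq_cocompact] at hs
    obtain ⟨hs1, hs2⟩ := hs
    obtain ⟨R, -, hR⟩ := (Metric.hasBasis_cobounded_compl_closedBall (0 : ℂ)).mem_iff.1 hs1
    have ht : Tendsto (fun z => (|R| + 1) * ‖y₂ z‖) (𝓝 z₀) (𝓝 0) := by
      have := (h.snd.continuousAt.norm.tendsto).const_mul (|R| + 1)
      simpa [h2] using this
    have h3 : ∀ᶠ z in 𝓝 z₀, (|R| + 1) * ‖y₂ z‖ < ‖y₁ z‖ :=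
      ht.eventually_lt h.fst.continuousAt.norm.tendsto (by simpa using h1)
    rw [mem_map]
    filter_upwards [h3] with z hz
    rw [mem_preimage]
    by_cases hz2 : y₂ z = 0
    · rw [ofHomog_eq_infty.2 hz2]; simpa using hs2
    · rw [ofHomog, if_neg hz2]
      apply hR
      have hp : 0 < ‖y₂ z‖ := norm_pos_iff.2 hz2
      simp only [mem_compl_iff, Metric.mem_closedBall, dist_zero_right, not_le, norm_div]
      rw [lt_div_iff₀ hp]
      nlinarith [le_abs_self R]
  · have he : (fun z => ofHomog (y₁ z) (y₂ z)) =ᶠ[𝓝 z₀] fun z => ((y₁ z / y₂ z : ℂ)) := by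
      filter_upwards [h.snd.continuousAt.eventually_ne h2] with z hz
      rw [ofHomog, if_neg hz]
    refine ContinuousAt.congr ?_ he.symm
    exact OnePoint.continuous_coe.continuousAt.comp (h.fst.continuousAt.div h.snd.continuousAt h2)

lemma smul (h : HasHomogLift W y₁ y₂ z₀) (M : SL(2, ℂ)) :
    HasHomogLift (fun z => (M : GL (Fin 2) ℂ) • W z) (fun z => M 0 0 * y₁ z + M 0 1 * y₂ z)
      (fun z => M 1 0 * y₁ z + M 1 1 * y₂ z) z₀ where
  fst := by have := h.fst; have := h.snd; fun_prop
  snd := by have := h.fst; have := h.snd; fun_prop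
  ne_zero := SL_mulVec_ne_zero M h.ne_zero
  eq := by
    filter_upwards [h.eq, h.eventually_ne_zero] with z hz hz0
    rw [hz, smul_ofHomog M hz0]

lemma comp_sub {s : ℂ} (h : HasHomogLift W y₁ y₂ (z₀ - s)) :
    HasHomogLift (fun z => W (z - s)) (fun z => y₁ (z - s)) (fun z => y₂ (z - s)) z₀ where
  fst := h.fst.fun_comp (f := fun z => z - s) (by fun_prop)
  snd := h.snd.fun_comp (f := fun z => z - s) (by fun_prop)
  ne_zero := h.ne_zero
  eq := by
    have : Tendsto (fun z : ℂ => z - s) (𝓝 z₀) (𝓝 (z₀ - s)) := by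
      have : ContinuousAt (fun z : ℂ => z - s) z₀ := by fun_prop
      exact this
    exact this.eventually h.eq

end HasHomogLift

/-! ### `℘` as a map to the sphere -/

lemma wp_of_mem {z : ℂ} (hz : z ∈ squarePeriods.lattice) : wp z = OnePoint.infty := if_pos hz

lemma wp_of_notMem {z : ℂ} (hz : z ∉ squarePeriods.lattice) :
    wp z = (squarePeriods.weierstrassP z : ℂ) := if_neg hz

lemma wp_add {l : ℂ} (hl : l ∈ squarePeriods.lattice) (z : ℂ) : wp (z + l) = wp z := by
  by_cases hz : z ∈ squarePeriods.lattice
  · rw [wp_of_mem hz, wp_of_mem (add_mem hz hl)]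
  · rw [wp_of_notMem hz, wp_of_notMem (fun h => hz (by simpa using sub_mem h hl))]
    exact congrArg _ (squarePeriods.weierstrassP_add_coe z ⟨l, hl⟩)

lemma wp_lift_of_notMem {z : ℂ} (hz : z ∉ squarePeriods.lattice) :
    HasHomogLift wp squarePeriods.weierstrassP (fun _ => 1) z where
  fst := squarePeriods.analyticAt_weierstrassP hz
  snd := analyticAt_const
  ne_zero := Or.inr one_ne_zero
  eq := by
    filter_upwards [squarePeriods.eventually_notMem_lattice hz] with y hy
    rw [wp_of_notMem hy, ofHomog_one]

lemma wp_lift_of_mem {z : ℂ} (hz : z ∈ squarePeriods.lattice) :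
    HasHomogLift wp (fun _ => 1) (fun z => (squarePeriods.weierstrassP z)⁻¹) z where
  fst := analyticAt_const
  snd := (squarePeriods.analyticAt_inv_weierstrassP hz).1
  ne_zero := Or.inl one_ne_zero
  eq := by
    have h1 := (squarePeriods.meromorphic_weierstrassP z)
    have h2 : ∀ᶠ y in 𝓝[≠] z, squarePeriods.weierstrassP y ≠ 0 :=
      (meromorphicOrderAt_ne_top_iff_eventually_ne_zero h1).1
        (squarePeriods.order_weierstrassP_ne_top z)
    have h3 := squarePeriods.compl_lattice_sdiff_singleton_mem_nhds z
    rw [eventually_nhdsWithin_iff] at h2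
    filter_upwards [h2, h3] with y hy hy'
    by_cases hyz : y = z
    · subst hyz
      rw [wp_of_mem hz, squarePeriods.weierstrassP_coe ⟨y, hz⟩, inv_zero]
      exact (ofHomog_eq_infty.2 rfl).symm
    · have hyL : y ∉ squarePeriods.lattice := fun h => hy' ⟨h, hyz⟩
      rw [wp_of_notMem hyL, ofHomog, if_neg (inv_ne_zero (hy hyz)), one_div, inv_inv]

lemma exists_wp_lift (z : ℂ) : ∃ y₁ y₂, HasHomogLift wp y₁ y₂ z := by
  by_cases hz : z ∈ squarePeriods.lattice
  · exact ⟨_, _, wp_lift_of_mem hz⟩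
  · exact ⟨_, _, wp_lift_of_notMem hz⟩

/-- Homogeneous coordinates treat poles and other points alike: continuity and holomorphy of `M ⊙
℘(· - s)` both follow from such a lift. -/
lemma exists_orbitMap_lift (M : SL(2, ℂ)) (s z : ℂ) :
    ∃ y₁ y₂, HasHomogLift (orbitMap M s) y₁ y₂ z := by
  obtain ⟨y₁, y₂, h⟩ := exists_wp_lift (z - s)
  exact ⟨_, _, (h.comp_sub (z₀ := z)).smul M⟩

lemma continuous_orbitMap (M : SL(2, ℂ)) (s : ℂ) : Continuous (orbitMap M s) :=
  continuous_iff_continuousAt.2 fun z => by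
    obtain ⟨y₁, y₂, h⟩ := exists_orbitMap_lift M s z
    exact h.continuousAt

lemma orbitMap_add (M : SL(2, ℂ)) (s : ℂ) {l : ℂ} (hl : l ∈ squarePeriods.lattice) (z : ℂ) :
    orbitMap M s (z + l) = orbitMap M s z := by
  unfold orbitMap
  rw [← wp_add hl (z - s)]
  congr 2; ring

lemma one_mem_lattice : (1 : ℂ) ∈ squarePeriods.lattice := squarePeriods.ω₁_mem_lattice
lemma I_mem_lattice : Complex.I ∈ squarePeriods.lattice := squarePeriods.ω₂_mem_lattice

lemma mem_lattice_iff {x : ℂ} :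
    x ∈ squarePeriods.lattice ↔ ∃ m n : ℤ, x.re = m ∧ x.im = n := by
  rw [PeriodPair.mem_lattice]
  constructor
  · rintro ⟨m, n, rfl⟩
    exact ⟨m, n, by simp [squarePeriods], by simp [squarePeriods]⟩
  · rintro ⟨m, n, h1, h2⟩
    exact ⟨m, n, by apply Complex.ext <;> simp [squarePeriods, h1, h2]⟩

/-- Every point has a translate in the period square. -/
lemma exists_mem_unitCell (x : ℂ) : ∃ y ∈ unitCell, y - x ∈ squarePeriods.lattice := by
  refine ⟨⟨Int.fract x.re, Int.fract x.im⟩, ?_, ?_⟩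
  · exact ⟨⟨Int.fract_nonneg _, Int.fract_lt_one _⟩, ⟨Int.fract_nonneg _, Int.fract_lt_one _⟩⟩
  · rw [mem_lattice_iff]
    refine ⟨-⌊x.re⌋, -⌊x.im⌋, ?_, ?_⟩
    · have := Int.self_sub_floor x.re
      simp only [Complex.sub_re]; push_cast; linarith
    · have := Int.self_sub_floor x.im
      simp only [Complex.sub_im]; push_cast; linarith

lemma eq_of_mem_unitCell {x y : ℂ} (hx : x ∈ unitCell) (hy : y ∈ unitCell)
    (h : x - y ∈ squarePeriods.lattice) : x = y := by
  obtain ⟨m, n, h1, h2⟩ := mem_lattice_iff.1 h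
  obtain ⟨⟨a1, a2⟩, ⟨a3, a4⟩⟩ := hx
  obtain ⟨⟨b1, b2⟩, ⟨b3, b4⟩⟩ := hy
  simp only [Complex.sub_re, Complex.sub_im] at h1 h2
  have hm : m = 0 := by
    have l1 : (m : ℝ) < 1 := by linarith
    have l2 : (-1 : ℝ) < m := by linarith
    have l1' : m < 1 := by exact_mod_cast l1
    have l2' : -1 < m := by exact_mod_cast l2
    omega
  have hn : n = 0 := by
    have l1 : (n : ℝ) < 1 := by linarith
    have l2 : (-1 : ℝ) < n := by linarith
    have l1' : n < 1 := by exact_mod_cast l1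
    have l2' : -1 < n := by exact_mod_cast l2
    omega
  subst hm; subst hn
  apply Complex.ext
  · simpa [sub_eq_zero] using h1
  · simpa [sub_eq_zero] using h2

/-- The poles of `M ⊙ ℘(· - s)`, with their multiplicities. -/
lemma exists_orbitMap_poles (M : SL(2, ℂ)) (s : ℂ) : ∃ a : ℂ,
    (∀ z, orbitMap M s z = OnePoint.infty ↔
      z - s - a ∈ squarePeriods.lattice ∨ z - s + a ∈ squarePeriods.lattice) ∧
    (∀ z, orbitMap M s z = OnePoint.infty → a + a ∈ squarePeriods.lattice →
      analyticOrderAt (fun y => recipCoord (orbitMap M s y)) z = 2) ∧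
    (∀ z, orbitMap M s z = OnePoint.infty → a + a ∉ squarePeriods.lattice →
      analyticOrderAt (fun y => recipCoord (orbitMap M s y)) z = 1) := by
  have hd : M 0 0 * M 1 1 - M 0 1 * M 1 0 = 1 := by
    have := M.2; rwa [Matrix.det_fin_two] at this
  have hlift : ∀ z, z - s ∉ squarePeriods.lattice → HasHomogLift (orbitMap M s) _ _ z := fun z hz =>
    ((wp_lift_of_notMem hz).comp_sub (z₀ := z)).smul M
  have hlift' : ∀ z, z - s ∈ squarePeriods.lattice → HasHomogLift (orbitMap M s) _ _ z :=
    fun z hz => ((wp_lift_of_mem hz).comp_sub (z₀ := z)).smul M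
  have horder : ∀ (f : ℂ → ℂ) (k z : ℂ), k ≠ 0 → AnalyticAt ℂ f (z - s) →
      analyticOrderAt (fun y => k * f (y - s)) z = analyticOrderAt f (z - s) := by
    intro f k z hk hf
    have h1 : AnalyticAt ℂ (fun y => f (y - s)) z :=
      hf.fun_comp (f := fun y => y - s) (by fun_prop)
    have h2 := analyticOrderAt_comp_of_deriv_ne_zero (f := f) (g := fun y => y - s) (z₀ := z)
      (by fun_prop) (by simp)
    rw [show (fun y => k * f (y - s)) = (fun _ => k) * (f ∘ fun y => y - s) from rfl,
      analyticOrderAt_mul analyticAt_const (show AnalyticAt ℂ (f ∘ fun y => y - s) z from h1), h2,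
      analyticAt_const.analyticOrderAt_eq_zero.2 hk, zero_add]
  -- If `M` fixes `∞`, the poles are the double poles of `℘(· - s)` and `a = 0`. Otherwise they are
  -- the solutions of `℘(z - s) = -(M 1 1 / M 1 0)`, and `a` comes from surjectivity of `℘`.
  by_cases hc : M 1 0 = 0
  · have h11 : M 1 1 ≠ 0 := by rintro h; simp [h, hc] at hd
    have hiff : ∀ z, orbitMap M s z = OnePoint.infty ↔ z - s ∈ squarePeriods.lattice := by
      intro z
      by_cases hz : z - s ∈ squarePeriods.lattice
      · rw [(hlift' z hz).eq.self_of_nhds, ofHomog_eq_infty,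
          squarePeriods.weierstrassP_coe ⟨_, hz⟩]
        simp [hc, hz]
      · rw [(hlift z hz).eq.self_of_nhds, ofHomog_eq_infty]
        simp [hc, hz, h11]
    refine ⟨0, fun z => by simp [hiff], fun z hz _ => ?_, fun z hz h => absurd (by simp) h⟩
    have hz' := (hiff z).1 hz
    rw [(hlift' z hz').order_recipCoord hz]
    simp only [hc, zero_mul, zero_add]
    rw [horder _ _ _ h11 (squarePeriods.analyticAt_inv_weierstrassP hz').1,
      (squarePeriods.analyticAt_inv_weierstrassP hz').2]
  · obtain ⟨a, ha, hac⟩ := squarePeriods.exists_weierstrassP_eq (-(M 1 1 / M 1 0))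
    have hiff : ∀ z, orbitMap M s z = OnePoint.infty ↔ z - s ∉ squarePeriods.lattice ∧
        squarePeriods.weierstrassP (z - s) = squarePeriods.weierstrassP a := by
      intro z
      by_cases hz : z - s ∈ squarePeriods.lattice
      · rw [(hlift' z hz).eq.self_of_nhds, ofHomog_eq_infty,
          squarePeriods.weierstrassP_coe ⟨_, hz⟩]
        simp [hc, hz]
      · rw [(hlift z hz).eq.self_of_nhds, ofHomog_eq_infty, hac]
        simp only [mul_one, hz, not_false_eq_true, true_and]
        constructor
        · intro h; field_simp; linear_combination h
        · intro h; rw [h]; field_simp; ring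
    have hord : ∀ z, z - s ∉ squarePeriods.lattice →
        squarePeriods.weierstrassP (z - s) = squarePeriods.weierstrassP a →
        orbitMap M s z = OnePoint.infty →
        analyticOrderAt (fun y => recipCoord (orbitMap M s y)) z = analyticOrderAt
          (fun y => squarePeriods.weierstrassP y - squarePeriods.weierstrassP (z - s)) (z - s) := by
      intro z hz hza hinf
      refine ((hlift z hz).order_recipCoord hinf).trans (Eq.trans ?_ (horder
        (fun y => squarePeriods.weierstrassP y - squarePeriods.weierstrassP (z - s)) (M 1 0) z hc
        ((squarePeriods.analyticAt_weierstrassP hz).sub analyticAt_const)))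
      congr 1
      ext y
      rw [hza, hac]; field_simp; ring
    -- The half periods are the zeros of `℘'`, and `℘'²` is a function of `℘`: points with equal
    -- values are half periods simultaneously.
    have hdouble : ∀ z, orbitMap M s z = OnePoint.infty →
        ((z - s) + (z - s) ∈ squarePeriods.lattice ↔ a + a ∈ squarePeriods.lattice) := by
      intro z hz
      obtain ⟨h1, h2⟩ := (hiff z).1 hz
      rw [← squarePeriods.derivWeierstrassP_eq_zero_iff h1,
        ← squarePeriods.derivWeierstrassP_eq_zero_iff ha, ← sq_eq_zero_iff,
        ← sq_eq_zero_iff (a := squarePeriods.derivWeierstrassP a),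
        squarePeriods.derivWeierstrassP_sq _ h1, squarePeriods.derivWeierstrassP_sq _ ha, h2]
    refine ⟨a, fun z => ?_, fun z hz haa => ?_, fun z hz haa => ?_⟩
    · rw [hiff]
      constructor
      · rintro ⟨h1, h2⟩
        exact (squarePeriods.weierstrassP_eq_iff h1 ha).1 h2
      · intro h
        have h1 : z - s ∉ squarePeriods.lattice := by
          intro h1
          rcases h with h | h
          · exact ha (by simpa using sub_mem h1 h)
          · exact ha (by simpa using sub_mem h h1)
        exact ⟨h1, (squarePeriods.weierstrassP_eq_iff h1 ha).2 h⟩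
    · obtain ⟨h1, h2⟩ := (hiff z).1 hz
      rw [hord z h1 h2 hz]
      exact squarePeriods.analyticOrderAt_weierstrassP_sub_eq_two h1 ((hdouble z hz).2 haa)
    · obtain ⟨h1, h2⟩ := (hiff z).1 hz
      rw [hord z h1 h2 hz]
      exact squarePeriods.analyticOrderAt_weierstrassP_sub_eq_one h1
        (fun h => haa ((hdouble z hz).1 h))

/-- The poles in the cell represent `s + a` and `s - a`. They coincide exactly when `2 a` is a
period, and this is also when they are double. -/
lemma ellipticDegree_orbitMap (M : SL(2, ℂ)) (s : ℂ) : ellipticDegree (orbitMap M s) = 2 := by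
  obtain ⟨a, hpole, h2, h1⟩ := exists_orbitMap_poles M s
  obtain ⟨p, hp, hpa⟩ := exists_mem_unitCell (s + a)
  obtain ⟨q, hq, hqa⟩ := exists_mem_unitCell (s - a)
  have hset : {z | z ∈ unitCell ∧ orbitMap M s z = OnePoint.infty} = {p, q} := by
    ext z
    simp only [mem_ofPred_eq, hpole, mem_insert_iff, mem_singleton_iff]
    constructor
    · rintro ⟨hz, h | h⟩
      · left
        refine eq_of_mem_unitCell hz hp ?_
        have := sub_mem h hpa
        convert this using 1; ring
      · right
        refine eq_of_mem_unitCell hz hq ?_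
        have := sub_mem h hqa
        convert this using 1; ring
    · rintro (rfl | rfl)
      · refine ⟨hp, Or.inl ?_⟩
        convert hpa using 1; ring
      · refine ⟨hq, Or.inr ?_⟩
        convert hqa using 1; ring
  have hpi : orbitMap M s p = OnePoint.infty :=
    (hset.ge (by simp : p ∈ ({p, q} : Set ℂ))).2
  have hqi : orbitMap M s q = OnePoint.infty :=
    (hset.ge (by simp : q ∈ ({p, q} : Set ℂ))).2
  have hpq : p = q ↔ a + a ∈ squarePeriods.lattice := by
    constructor
    · rintro rfl
      have := sub_mem hqa hpa
      convert this using 1; ring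
    · intro h
      refine eq_of_mem_unitCell hp hq ?_
      have := add_mem (sub_mem hpa hqa) h
      convert this using 1; ring
  unfold ellipticDegree
  rw [hset]
  by_cases haa : a + a ∈ squarePeriods.lattice
  · obtain rfl := hpq.2 haa
    rw [pair_eq_singleton, finsum_mem_singleton, h2 p hpi haa]
  · rw [finsum_mem_pair (fun h => haa (hpq.1 h)), h1 p hpi haa, h1 q hqi haa]
    rfl

/-- The orbit map of `SL(2, ℂ) × ℂ` as a map to the moduli space. -/
def lump (M : SL(2, ℂ)) (s : ℂ) : ModuliSpace :=
  ⟨⟨orbitMap M s, continuous_orbitMap M s⟩, fun z => orbitMap_add M s one_mem_lattice z,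
    fun z => orbitMap_add M s I_mem_lattice z,
    ⟨fun z hz => by
      obtain ⟨y₁, y₂, h⟩ := exists_orbitMap_lift M s z
      exact h.analyticAt_coord hz, fun z hz => by
      obtain ⟨y₁, y₂, h⟩ := exists_orbitMap_lift M s z
      exact h.analyticAt_recipCoord hz⟩, ellipticDegree_orbitMap M s⟩

lemma lump_apply (M : SL(2, ℂ)) (s z : ℂ) : (lump M s).1 z = orbitMap M s z := rfl

/-! ### Transitivity of the action -/

lemma coord_eq_inv_recipCoord (p : OnePoint ℂ) : coord p = (recipCoord p)⁻¹ := by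
  induction p using OnePoint.rec with
  | infty => simp [coord_infty, recipCoord_infty]
  | coe w => simp [coord_coe, recipCoord_coe]

lemma coe_coord {p : OnePoint ℂ} (hp : p ≠ OnePoint.infty) : (coord p : OnePoint ℂ) = p := by
  induction p using OnePoint.rec with
  | infty => exact absurd rfl hp
  | coe w => rfl

lemma ENat.eq_one_of_add_eq_two {m n : ℕ∞} (hm : 1 ≤ m) (hn : 1 ≤ n) (h : m + n = 2) :
    m = 1 ∧ n = 1 := by
  induction m with
  | top => simp at h
  | coe m =>
    induction n with
    | top => simp at h
    | coe n =>
      have e1 : m + n = 2 := by exact_mod_cast h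
      have e2 : 1 ≤ m := by exact_mod_cast hm
      have e3 : 1 ≤ n := by exact_mod_cast hn
      have e4 : m = 1 := by omega
      have e5 : n = 1 := by omega
      simp [e4, e5]

section

variable (W : ModuliSpace)

/-- The poles in the period square. -/
def poles : Set ℂ := {z | z ∈ unitCell ∧ W.1 z = OnePoint.infty}

lemma apply_add {l : ℂ} (hl : l ∈ squarePeriods.lattice) (z : ℂ) : W.1 (z + l) = W.1 z := by
  unfold PeriodPair.lattice at hl
  induction hl using Submodule.span_induction generalizing z with
  | mem x hx =>
    rcases hx with rfl | hx
    · exact W.2.1 z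
    · rw [mem_singleton_iff.1 hx]; exact W.2.2.1 z
  | zero => simp
  | add x y _ _ hx hy => rw [← add_assoc, hy, hx]
  | smul n x _ hx =>
    have hneg : ∀ z, W.1 (z - x) = W.1 z := fun z => by rw [← hx (z - x), sub_add_cancel]
    induction n using Int.induction_on generalizing z with
    | zero => simp
    | succ n ih => rw [add_smul, one_smul, ← add_assoc, hx, ih]
    | pred n ih => rw [sub_smul, one_smul, ← add_sub_assoc, hneg, ih]

lemma analyticAt_recipCoord_of_pole {z : ℂ} (hz : W.1 z = OnePoint.infty) :
    AnalyticAt ℂ (fun y => recipCoord (W.1 y)) z :=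
  W.2.2.2.1.2 z (by simp [hz])

lemma order_recipCoord_ne_zero {z : ℂ} (hz : W.1 z = OnePoint.infty) :
    analyticOrderAt (fun y => recipCoord (W.1 y)) z ≠ 0 := by
  rw [(analyticAt_recipCoord_of_pole W hz).analyticOrderAt_ne_zero, hz, recipCoord_infty]

/-- A `finsum` of infinite support has the value `0`, and every pole has nonzero order; so degree
`2` already forces finiteness. -/
lemma poles_finite : (poles W).Finite := by
  by_contra hinf
  have h2 : ellipticDegree W.1 = 2 := W.2.2.2.2
  unfold ellipticDegree at h2
  rw [finsum_mem_eq_zero_of_infinite] at h2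
  · exact absurd h2 (by norm_num)
  · convert (show (poles W).Infinite from hinf) using 1
    refine inter_eq_left (s := poles W).2 ?_
    intro z hz
    exact order_recipCoord_ne_zero W hz.2

/-- There are two simple poles or one double pole in the period square. -/
lemma poles_cases :
    (∃ p, poles W = {p} ∧ analyticOrderAt (fun y => recipCoord (W.1 y)) p = 2) ∨
    ∃ p q, p ≠ q ∧ poles W = {p, q} ∧ analyticOrderAt (fun y => recipCoord (W.1 y)) p = 1 ∧
      analyticOrderAt (fun y => recipCoord (W.1 y)) q = 1 := by
  have h2 : ellipticDegree W.1 = 2 := W.2.2.2.2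
  unfold ellipticDegree at h2
  have hfin := poles_finite W
  rw [show {z | z ∈ unitCell ∧ W.1 z = OnePoint.infty} = poles W from rfl,
    finsum_mem_eq_finite_toFinset_sum _ hfin] at h2
  set o := fun z => analyticOrderAt (fun y => recipCoord (W.1 y)) z
  have ho : ∀ z ∈ hfin.toFinset, 1 ≤ o z := fun z hz =>
    Order.one_le_iff_ne_zero.2 (order_recipCoord_ne_zero W ((hfin.mem_toFinset).1 hz).2)
  have hcard : hfin.toFinset.card ≤ 2 := by
    have := Finset.card_nsmul_le_sum _ _ 1 ho
    rw [h2] at this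
    simpa using this
  have hcoe : poles W = (hfin.toFinset : Set ℂ) := hfin.coe_toFinset.symm
  have hcases : hfin.toFinset.card = 0 ∨ hfin.toFinset.card = 1 ∨ hfin.toFinset.card = 2 := by
    omega
  rcases hcases with h | h | h
  · rw [Finset.card_eq_zero.1 h] at h2
    simp at h2
  · obtain ⟨p, hp⟩ := Finset.card_eq_one.1 h
    left
    refine ⟨p, by rw [hcoe, hp]; simp, ?_⟩
    rw [hp, Finset.sum_singleton] at h2
    exact h2
  · obtain ⟨p, q, hpq, hp⟩ := Finset.card_eq_two.1 h
    right
    refine ⟨p, q, hpq, by rw [hcoe, hp]; simp, ?_⟩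
    rw [hp, Finset.sum_pair hpq] at h2
    have h3 := ho p (by simp [hp])
    have h4 := ho q (by simp [hp])
    change o p = 1 ∧ o q = 1
    exact ENat.eq_one_of_add_eq_two h3 h4 h2

lemma exists_pole_of_eq_infty {z : ℂ} (hz : W.1 z = OnePoint.infty) :
    ∃ p ∈ poles W, z - p ∈ squarePeriods.lattice := by
  obtain ⟨y, hy, hyz⟩ := exists_mem_unitCell z
  refine ⟨y, ⟨hy, ?_⟩, by simpa using neg_mem hyz⟩
  have := apply_add W hyz z
  rw [add_sub_cancel] at this
  rw [this, hz]

lemma order_recipCoord_ne_top {z : ℂ} (hz : W.1 z = OnePoint.infty) :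
    analyticOrderAt (fun y => recipCoord (W.1 y)) z ≠ ⊤ := by
  intro htop
  have hf := poles_finite W
  obtain ⟨p, hp, hpz⟩ := exists_pole_of_eq_infty W hz
  have h1 := analyticOrderAt_comp_of_deriv_ne_zero (f := fun y => recipCoord (W.1 y))
    (g := fun y => y + (z - p)) (z₀ := p) (by fun_prop) (by simp)
  simp only [Function.comp_def, apply_add W hpz, add_sub_cancel, htop] at h1
  rcases poles_cases W with ⟨a, ha, h2⟩ | ⟨a, b, -, ha, h2, h3⟩
  · rw [ha] at hp
    rw [mem_singleton_iff.1 hp, h2] at h1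
    exact absurd h1 (by norm_num)
  · rw [ha] at hp
    rcases hp with rfl | hp
    · rw [h2] at h1; exact absurd h1 (by norm_num)
    · rw [mem_singleton_iff.1 hp, h3] at h1; exact absurd h1 (by norm_num)

lemma eventually_ne_infty (z : ℂ) : ∀ᶠ y in 𝓝[≠] z, W.1 y ≠ OnePoint.infty := by
  by_cases hz : W.1 z = OnePoint.infty
  · have ha := analyticAt_recipCoord_of_pole W hz
    rcases ha.eventually_eq_zero_or_eventually_ne_zero with h | h
    · exact absurd (analyticOrderAt_eq_top.2 h) (order_recipCoord_ne_top W hz)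
    · filter_upwards [h] with y hy hinf
      apply hy; rw [hinf, recipCoord_infty]
  · exact (W.1.continuous.continuousAt.eventually_ne hz).filter_mono nhdsWithin_le_nhds

lemma meromorphic_coord : Meromorphic (fun z => coord (W.1 z)) := by
  intro z
  by_cases hz : W.1 z = OnePoint.infty
  · have := (analyticAt_recipCoord_of_pole W hz).meromorphicAt.inv
    refine this.congr (Eventually.of_forall fun y => ?_)
    simp [coord_eq_inv_recipCoord]
  · exact (W.2.2.2.1.1 z hz).meromorphicAt

lemma order_coord_nonneg {z : ℂ} (hz : W.1 z ≠ OnePoint.infty) :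
    0 ≤ meromorphicOrderAt (fun z => coord (W.1 z)) z :=
  (W.2.2.2.1.1 z hz).meromorphicOrderAt_nonneg

lemma order_coord_of_pole {z : ℂ} (hz : W.1 z = OnePoint.infty) {n : ℕ}
    (hn : analyticOrderAt (fun y => recipCoord (W.1 y)) z = n) :
    meromorphicOrderAt (fun z => coord (W.1 z)) z = ((-n : ℤ) : WithTop ℤ) := by
  simp only [coord_eq_inv_recipCoord]
  rw [fun_meromorphicOrderAt_inv, (analyticAt_recipCoord_of_pole W hz).meromorphicOrderAt_eq, hn]
  rfl

/-- `W` is determined by a Möbius relation with a translate of `℘` off a discrete set. -/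
lemma exists_eq_lump_of_eventually {a b c d : ℂ} (hdet : a * d - b * c ≠ 0) (s : ℂ)
    (h : ∀ z, ∀ᶠ y in 𝓝[≠] z, coord (W.1 y) * (c * squarePeriods.weierstrassP (y - s) + d) =
      a * squarePeriods.weierstrassP (y - s) + b) :
    ∃ M : SL(2, ℂ), W = lump M s := by
  -- Scaling the matrix by `μ` makes its determinant `1` without changing the Möbius transformation.
  obtain ⟨μ, hμ⟩ := IsAlgClosed.exists_pow_nat_eq (a * d - b * c)⁻¹ (n := 2) (by norm_num)
  have hμ0 : μ ≠ 0 := by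
    rintro rfl
    exact inv_ne_zero hdet (by rw [← hμ]; norm_num)
  refine ⟨⟨!![μ * a, μ * b; μ * c, μ * d], ?_⟩, ?_⟩
  · rw [Matrix.det_fin_two_of]
    have : μ ^ 2 * (a * d - b * c) = 1 := by rw [hμ, inv_mul_cancel₀ hdet]
    linear_combination this
  · apply Subtype.ext
    apply DFunLike.ext'
    set M : SL(2, ℂ) := ⟨!![μ * a, μ * b; μ * c, μ * d], _⟩
    -- Both maps to the sphere are continuous, so agreement on a dense set is enough, and the poles
    -- can be avoided.
    have key : ∀ z, ∃ᶠ y in 𝓝[≠] z, W.1 y = (lump M s).1 y := by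
      intro z
      refine Eventually.frequently ?_
      have t : Tendsto (fun y : ℂ => y - s) (𝓝[≠] z) (𝓝[≠] (z - s)) := by
        refine tendsto_nhdsWithin_iff.2 ⟨?_, ?_⟩
        · have : ContinuousAt (fun y : ℂ => y - s) z := by fun_prop
          exact this.tendsto.mono_left nhdsWithin_le_nhds
        · filter_upwards [self_mem_nhdsWithin] with y hy
          intro h
          exact hy (sub_left_injective h)
      have h1 : ∀ᶠ y in 𝓝[≠] (z - s), y ∉ squarePeriods.lattice := by
        have := squarePeriods.compl_lattice_sdiff_singleton_mem_nhds (z - s)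
        filter_upwards [mem_nhdsWithin_of_mem_nhds this, self_mem_nhdsWithin] with y hy hy2 hyL
        exact hy ⟨hyL, hy2⟩
      have h2 : ∀ᶠ y in 𝓝[≠] (z - s), c * squarePeriods.weierstrassP y + d ≠ 0 := by
        have hm : MeromorphicAt (fun y => c * squarePeriods.weierstrassP y + d) (z - s) := by
          have := squarePeriods.meromorphic_weierstrassP (z - s)
          fun_prop
        rw [← meromorphicOrderAt_ne_top_iff_eventually_ne_zero hm, Ne,
          meromorphicOrderAt_eq_top_iff]
        intro hev
        by_cases hc : c = 0
        · have hd : d ≠ 0 := by rintro rfl; simp [hc] at hdet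
          obtain ⟨y, hy⟩ := hev.exists
          simp [hc, hd] at hy
        · refine squarePeriods.not_eventually_weierstrassP_eq_const (z - s) (-d / c)
            (hev.mono fun y hy => ?_)
          field_simp
          linear_combination hy
      filter_upwards [h z, t.eventually h1, t.eventually h2, eventually_ne_infty W z]
        with y hy1 hy2 hy3 hy4
      have e1 := ((wp_lift_of_notMem hy2).comp_sub (z₀ := y)).smul M
      have e2 := e1.eq.self_of_nhds
      rw [lump_apply]
      refine Eq.trans ?_ e2.symm
      rw [← coe_coord hy4, ← ofHomog_one]
      have m00 : M 0 0 = μ * a := rfl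
      have m01 : M 0 1 = μ * b := rfl
      have m10 : M 1 0 = μ * c := rfl
      have m11 : M 1 1 = μ * d := rfl
      have hne : μ * c * squarePeriods.weierstrassP (y - s) + μ * d * 1 ≠ 0 := by
        have := mul_ne_zero hμ0 hy3
        intro h0; apply this; linear_combination h0
      simp only [m00, m01, m10, m11]
      rw [ofHomog, ofHomog, if_neg one_ne_zero, if_neg hne]
      congr 1
      rw [div_one, eq_div_iff hne]
      linear_combination μ * hy1
    have hd : Dense {y | W.1 y = (lump M s).1 y} := by
      intro z
      rw [mem_closure_iff_frequently]
      exact (key z).filter_mono nhdsWithin_le_nhds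
    exact Continuous.ext_on hd W.1.continuous (lump M s).1.continuous fun y hy => hy

lemma notMem_lattice_of_double {a : ℂ} (h : a + a ∉ squarePeriods.lattice) :
    a ∉ squarePeriods.lattice := fun ha => h (add_mem ha ha)

/-- Subtracting from `W` a multiple of a function `G` with the same poles leaves a constant. -/
lemma exists_coord_eq {G : ℂ → ℂ} (hG : Meromorphic G)
    (hGper : ∀ l ∈ squarePeriods.lattice, ∀ z, G (z + l) = G z) {p q : ℂ} {n : ℤ}
    (hWp : meromorphicOrderAt (fun z => coord (W.1 z)) p = n) (hGp : meromorphicOrderAt G p = n)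
    (hWq : ((-1 : ℤ) : WithTop ℤ) ≤ meromorphicOrderAt (fun z => coord (W.1 z)) q ∨ p = q)
    (hGq : ((-1 : ℤ) : WithTop ℤ) ≤ meromorphicOrderAt G q ∨ p = q)
    (hn : (n = -1 ∧ p ≠ q) ∨ (n = -2 ∧ p = q))
    (hW : ∀ z, z - p ∉ squarePeriods.lattice → z - q ∉ squarePeriods.lattice →
      W.1 z ≠ OnePoint.infty)
    (hGo : ∀ z, z - p ∉ squarePeriods.lattice → z - q ∉ squarePeriods.lattice →
      0 ≤ meromorphicOrderAt G z) :
    ∃ α c : ℂ, α ≠ 0 ∧ ∀ z, ∀ᶠ y in 𝓝[≠] z, coord (W.1 y) = α * G y + c := by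
  have hWm := meromorphic_coord W
  obtain ⟨α, hα, hp⟩ := exists_meromorphicOrderAt_sub_const_mul (hWm p) (hG p) hWp hGp
  have hm : Meromorphic (fun z => coord (W.1 z) - α * G z) := by fun_prop
  have hper : ∀ l ∈ squarePeriods.lattice, ∀ z,
      coord (W.1 (z + l)) - α * G (z + l) = coord (W.1 z) - α * G z := fun l hl z => by
    rw [apply_add W hl, hGper l hl]
  have hsub : ∀ z (m : WithTop ℤ), m ≤ meromorphicOrderAt (fun z => coord (W.1 z)) z →
      m ≤ meromorphicOrderAt G z →
      m ≤ meromorphicOrderAt (fun z => coord (W.1 z) - α * G z) z := by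
    intro z m h1 h2
    have h3 : meromorphicOrderAt (fun y => -α * G y) z = meromorphicOrderAt G z :=
      meromorphicOrderAt_mul_of_ne_zero (g := fun _ => -α) analyticAt_const (neg_ne_zero.2 hα)
    have h4 : MeromorphicAt (fun y => -α * G y) z := by have := hG z; fun_prop
    have h5 := meromorphicOrderAt_add (hWm z) h4
    rw [h3] at h5
    have : (fun z => coord (W.1 z)) + (fun y => -α * G y) =
        fun z => coord (W.1 z) - α * G z := by ext y; simp; ring
    rw [this] at h5
    exact (le_min h1 h2).trans h5
  -- For two simple poles, `α` cancels the one at `p`; for a double pole, it lowers the order to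
  -- one. In both cases at most a simple pole at `q` is left.
  obtain ⟨c, hc⟩ := squarePeriods.exists_eq_const_of_order_ge_neg_one hm hper q (fun z hz => by
    by_cases hzp : z - p ∈ squarePeriods.lattice
    · rcases hn with ⟨rfl, hpq⟩ | ⟨-, rfl⟩
      · have := meromorphicOrderAt_comp_add (fun z => coord (W.1 z) - α * G z) (z - p) p
        simp only [hper _ hzp, add_sub_cancel] at this
        rw [← this]
        simpa using hp
      · exact absurd hzp hz
    · exact hsub z 0 (order_coord_nonneg W (hW z hzp hz)) (hGo z hzp hz)) (by
    rcases hn with ⟨rfl, hpq⟩ | ⟨rfl, rfl⟩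
    · exact hsub q _ (hWq.resolve_right hpq) (hGq.resolve_right hpq)
    · simpa using hp)
  refine ⟨α, c, hα, fun z => ?_⟩
  filter_upwards [hc z] with y hy
  linear_combination hy

/-- `PSL(2, ℂ) × T²` acts transitively on `M₂`. -/
theorem exists_eq_lump : ∃ (M : SL(2, ℂ)) (s : ℂ), W = lump M s := by
  have hPper : ∀ l ∈ squarePeriods.lattice, ∀ z,
      squarePeriods.weierstrassP (z + l) = squarePeriods.weierstrassP z :=
    fun l hl z => squarePeriods.weierstrassP_add_coe z ⟨l, hl⟩
  have hPm : ∀ s, Meromorphic (fun z => squarePeriods.weierstrassP (z - s)) := fun s => by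
    simpa [sub_eq_add_neg] using squarePeriods.meromorphic_weierstrassP.comp_add_const (-s)
  have hPo : ∀ (f : ℂ → ℂ) (s z : ℂ), meromorphicOrderAt (fun z => f (z - s)) z =
      meromorphicOrderAt f (z - s) := fun f s z => by
    simpa [sub_eq_add_neg] using meromorphicOrderAt_comp_add f (-s) z
  rcases poles_cases W with ⟨p, hp, h2⟩ | ⟨p, q, hpq, hp, h1, h1'⟩
  · have hpi : W.1 p = OnePoint.infty := (hp.ge (mem_singleton p)).2
    obtain ⟨α, c, hα, h⟩ := exists_coord_eq W (G := fun z => squarePeriods.weierstrassP (z - p))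
      (hPm p) (fun l hl z => by rw [← hPper l hl (z - p)]; congr 1; ring) (p := p) (q := p) (n := -2)
      (order_coord_of_pole W hpi (n := 2) (by simpa using h2))
      (by rw [hPo, sub_self]; exact squarePeriods.order_weierstrassP 0 (zero_mem _))
      (Or.inr rfl) (Or.inr rfl) (Or.inr ⟨rfl, rfl⟩)
      (fun z hz _ hzi => by
        obtain ⟨p', hp', h⟩ := exists_pole_of_eq_infty W hzi
        rw [hp] at hp'
        rw [mem_singleton_iff.1 hp'] at h
        exact hz h)
      (fun z hz _ => by rw [hPo]; exact squarePeriods.order_weierstrassP_nonneg hz)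
    obtain ⟨M, hM⟩ := exists_eq_lump_of_eventually W (a := α) (b := c) (c := 0) (d := 1)
      (by simpa using hα) p (fun z => by
        filter_upwards [h z] with y hy
        rw [hy]; ring)
    exact ⟨M, p, hM⟩
  · have hpi : W.1 p = OnePoint.infty := (hp.ge (by simp : p ∈ ({p, q} : Set ℂ))).2
    have hqi : W.1 q = OnePoint.infty := (hp.ge (by simp : q ∈ ({p, q} : Set ℂ))).2
    -- With this centre the poles are `s ± a`, which are exactly the poles of `1 / (℘(· - s) - ℘
    -- a)`, both simple because `2 a = p - q` is not a period.
    set s := (p + q) / 2 with hs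
    set a := (p - q) / 2 with ha
    have hps : p - s = a := by rw [hs, ha]; ring
    have hqs : q - s = -a := by rw [hs, ha]; ring
    have haa : a + a ∉ squarePeriods.lattice := by
      intro h
      apply hpq
      refine eq_of_mem_unitCell (hp.ge (by simp : p ∈ ({p, q} : Set ℂ))).1
        (hp.ge (by simp : q ∈ ({p, q} : Set ℂ))).1 ?_
      convert h using 1; rw [ha]; ring
    have haL := notMem_lattice_of_double haa
    set e := squarePeriods.weierstrassP a with he
    have hord1 : ∀ b, b ∉ squarePeriods.lattice → b + b ∉ squarePeriods.lattice →
        squarePeriods.weierstrassP b = e →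
        meromorphicOrderAt (fun z => (squarePeriods.weierstrassP z - e)⁻¹) b =
          ((-1 : ℤ) : WithTop ℤ) := by
      intro b hb hbb hbe
      have han : AnalyticAt ℂ (fun z => squarePeriods.weierstrassP z - e) b :=
        (squarePeriods.analyticAt_weierstrassP hb).sub analyticAt_const
      have ho := squarePeriods.analyticOrderAt_weierstrassP_sub_eq_one hb hbb
      rw [hbe] at ho
      rw [fun_meromorphicOrderAt_inv, han.meromorphicOrderAt_eq, ho]
      rfl
    have hGp : meromorphicOrderAt (fun z => (squarePeriods.weierstrassP (z - s) - e)⁻¹) p =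
        ((-1 : ℤ) : WithTop ℤ) := by
      rw [hPo (fun z => (squarePeriods.weierstrassP z - e)⁻¹), hps]
      exact hord1 a haL haa rfl
    have hGq : meromorphicOrderAt (fun z => (squarePeriods.weierstrassP (z - s) - e)⁻¹) q =
        ((-1 : ℤ) : WithTop ℤ) := by
      rw [hPo (fun z => (squarePeriods.weierstrassP z - e)⁻¹), hqs]
      refine hord1 (-a) (by simpa using haL) ?_ (squarePeriods.weierstrassP_neg a)
      intro h; apply haa; have := neg_mem h; simpa using this
    obtain ⟨α, c, hα, h⟩ := exists_coord_eq W
      (G := fun z => (squarePeriods.weierstrassP (z - s) - e)⁻¹)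
      (by have := hPm s; fun_prop)
      (fun l hl z => by
        rw [← hPper l hl (z - s)]; congr 3; ring) (p := p) (q := q)
      (n := -1)
      (order_coord_of_pole W hpi (n := 1) (by simpa using h1)) hGp
      (Or.inl (order_coord_of_pole W hqi (n := 1) (by simpa using h1')).ge) (Or.inl hGq.ge)
      (Or.inl ⟨rfl, hpq⟩)
      (fun z hz hz' hzi => by
        obtain ⟨p', hp', h⟩ := exists_pole_of_eq_infty W hzi
        rw [hp] at hp'
        rcases hp' with rfl | hp'
        · exact hz h
        · rw [mem_singleton_iff.1 hp'] at h
          exact hz' h)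
      (fun z hz hz' => by
        rw [hPo (fun z => (squarePeriods.weierstrassP z - e)⁻¹)]
        by_cases hzL : z - s ∈ squarePeriods.lattice
        · have han := squarePeriods.analyticAt_inv_weierstrassP hzL
          -- near a lattice point, `(℘ - e)⁻¹ = ℘⁻¹ / (1 - e ℘⁻¹)`
          set r := fun z => (squarePeriods.weierstrassP z)⁻¹ with hr
          have hr0 : r (z - s) = 0 := by
            rw [hr]; simp only [squarePeriods.weierstrassP_coe ⟨_, hzL⟩, inv_zero]
          have h2 : AnalyticAt ℂ (fun z => r z / (1 - e * r z)) (z - s) := by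
            refine han.1.div (by have := han.1; fun_prop) ?_
            rw [hr0]; simp
          have hne : ∀ᶠ y in 𝓝[≠] (z - s), squarePeriods.weierstrassP y ≠ 0 :=
            (meromorphicOrderAt_ne_top_iff_eventually_ne_zero
              (squarePeriods.meromorphic_weierstrassP _)).1
              (squarePeriods.order_weierstrassP_ne_top _)
          have heq : (fun z => (squarePeriods.weierstrassP z - e)⁻¹) =ᶠ[𝓝[≠] (z - s)]
              fun z => r z / (1 - e * r z) := by
            filter_upwards [hne] with y hy
            simp only [hr]
            rw [show 1 - e * (squarePeriods.weierstrassP y)⁻¹ =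
              (squarePeriods.weierstrassP y - e) * (squarePeriods.weierstrassP y)⁻¹ by field_simp,
              div_mul_eq_div_div_swap, div_self (inv_ne_zero hy), one_div]
          rw [meromorphicOrderAt_congr heq]
          exact h2.meromorphicOrderAt_nonneg
        · have hne : squarePeriods.weierstrassP (z - s) - e ≠ 0 := by
            rw [sub_ne_zero, he, Ne, squarePeriods.weierstrassP_eq_iff hzL haL]
            rintro (h | h)
            · apply hz; convert h using 1; rw [← hps]; ring
            · apply hz'; convert h using 1; rw [← neg_neg a, ← hqs]; ring
          exact (((squarePeriods.analyticAt_weierstrassP hzL).sub analyticAt_const).inv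
            hne).meromorphicOrderAt_nonneg)
    obtain ⟨M, hM⟩ := exists_eq_lump_of_eventually W (a := c) (b := α - c * e) (c := 1) (d := -e)
      (by rw [show c * -e - (α - c * e) * 1 = -α by ring]; exact neg_ne_zero.2 hα) s (fun z => by
        have hne : ∀ᶠ y in 𝓝[≠] z, squarePeriods.weierstrassP (y - s) - e ≠ 0 := by
          rw [← meromorphicOrderAt_ne_top_iff_eventually_ne_zero
            (by have := hPm s; exact (this.sub (fun z => MeromorphicAt.const e z)) z)]
          intro htop
          have := Meromorphic.eventually_eq_zero_of_order_eq_top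
            (f := fun y => squarePeriods.weierstrassP (y - s) - e)
            ((hPm s).sub (fun z => MeromorphicAt.const e z)) htop p
          rw [fun_meromorphicOrderAt_inv, this] at hGp
          exact WithTop.coe_ne_top (a := (-1 : ℤ)) hGp.symm
        filter_upwards [h z, hne] with y hy hy'
        rw [hy, show 1 * squarePeriods.weierstrassP (y - s) + -e =
          squarePeriods.weierstrassP (y - s) - e by ring]
        field_simp
        ring)
    exact ⟨M, s, hM⟩

end

lemma lump_add_lattice (M : SL(2, ℂ)) (s : ℂ) {l : ℂ} (hl : l ∈ squarePeriods.lattice) :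
    lump M (s + l) = lump M s := by
  apply Subtype.ext
  ext z
  rw [lump_apply, lump_apply, orbitMap, orbitMap, ← wp_add hl (z - (s + l))]
  congr 2; ring

/-! ### Decomposition of `SL(2, ℂ)` -/

/-- The matrix acting by `w ↦ exp (2 r) (w - c)`. -/
def triMat (r : ℝ) (c : ℂ) : SL(2, ℂ) :=
  ⟨!![(Real.exp r : ℂ), -(Real.exp r * c); 0, (Real.exp (-r) : ℂ)], by
    rw [Matrix.det_fin_two_of, mul_zero, sub_zero, ← Complex.ofReal_mul, ← Real.exp_add]
    simp⟩

/-- Elements of `SU(2)`, in spherical coordinates. -/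
def suMat (θ φ ψ : ℝ) : SL(2, ℂ) :=
  ⟨!![(Real.cos θ : ℂ) * Complex.exp (φ * Complex.I),
      -((Real.sin θ : ℂ) * Complex.exp (-(ψ * Complex.I)));
      (Real.sin θ : ℂ) * Complex.exp (ψ * Complex.I),
      (Real.cos θ : ℂ) * Complex.exp (-(φ * Complex.I))], by
    rw [Matrix.det_fin_two_of, Complex.exp_neg, Complex.exp_neg]
    have h1 := Complex.exp_ne_zero (φ * Complex.I)
    have h2 := Complex.exp_ne_zero (ψ * Complex.I)
    have h3 : (Real.cos θ : ℂ) ^ 2 + (Real.sin θ : ℂ) ^ 2 = 1 := by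
      rw [← Complex.ofReal_pow, ← Complex.ofReal_pow, ← Complex.ofReal_add,
        Real.cos_sq_add_sin_sq, Complex.ofReal_one]
    field_simp
    linear_combination h3⟩

/-- Gram–Schmidt: dividing the first column of `M` by its norm `R` gives the first column of a
unitary `U`, and `U⁻¹ M` is then upper triangular with diagonal `R`, `R⁻¹`. The bound `4 ≥ π` on the
angles is what keeps the rotations of bounded length. -/
lemma exists_eq_suMat_mul_triMat (M : SL(2, ℂ)) : ∃ (θ φ ψ r : ℝ) (c : ℂ),
    |θ| ≤ 4 ∧ |φ| ≤ 4 ∧ |ψ| ≤ 4 ∧ M = suMat θ φ ψ * triMat r c := by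
  have hd : M 0 0 * M 1 1 - M 0 1 * M 1 0 = 1 := by
    have := M.2; rwa [Matrix.det_fin_two] at this
  set a := M 0 0
  set b := M 1 0
  have hpos : 0 < ‖a‖ ^ 2 + ‖b‖ ^ 2 := by
    by_contra! h
    have h1 : ‖a‖ = 0 := by nlinarith [sq_nonneg ‖a‖, sq_nonneg ‖b‖]
    have h2 : ‖b‖ = 0 := by nlinarith [sq_nonneg ‖a‖, sq_nonneg ‖b‖]
    rw [norm_eq_zero] at h1 h2
    simp [h1, h2] at hd
  set R := √(‖a‖ ^ 2 + ‖b‖ ^ 2) with hR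
  have hR0 : 0 < R := Real.sqrt_pos.2 hpos
  have hR2 : R ^ 2 = ‖a‖ ^ 2 + ‖b‖ ^ 2 := Real.sq_sqrt hpos.le
  have haR : ‖a‖ ≤ R := Real.le_sqrt_of_sq_le (by nlinarith [sq_nonneg ‖b‖])
  set θ := Real.arccos (‖a‖ / R) with hθ
  have hcos : Real.cos θ = ‖a‖ / R := Real.cos_arccos
    (by have : 0 ≤ ‖a‖ / R := by positivity
        linarith) ((div_le_one hR0).2 haR)
  have hsin : Real.sin θ = ‖b‖ / R := by
    rw [hθ, Real.sin_arccos, Real.sqrt_eq_iff_mul_self_eq]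
    · field_simp; nlinarith
    · rw [div_pow, sub_nonneg, div_le_one (by positivity)]; nlinarith [sq_nonneg ‖b‖]
    · positivity
  have hea : (‖a‖ : ℂ) * Complex.exp (Complex.arg a * Complex.I) = a :=
    Complex.norm_mul_exp_arg_mul_I a
  have heb : (‖b‖ : ℂ) * Complex.exp (Complex.arg b * Complex.I) = b :=
    Complex.norm_mul_exp_arg_mul_I b
  have hpi : Real.pi ≤ 4 := Real.pi_le_four
  have hRC : (R : ℂ) ≠ 0 := by exact_mod_cast hR0.ne'
  have hexp : Real.exp (Real.log R) = R := Real.exp_log hR0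
  have hexp' : Real.exp (-Real.log R) = R⁻¹ := by rw [Real.exp_neg, hexp]
  set U := suMat θ (Complex.arg a) (Complex.arg b) with hU
  have u00 : U 0 0 = a / R := by
    change (Real.cos θ : ℂ) * Complex.exp (Complex.arg a * Complex.I) = _
    rw [hcos, Complex.ofReal_div, div_mul_eq_mul_div, hea]
  have u10 : U 1 0 = b / R := by
    change (Real.sin θ : ℂ) * Complex.exp (Complex.arg b * Complex.I) = _
    rw [hsin, Complex.ofReal_div, div_mul_eq_mul_div, heb]
  have hUd : U 0 0 * U 1 1 - U 0 1 * U 1 0 = 1 := by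
    have := U.2; rwa [Matrix.det_fin_two] at this
  refine ⟨θ, Complex.arg a, Complex.arg b, Real.log R,
    -(U 1 1 * M 0 1 - U 0 1 * M 1 1) / R, ?_, ?_, ?_, ?_⟩
  · rw [abs_of_nonneg (Real.arccos_nonneg _)]; exact (Real.arccos_le_pi _).trans hpi
  · exact (Complex.abs_arg_le_pi a).trans hpi
  · exact (Complex.abs_arg_le_pi b).trans hpi
  · have ha : a = R * U 0 0 := by rw [u00]; field_simp
    have hb : b = R * U 1 0 := by rw [u10]; field_simp
    rw [ha, hb] at hd
    have hd' : U 0 0 * M 1 1 - M 0 1 * U 1 0 = (R : ℂ)⁻¹ := by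
      field_simp; linear_combination hd
    rw [← hU]
    set T := triMat (Real.log R) (-(U 1 1 * M 0 1 - U 0 1 * M 1 1) / R) with hT
    have t00 : T 0 0 = R := by
      change ((Real.exp (Real.log R) : ℝ) : ℂ) = _; rw [hexp]
    have t10 : T 1 0 = 0 := rfl
    have t11 : T 1 1 = (R : ℂ)⁻¹ := by
      change ((Real.exp (-Real.log R) : ℝ) : ℂ) = _; rw [hexp']; simp
    have t01 : T 0 1 = U 1 1 * M 0 1 - U 0 1 * M 1 1 := by
      change -(((Real.exp (Real.log R) : ℝ) : ℂ) * (-(U 1 1 * M 0 1 - U 0 1 * M 1 1) / R)) = _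
      rw [hexp]; field_simp
    apply Matrix.SpecialLinearGroup.ext
    intro i j
    rw [Matrix.SpecialLinearGroup.coe_mul, Matrix.mul_apply, Fin.sum_univ_two]
    fin_cases i <;> fin_cases j
    · change a = U 0 0 * T 0 0 + U 0 1 * T 1 0
      rw [t00, t10, ha]; ring
    · change M 0 1 = U 0 0 * T 0 1 + U 0 1 * T 1 1
      rw [t01, t11, ← hd']; linear_combination (-M 0 1) * hUd
    · change b = U 1 0 * T 0 0 + U 1 1 * T 1 0
      rw [t00, t10, hb]; ring
    · change M 1 1 = U 1 0 * T 0 1 + U 1 1 * T 1 1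
      rw [t01, t11, ← hd']; linear_combination (-M 1 1) * hUd

lemma ofHomog_mul_left {k y₁ y₂ : ℂ} (hk : k ≠ 0) : ofHomog (k * y₁) (k * y₂) = ofHomog y₁ y₂ := by
  unfold ofHomog
  simp only [mul_eq_zero, hk, false_or, mul_div_mul_left _ _ hk]

/-- The field `U ⊙ (exp (2 r) (℘(· - s) - c))` in homogeneous coordinates. -/
lemma orbitMap_mul_triMat (U : SL(2, ℂ)) (r : ℝ) (c s : ℂ) {z : ℂ}
    (hz : z - s ∉ squarePeriods.lattice) :
    orbitMap (U * triMat r c) s z =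
      ofHomog (U 0 0 * (Real.exp (2 * r) * (squarePeriods.weierstrassP (z - s) - c)) + U 0 1)
        (U 1 0 * (Real.exp (2 * r) * (squarePeriods.weierstrassP (z - s) - c)) + U 1 1) := by
  have hk : (Real.exp r : ℂ) ≠ 0 := by exact_mod_cast (Real.exp_pos r).ne'
  have h1 := (((wp_lift_of_notMem hz).comp_sub (z₀ := z)).smul (U * triMat r c)).eq.self_of_nhds
  refine h1.trans ?_
  have e : ∀ i, (U * triMat r c) i 0 = U i 0 * Real.exp r := fun i => by
    rw [Matrix.SpecialLinearGroup.coe_mul, Matrix.mul_apply, Fin.sum_univ_two]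
    change U i 0 * (Real.exp r : ℂ) + U i 1 * 0 = _
    ring
  have e' : ∀ i, (U * triMat r c) i 1 = -(U i 0 * (Real.exp r * c)) + U i 1 * Real.exp (-r) :=
    fun i => by
    rw [Matrix.SpecialLinearGroup.coe_mul, Matrix.mul_apply, Fin.sum_univ_two]
    change U i 0 * -(Real.exp r * c) + U i 1 * (Real.exp (-r) : ℂ) = _
    ring
  rw [← ofHomog_mul_left hk, e, e, e', e', two_mul, Real.exp_add, Real.exp_neg]
  push_cast at hk ⊢
  congr 1 <;> field_simp <;> ring

/-! ### Noncompactness -/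

lemma unitCell_mem_nhds : unitCell ∈ 𝓝 (⟨1 / 2, 1 / 2⟩ : ℂ) := by
  have h1 : ∀ᶠ z in 𝓝 (⟨1 / 2, 1 / 2⟩ : ℂ), z.re ∈ Ico (0 : ℝ) 1 :=
    Complex.continuous_re.continuousAt.eventually
      (Ico_mem_nhds (by norm_num : (0 : ℝ) < 1 / 2) (by norm_num))
  have h2 : ∀ᶠ z in 𝓝 (⟨1 / 2, 1 / 2⟩ : ℂ), z.im ∈ Ico (0 : ℝ) 1 :=
    Complex.continuous_im.continuousAt.eventually
      (Ico_mem_nhds (by norm_num : (0 : ℝ) < 1 / 2) (by norm_num))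
  filter_upwards [h1, h2] with z hz1 hz2 using ⟨hz1, hz2⟩

/-- Under `exp (2 r) ℘` every value other than `0` escapes to `∞`. A cluster point would have poles
off a countable subset of the cell, but its poles there are finite in number and the cell has
interior. -/
theorem noncompactSpace_moduliSpace : NoncompactSpace ModuliSpace := by
  refine ⟨fun hcomp => ?_⟩
  obtain ⟨W, -, hW⟩ := hcomp.exists_mapClusterPt (f := atTop)
    (u := fun r : ℝ => lump (1 * triMat r 0) 0) (by simp)
  obtain ⟨U, hU, hUW⟩ := mapClusterPt_iff_ultrafilter.1 hW
  have hinf : ∀ z, z ∉ squarePeriods.lattice → squarePeriods.weierstrassP z ≠ 0 →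
      W.1 z = OnePoint.infty := by
    intro z hz hz0
    have hev : Continuous (fun V : ModuliSpace => V.1 z) := by fun_prop
    have h1 : Tendsto (fun r : ℝ => (lump (1 * triMat r 0) 0).1 z) U (𝓝 (W.1 z)) :=
      (hev.tendsto W).comp hUW
    have h2 : Tendsto (fun r : ℝ => (lump (1 * triMat r 0) 0).1 z) atTop (𝓝 OnePoint.infty) := by
      have h3 : ∀ r : ℝ, (lump (1 * triMat r 0) 0).1 z =
          ((Real.exp (2 * r) * squarePeriods.weierstrassP z : ℂ) : OnePoint ℂ) := by
        intro r
        rw [lump_apply, orbitMap_mul_triMat _ _ _ _ (by simpa using hz)]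
        simp [ofHomog]
      simp only [h3]
      have h4 : Tendsto (fun w : ℂ => (w : OnePoint ℂ)) (Bornology.cobounded ℂ)
          (𝓝 OnePoint.infty) := by
        rw [Metric.cobounded_eq_cocompact, ← coclosedCompact_eq_cocompact]
        exact OnePoint.tendsto_coe_infty
      refine h4.comp ?_
      rw [← tendsto_norm_atTop_iff_cobounded]
      have h5 : ∀ r : ℝ, ‖(Real.exp (2 * r) * squarePeriods.weierstrassP z : ℂ)‖ =
          Real.exp (2 * r) * ‖squarePeriods.weierstrassP z‖ := by
        intro r
        rw [norm_mul, Complex.norm_real, Real.norm_of_nonneg (Real.exp_pos _).le]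
      simp only [h5]
      exact (Real.tendsto_exp_atTop.comp (tendsto_id.const_mul_atTop two_pos)).atTop_mul_const
        (norm_pos_iff.2 hz0)
    exact tendsto_nhds_unique h1 (h2.mono_left hU)
  have hcount : unitCell.Countable := by
    refine ((poles_finite W).countable.union (squarePeriods.countable_lattice.union
      (squarePeriods.countable_weierstrassP_fiber 0))).mono ?_
    intro z hz
    by_cases h1 : z ∈ squarePeriods.lattice
    · exact Or.inr (Or.inl h1)
    by_cases h2 : squarePeriods.weierstrassP z = 0
    · exact Or.inr (Or.inr h2)
    exact Or.inl ⟨hz, hinf z h1 h2⟩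
  obtain ⟨z, hz1, hz2⟩ := (hcount.dense_compl ℂ).inter_nhds_nonempty unitCell_mem_nhds
  exact hz1 hz2

end TorusLump

end

noncomputable section

/-! ### Local lower bounds for differences -/

lemma HasStrictDerivAt.eventually_le_norm_sub {f : ℂ → ℂ} {f' x : ℂ} (h : HasStrictDerivAt f f' x)
    (hf' : f' ≠ 0) : ∀ᶠ p : ℂ × ℂ in 𝓝 (x, x), ‖f'‖ / 2 * ‖p.1 - p.2‖ ≤ ‖f p.1 - f p.2‖ := by
  have h1 := h.isLittleO.def (half_pos (norm_pos_iff.2 hf'))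
  filter_upwards [h1] with p hp
  have h2 : ‖f' * (p.1 - p.2)‖ ≤ ‖f p.1 - f p.2‖ + ‖f'‖ / 2 * ‖p.1 - p.2‖ := by
    refine le_trans ?_ (add_le_add_right hp _)
    rw [norm_sub_rev (f p.1 - f p.2 : ℂ)]
    refine le_trans (le_of_eq ?_) (norm_add_le _ _)
    congr 1
    simp [mul_comm]
  rw [norm_mul] at h2
  linarith

/-- The difference of the values of an even function with a nondegenerate critical point at the
origin. -/
lemma AnalyticAt.eventually_le_norm_sub_of_even {f : ℂ → ℂ} (hf : AnalyticAt ℂ f 0)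
    (he : ∀ u, f (-u) = f u) (ho : analyticOrderAt (fun u => f u - f 0) 0 = 2) :
    ∃ κ : ℝ, 0 < κ ∧ ∀ᶠ p : ℂ × ℂ in 𝓝 (0, 0),
      κ * (‖p.1 - p.2‖ * ‖p.1 + p.2‖) ≤ ‖f p.1 - f p.2‖ := by
  obtain ⟨k, hk, hk0, hfk⟩ :=
    ((hf.sub analyticAt_const : AnalyticAt ℂ (fun u => f u - f 0) 0).analyticOrderAt_eq_natCast
      (n := 2)).1 ho
  simp only [Pi.sub_apply] at hfk
  have hneg : Tendsto (fun u : ℂ => -u) (𝓝 0) (𝓝 0) := by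
    simpa using (continuous_neg (G := ℂ)).tendsto 0
  have hkeven : ∀ᶠ u in 𝓝 (0 : ℂ), k (-u) = k u := by
    filter_upwards [hfk, hneg.eventually hfk] with u h1 h2
    by_cases hu : u = 0
    · simp [hu]
    · rw [he, h1] at h2
      simp only [sub_zero, neg_sq, smul_eq_mul] at h2
      exact (mul_left_cancel₀ (pow_ne_zero 2 hu) h2).symm
  set r : ℂ → ℂ := fun u => (k u / k 0) ^ (1 / 2 : ℂ) with hr
  have hra : AnalyticAt ℂ r 0 := by
    refine AnalyticAt.cpow (by fun_prop) analyticAt_const ?_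
    rw [div_self hk0]; exact Complex.one_mem_slitPlane
  have hr0 : r 0 = 1 := by rw [hr]; simp [div_self hk0]
  have hrsq : ∀ u, r u ^ 2 = k u / k 0 := fun u => by
    rw [hr]
    have := Complex.cpow_nat_inv_pow (k u / k 0) (n := 2) (by norm_num)
    rw [← this]; simp
  set φ : ℂ → ℂ := fun u => u * r u with hφ
  have hφa : AnalyticAt ℂ φ 0 := by fun_prop
  have hφd : HasStrictDerivAt φ 1 0 := by
    have h1 := hφa.hasStrictDerivAt
    have h2 : HasDerivAt φ (1 * r 0 + 0 * deriv r 0) 0 :=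
      (hasDerivAt_id (0 : ℂ)).mul hra.differentiableAt.hasDerivAt
    rw [hr0] at h2
    simp only [mul_one, zero_mul, add_zero] at h2
    rwa [h2.deriv] at h1
  have hφneg : ∀ᶠ u in 𝓝 (0 : ℂ), φ (-u) = -φ u := by
    filter_upwards [hkeven] with u hu
    rw [hφ]; simp only [hr, hu]; ring
  have hfφ : ∀ᶠ u in 𝓝 (0 : ℂ), f u - f 0 = k 0 * φ u ^ 2 := by
    filter_upwards [hfk] with u hu
    rw [hu, hφ]
    simp only [mul_pow, hrsq, sub_zero, smul_eq_mul]
    field_simp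
  have hlow := hφd.eventually_le_norm_sub one_ne_zero
  have hfst : Tendsto (fun p : ℂ × ℂ => p.1) (𝓝 (0, 0)) (𝓝 0) := continuous_fst.tendsto (0, 0)
  have hsnd : Tendsto (fun p : ℂ × ℂ => p.2) (𝓝 (0, 0)) (𝓝 0) := continuous_snd.tendsto (0, 0)
  have hflip : Tendsto (fun p : ℂ × ℂ => (p.1, -p.2)) (𝓝 (0, 0)) (𝓝 (0, 0)) := by
    have : Continuous (fun p : ℂ × ℂ => (p.1, -p.2)) := by fun_prop
    simpa using this.tendsto (0, 0)
  refine ⟨‖k 0‖ / 4, by have := norm_pos_iff.2 hk0; positivity, ?_⟩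
  filter_upwards [hfst.eventually hfφ, hsnd.eventually hfφ, hsnd.eventually hφneg, hlow,
    hflip.eventually hlow] with p h1 h2 h3 h4 h5
  have e1 : f p.1 - f p.2 = k 0 * ((φ p.1 - φ p.2) * (φ p.1 - φ (-p.2))) := by
    rw [h3]; linear_combination h1 - h2
  rw [e1, norm_mul, norm_mul]
  simp only [norm_one, sub_neg_eq_add] at h4 h5
  have := mul_le_mul h4 h5 (by positivity) (by positivity)
  have hk := norm_nonneg (k 0)
  calc ‖k 0‖ / 4 * (‖p.1 - p.2‖ * ‖p.1 + p.2‖)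
      = ‖k 0‖ * ((1 / 2 * ‖p.1 - p.2‖) * (1 / 2 * ‖p.1 + p.2‖)) := by ring
    _ ≤ _ := by gcongr

namespace PeriodPair

variable (L : PeriodPair)

lemma eventually_le_norm_weierstrassP {l : ℂ} (hl : l ∈ L.lattice) (R : ℝ) :
    ∀ᶠ z in 𝓝 l, z ∉ L.lattice → R ≤ ‖L.weierstrassP z‖ := by
  have h1 : Tendsto L.weierstrassP (𝓝[≠] l) (Bornology.cobounded ℂ) := by
    refine tendsto_cobounded_of_meromorphicOrderAt_neg ?_
    rw [L.order_weierstrassP l hl]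
    exact WithTop.coe_lt_coe.2 (by norm_num : (-2 : ℤ) < 0)
  have h2 := (tendsto_norm_cobounded_atTop.comp h1).eventually_ge_atTop R
  rw [eventually_nhdsWithin_iff] at h2
  filter_upwards [h2] with z hz hzL
  refine hz ?_
  rintro rfl
  exact hzL hl

/-- The local form of the lower bound for the chordal distance of values of `℘`. -/
lemma exists_local_lower_bound (z₀ a₀ : ℂ) : ∃ (κ : ℝ) (ω ω' : ℂ), 0 < κ ∧
    ∀ᶠ p : ℂ × ℂ in 𝓝 (z₀, a₀), p.1 ∉ L.lattice → p.2 ∉ L.lattice →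
      κ * (‖p.1 - p.2 - ω‖ * ‖p.1 + p.2 - ω'‖) * √(1 + ‖L.weierstrassP p.2‖ ^ 2) ≤
        ‖L.weierstrassP p.1 - L.weierstrassP p.2‖ := by
  set P := L.weierstrassP with hP
  have hper : ∀ l ∈ L.lattice, ∀ z, P (z + l) = P z :=
    fun l hl z => L.weierstrassP_add_coe z ⟨l, hl⟩
  have hfst : Tendsto (fun p : ℂ × ℂ => p.1) (𝓝 (z₀, a₀)) (𝓝 z₀) := continuous_fst.tendsto (z₀, a₀)
  have hsnd : Tendsto (fun p : ℂ × ℂ => p.2) (𝓝 (z₀, a₀)) (𝓝 a₀) := continuous_snd.tendsto (z₀, a₀)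
  -- it is enough to bound one of the factors, since the other ones are locally bounded
  have bdd : ∀ F : ℂ × ℂ → ℝ, ContinuousAt F (z₀, a₀) →
      ∃ B : ℝ, 0 < B ∧ ∀ᶠ p in 𝓝 (z₀, a₀), F p ≤ B := by
    intro F hF
    refine ⟨|F (z₀, a₀)| + 1, by positivity, ?_⟩
    refine hF.tendsto.eventually_le_const ?_
    linarith [le_abs_self (F (z₀, a₀))]
  have bddprod : ∀ F : ℂ × ℂ → ℝ, ContinuousAt F (z₀, a₀) → (∃ κ : ℝ, 0 < κ ∧
      ∀ᶠ p in 𝓝 (z₀, a₀), p.1 ∉ L.lattice → p.2 ∉ L.lattice → κ ≤ ‖P p.1 - P p.2‖) →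
      ∃ κ : ℝ, 0 < κ ∧ ∀ᶠ p in 𝓝 (z₀, a₀), p.1 ∉ L.lattice → p.2 ∉ L.lattice →
        κ * F p ≤ ‖P p.1 - P p.2‖ := by
    rintro F hF ⟨κ, hκ, h⟩
    obtain ⟨B, hB, hFB⟩ := bdd F hF
    refine ⟨κ / B, by positivity, ?_⟩
    filter_upwards [h, hFB] with p h1 h2 h3 h4
    refine le_trans ?_ (h1 h3 h4)
    rw [div_mul_eq_mul_div, div_le_iff₀ hB]
    gcongr
  -- A degenerate bound is forced only where `z₀` and `a₀` have the same image on the sphere. There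
  -- `ω = z₀ - a₀` or `ω' = z₀ + a₀` marks the vanishing factor; both occur at poles and half
  -- periods, where `a` and `-a` merge modulo the lattice. A factor that is merely bounded is
  -- absorbed into `κ`, with `0` as a dummy centre.
  by_cases ha : a₀ ∈ L.lattice
  · by_cases hz : z₀ ∈ L.lattice
    · -- both points are poles
      -- Work with `1 / ℘`, even with a double zero. Returning to `℘` multiplies by `‖P z‖ ‖P a‖`,
      -- which dominates `√(1 + ‖P a‖²) / 2` since both norms are at least `1`.
      have h0 := L.analyticAt_inv_weierstrassP (zero_mem L.lattice)
      obtain ⟨κ, hκ, hlow⟩ := h0.1.eventually_le_norm_sub_of_even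
        (fun u => by rw [L.weierstrassP_neg]) (by
          have : (L.weierstrassP 0)⁻¹ = 0 := by rw [L.weierstrassP_zero, inv_zero]
          simpa [this] using h0.2)
      have htr : Tendsto (fun p : ℂ × ℂ => (p.1 - z₀, p.2 - a₀)) (𝓝 (z₀, a₀)) (𝓝 (0, 0)) := by
        have : Continuous (fun p : ℂ × ℂ => (p.1 - z₀, p.2 - a₀)) := by fun_prop
        simpa using this.tendsto (z₀, a₀)
      refine ⟨κ / 2, z₀ - a₀, z₀ + a₀, by positivity, ?_⟩
      filter_upwards [htr.eventually hlow, hfst.eventually (L.eventually_le_norm_weierstrassP hz 1),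
        hsnd.eventually (L.eventually_le_norm_weierstrassP ha 1)] with p h1 h2 h3 h4 h5
      have h2 := h2 h4
      have h3 := h3 h5
      have e1 : P (p.1 - z₀) = P p.1 := by rw [← hper z₀ hz, sub_add_cancel]
      have e2 : P (p.2 - a₀) = P p.2 := by rw [← hper a₀ ha, sub_add_cancel]
      simp only [← hP, e1, e2] at h1 h2 h3
      have n1 : P p.1 ≠ 0 := by rw [← norm_pos_iff]; linarith
      have n2 : P p.2 ≠ 0 := by rw [← norm_pos_iff]; linarith
      rw [inv_sub_inv n1 n2, norm_div, norm_mul, le_div_iff₀ (by positivity),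
        norm_sub_rev (P p.2)] at h1
      rw [show p.1 - p.2 - (z₀ - a₀) = p.1 - z₀ - (p.2 - a₀) by ring,
        show p.1 + p.2 - (z₀ + a₀) = p.1 - z₀ + (p.2 - a₀) by ring]
      refine le_trans ?_ h1
      have hs : √(1 + ‖P p.2‖ ^ 2) ≤ 2 * (‖P p.1‖ * ‖P p.2‖) := by
        rw [Real.sqrt_le_left (by positivity)]
        have : ‖P p.2‖ ≤ ‖P p.1‖ * ‖P p.2‖ := le_mul_of_one_le_left (norm_nonneg _) h2
        nlinarith
      calc κ / 2 * (‖p.1 - z₀ - (p.2 - a₀)‖ * ‖p.1 - z₀ + (p.2 - a₀)‖) * √(1 + ‖P p.2‖ ^ 2)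
          ≤ κ / 2 * (‖p.1 - z₀ - (p.2 - a₀)‖ * ‖p.1 - z₀ + (p.2 - a₀)‖) *
            (2 * (‖P p.1‖ * ‖P p.2‖)) := by gcongr
        _ = _ := by ring
    · -- `a` is near a pole and `z` is not
      have hPz : ContinuousAt P z₀ := (L.analyticAt_weierstrassP hz).continuousAt
      have hb : ∀ᶠ z in 𝓝 z₀, ‖P z‖ ≤ ‖P z₀‖ + 1 :=
        hPz.norm.tendsto.eventually_le_const (by linarith)
      obtain ⟨B, hB, hFB⟩ := bdd (fun p => ‖p.1 - p.2 - 0‖ * ‖p.1 + p.2 - 0‖) (by fun_prop)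
      refine ⟨1 / (4 * B), 0, 0, by positivity, ?_⟩
      filter_upwards [hfst.eventually hb, hFB, hsnd.eventually
        (L.eventually_le_norm_weierstrassP ha (2 * (‖P z₀‖ + 1)))] with p h1 h2 h3 h4 h5
      have h3 := h3 h5
      have h0 := norm_nonneg (P z₀)
      have hs : √(1 + ‖P p.2‖ ^ 2) ≤ 2 * ‖P p.2‖ := by
        rw [Real.sqrt_le_left (by positivity)]
        nlinarith
      have h6 : ‖P p.2‖ - ‖P p.1‖ ≤ ‖P p.1 - P p.2‖ := by
        rw [norm_sub_rev]; exact norm_sub_norm_le _ _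
      calc 1 / (4 * B) * (‖p.1 - p.2 - 0‖ * ‖p.1 + p.2 - 0‖) * √(1 + ‖P p.2‖ ^ 2)
          ≤ 1 / (4 * B) * B * (2 * ‖P p.2‖) := by gcongr
        _ = ‖P p.2‖ / 2 := by field_simp; ring
        _ ≤ _ := by linarith
  · have hPa : ContinuousAt P a₀ := (L.analyticAt_weierstrassP ha).continuousAt
    have hPa2 : ContinuousAt (fun p : ℂ × ℂ => √(1 + ‖P p.2‖ ^ 2)) (z₀, a₀) := by
      have : ContinuousAt (fun p : ℂ × ℂ => P p.2) (z₀, a₀) :=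
        ContinuousAt.comp (g := P) (f := Prod.snd) (x := (z₀, a₀)) hPa continuousAt_snd
      fun_prop
    by_cases hz : z₀ ∈ L.lattice
    · obtain ⟨κ, hκ, h⟩ := bddprod
        (fun p => ‖p.1 - p.2 - 0‖ * ‖p.1 + p.2 - 0‖ * √(1 + ‖P p.2‖ ^ 2))
        (by fun_prop) ⟨1, one_pos, by
          have hb : ∀ᶠ z in 𝓝 a₀, ‖P z‖ ≤ ‖P a₀‖ + 1 :=
            hPa.norm.tendsto.eventually_le_const (by linarith)
          filter_upwards [hsnd.eventually hb, hfst.eventually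
            (L.eventually_le_norm_weierstrassP hz (‖P a₀‖ + 2))] with p h1 h2 h3 h4
          have h2 := h2 h3
          have := norm_sub_norm_le (P p.1) (P p.2)
          linarith⟩
      refine ⟨κ, 0, 0, hκ, ?_⟩
      filter_upwards [h] with p hp h1 h2
      rw [mul_assoc]; exact hp h1 h2
    · have hPz : ContinuousAt P z₀ := (L.analyticAt_weierstrassP hz).continuousAt
      by_cases hne : P z₀ = P a₀
      · suffices hQ : ∃ (κ : ℝ) (ω ω' : ℂ), 0 < κ ∧ ∀ᶠ p : ℂ × ℂ in 𝓝 (z₀, a₀),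
            κ * (‖p.1 - p.2 - ω‖ * ‖p.1 + p.2 - ω'‖) ≤ ‖P p.1 - P p.2‖ by
          obtain ⟨κ, ω, ω', hκ, h⟩ := hQ
          obtain ⟨B, hB, hFB⟩ := bdd _ hPa2
          refine ⟨κ / B, ω, ω', by positivity, ?_⟩
          filter_upwards [h, hFB] with p h1 h2 _ _
          refine le_trans ?_ h1
          calc κ / B * (‖p.1 - p.2 - ω‖ * ‖p.1 + p.2 - ω'‖) * √(1 + ‖P p.2‖ ^ 2)
              ≤ κ / B * (‖p.1 - p.2 - ω‖ * ‖p.1 + p.2 - ω'‖) * B := by gcongr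
            _ = _ := by field_simp
        by_cases haa : a₀ + a₀ ∈ L.lattice
        · -- `a` is near a half period
          have hω : z₀ - a₀ ∈ L.lattice := by
            rcases (L.weierstrassP_eq_iff hz ha).1 hne with h | h
            · exact h
            · convert sub_mem h haa using 1; ring
          have hf : AnalyticAt ℂ (fun u => P (u + a₀)) 0 :=
            AnalyticAt.fun_comp (by simpa using L.analyticAt_weierstrassP ha) (by fun_prop)
          obtain ⟨κ, hκ, hlow⟩ := hf.eventually_le_norm_sub_of_even (fun u => by
              rw [hP, ← L.weierstrassP_neg, ← hP, ← hper _ haa]; congr 1; ring) (by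
            have h1 := analyticOrderAt_comp_of_deriv_ne_zero (f := fun z => P z - P a₀)
              (g := fun y => y + a₀) (z₀ := 0) (by fun_prop) (by simp)
            simp only [zero_add, Function.comp_def] at h1 ⊢
            rw [h1]
            exact L.analyticOrderAt_weierstrassP_sub_eq_two ha haa)
          have htr : Tendsto (fun p : ℂ × ℂ => (p.1 - z₀, p.2 - a₀)) (𝓝 (z₀, a₀)) (𝓝 (0, 0)) := by
            have : Continuous (fun p : ℂ × ℂ => (p.1 - z₀, p.2 - a₀)) := by fun_prop
            simpa using this.tendsto (z₀, a₀)
          refine ⟨κ, z₀ - a₀, z₀ + a₀, hκ, ?_⟩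
          filter_upwards [htr.eventually hlow] with p hp
          have e : P (p.1 - z₀ + a₀) = P p.1 := by
            rw [← hper _ hω]; congr 1; ring
          simp only [e, sub_add_cancel] at hp
          rw [show p.1 - p.2 - (z₀ - a₀) = p.1 - z₀ - (p.2 - a₀) by ring,
            show p.1 + p.2 - (z₀ + a₀) = p.1 - z₀ + (p.2 - a₀) by ring]
          exact hp
        · -- `a` is not a half period
          have hd : HasStrictDerivAt P (L.derivWeierstrassP a₀) a₀ := by
            rw [← L.deriv_weierstrassP]
            exact (L.analyticAt_weierstrassP ha).hasStrictDerivAt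
          have hd0 : L.derivWeierstrassP a₀ ≠ 0 :=
            fun h => haa ((L.derivWeierstrassP_eq_zero_iff ha).1 h)
          have hlow := hd.eventually_le_norm_sub hd0
          have hδ : 0 < ‖L.derivWeierstrassP a₀‖ := norm_pos_iff.2 hd0
          rcases (L.weierstrassP_eq_iff hz ha).1 hne with hω | hω
          · have htr : Tendsto (fun p : ℂ × ℂ => (p.1 - (z₀ - a₀), p.2)) (𝓝 (z₀, a₀))
                (𝓝 (a₀, a₀)) := by
              have : Continuous (fun p : ℂ × ℂ => (p.1 - (z₀ - a₀), p.2)) := by fun_prop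
              simpa using this.tendsto (z₀, a₀)
            obtain ⟨B, hB, hFB⟩ := bdd (fun p => ‖p.1 + p.2 - 0‖) (by fun_prop)
            refine ⟨‖L.derivWeierstrassP a₀‖ / 2 / B, z₀ - a₀, 0, by positivity, ?_⟩
            filter_upwards [htr.eventually hlow, hFB] with p hp h2
            have e : P (p.1 - (z₀ - a₀)) = P p.1 := by rw [← hper _ hω, sub_add_cancel]
            simp only [e] at hp
            refine le_trans ?_ hp
            calc ‖L.derivWeierstrassP a₀‖ / 2 / B * (‖p.1 - p.2 - (z₀ - a₀)‖ * ‖p.1 + p.2 - 0‖)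
                ≤ ‖L.derivWeierstrassP a₀‖ / 2 / B * (‖p.1 - p.2 - (z₀ - a₀)‖ * B) := by gcongr
              _ = ‖L.derivWeierstrassP a₀‖ / 2 * ‖p.1 - (z₀ - a₀) - p.2‖ := by
                rw [show p.1 - (z₀ - a₀) - p.2 = p.1 - p.2 - (z₀ - a₀) by ring]
                field_simp
          · have htr : Tendsto (fun p : ℂ × ℂ => ((z₀ + a₀) - p.1, p.2)) (𝓝 (z₀, a₀))
                (𝓝 (a₀, a₀)) := by
              have : Continuous (fun p : ℂ × ℂ => ((z₀ + a₀) - p.1, p.2)) := by fun_prop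
              simpa using this.tendsto (z₀, a₀)
            obtain ⟨B, hB, hFB⟩ := bdd (fun p => ‖p.1 - p.2 - 0‖) (by fun_prop)
            refine ⟨‖L.derivWeierstrassP a₀‖ / 2 / B, 0, z₀ + a₀, by positivity, ?_⟩
            filter_upwards [htr.eventually hlow, hFB] with p hp h2
            have e : P ((z₀ + a₀) - p.1) = P p.1 := by
              rw [hP, ← L.weierstrassP_neg, ← hP, ← hper _ hω]; congr 1; ring
            simp only [e] at hp
            refine le_trans ?_ hp
            calc ‖L.derivWeierstrassP a₀‖ / 2 / B * (‖p.1 - p.2 - 0‖ * ‖p.1 + p.2 - (z₀ + a₀)‖)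
                ≤ ‖L.derivWeierstrassP a₀‖ / 2 / B * (B * ‖p.1 + p.2 - (z₀ + a₀)‖) := by gcongr
              _ = ‖L.derivWeierstrassP a₀‖ / 2 * ‖(z₀ + a₀) - p.1 - p.2‖ := by
                rw [show (z₀ + a₀) - p.1 - p.2 = -(p.1 + p.2 - (z₀ + a₀)) by ring, norm_neg]
                field_simp
      · obtain ⟨κ, hκ, h⟩ := bddprod
          (fun p => ‖p.1 - p.2 - 0‖ * ‖p.1 + p.2 - 0‖ * √(1 + ‖P p.2‖ ^ 2))
          (by fun_prop) ⟨‖P z₀ - P a₀‖ / 2, half_pos (norm_pos_iff.2 (sub_ne_zero.2 hne)), by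
            have hc : ContinuousAt (fun p : ℂ × ℂ => ‖P p.1 - P p.2‖) (z₀, a₀) := by
              have h1 : ContinuousAt (fun p : ℂ × ℂ => P p.2) (z₀, a₀) :=
                ContinuousAt.comp (g := P) (f := Prod.snd) (x := (z₀, a₀)) hPa continuousAt_snd
              have h2 : ContinuousAt (fun p : ℂ × ℂ => P p.1) (z₀, a₀) :=
                ContinuousAt.comp (g := P) (f := Prod.fst) (x := (z₀, a₀)) hPz continuousAt_fst
              fun_prop
            have := hc.tendsto.eventually_const_le
              (half_lt_self (norm_pos_iff.2 (sub_ne_zero.2 hne)))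
            filter_upwards [this] with p hp _ _ using hp⟩
        refine ⟨κ, 0, 0, hκ, ?_⟩
        filter_upwards [h] with p hp h1 h2
        rw [mul_assoc]; exact hp h1 h2

end PeriodPair

end

noncomputable section

/-! ### Uniform integral bounds -/

/-- The singular integral of `1 / ‖z - b‖` over a bounded set is bounded uniformly in `b`. -/
lemma exists_lintegral_inv_enorm_sub_le (B : Set ℂ) (hB : volume B ≠ ⊤) :
    ∃ K : ℝ≥0∞, K ≠ ⊤ ∧ ∀ b : ℂ, ∫⁻ z in B, ‖z - b‖ₑ⁻¹ ≤ K := by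
  have h1 : ∫⁻ z in Metric.ball (0 : ℂ) 1, ‖z‖ₑ⁻¹ ≠ ⊤ := by
    have h2 : IntegrableOn (fun z : ℂ => ‖z‖⁻¹) (Metric.ball 0 1) := by
      refine integrableOn_ball_of_norm_le_rpow (C := 1) (α := 1) (by simp) (by simp) ?_ ?_
      · refine Eventually.of_forall fun x => ?_
        rw [Real.rpow_neg_one, one_mul, norm_inv, norm_norm]
      · exact (measurable_norm.inv).aestronglyMeasurable
    have h3 := h2.hasFiniteIntegral
    unfold HasFiniteIntegral at h3
    refine ne_of_lt (lt_of_le_of_lt (lintegral_mono_ae ?_) h3)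
    have h4 : ∀ᵐ z : ℂ ∂(volume.restrict (Metric.ball (0 : ℂ) 1)), z ≠ 0 :=
      ae_restrict_of_ae (by simp [ae_iff])
    filter_upwards [h4] with z hz
    rw [enorm_inv (norm_ne_zero_iff.2 hz), enorm_norm]
  refine ⟨volume B + ∫⁻ z in Metric.ball (0 : ℂ) 1, ‖z‖ₑ⁻¹, ENNReal.add_ne_top.2 ⟨hB, h1⟩,
    fun b => ?_⟩
  -- Outside the unit disc about `b` the integrand is at most `1`; inside, translation invariance
  -- reduces to the disc about `0`.
  have hpt : ∀ z, ‖z - b‖ₑ⁻¹ ≤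
      1 + (Metric.ball (0 : ℂ) 1).indicator (fun y => ‖y‖ₑ⁻¹) (z - b) := by
    intro z
    by_cases hz : z - b ∈ Metric.ball (0 : ℂ) 1
    · rw [indicator_of_mem hz]; exact le_add_self
    · rw [indicator_of_notMem hz, add_zero, ENNReal.inv_le_one]
      rw [mem_ball_zero_iff, not_lt] at hz
      rw [← ofReal_norm]
      simpa using ENNReal.ofReal_le_ofReal hz
  calc ∫⁻ z in B, ‖z - b‖ₑ⁻¹
      ≤ ∫⁻ z in B, 1 + (Metric.ball (0 : ℂ) 1).indicator (fun y => ‖y‖ₑ⁻¹) (z - b) :=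
        lintegral_mono hpt
    _ = volume B + ∫⁻ z in B, (Metric.ball (0 : ℂ) 1).indicator (fun y => ‖y‖ₑ⁻¹) (z - b) := by
        rw [lintegral_add_left measurable_const]; simp
    _ ≤ volume B + ∫⁻ z, (Metric.ball (0 : ℂ) 1).indicator (fun y => ‖y‖ₑ⁻¹) (z - b) := by
        gcongr; exact Measure.restrict_le_self
    _ = volume B + ∫⁻ z, (Metric.ball (0 : ℂ) 1).indicator (fun y => ‖y‖ₑ⁻¹) z := by
        rw [lintegral_sub_right_eq_self]
    _ = _ := by rw [lintegral_indicator Metric.isOpen_ball.measurableSet]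

namespace PeriodPair

variable (L : PeriodPair)

/-- Uniform bound for the reciprocal of the chordal distance of values of `℘` on a compact set. -/
lemma exists_inv_chordal_le {K : Set (ℂ × ℂ)} (hK : IsCompact K) :
    ∃ (C : ℝ≥0∞) (Ω : Finset ℂ), C ≠ ⊤ ∧ ∀ p ∈ K, p.1 ∉ L.lattice → p.2 ∉ L.lattice →
      ENNReal.ofReal √(√(1 + ‖L.weierstrassP p.2‖ ^ 2) /
        ‖L.weierstrassP p.1 - L.weierstrassP p.2‖) ≤
      C * ∑ ω ∈ Ω, (‖p.1 - p.2 - ω‖ₑ⁻¹ + ‖p.1 + p.2 - ω‖ₑ⁻¹) := by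
  -- Finitely many local bounds are merged by adding the constants and uniting the sets of centres.
  refine hK.induction_on ?_ ?_ ?_ ?_
  · exact ⟨0, ∅, by simp, by simp⟩
  · rintro S T hst ⟨C, Ω, hC, h⟩
    exact ⟨C, Ω, hC, fun p hp => h p (hst hp)⟩
  · rintro S T ⟨C₁, Ω₁, hC₁, h₁⟩ ⟨C₂, Ω₂, hC₂, h₂⟩
    refine ⟨C₁ + C₂, Ω₁ ∪ Ω₂, ENNReal.add_ne_top.2 ⟨hC₁, hC₂⟩, ?_⟩
    rintro p (hp | hp) h3 h4
    · refine (h₁ p hp h3 h4).trans ?_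
      gcongr
      · exact le_self_add
      · exact Finset.subset_union_left
    · refine (h₂ p hp h3 h4).trans ?_
      gcongr
      · exact le_add_self
      · exact Finset.subset_union_right
  · intro p₀ hp₀
    obtain ⟨κ, ω, ω', hκ, h⟩ := L.exists_local_lower_bound p₀.1 p₀.2
    refine ⟨_, nhdsWithin_le_nhds h, ENNReal.ofReal √(1 / κ), {ω, ω'}, ENNReal.ofReal_ne_top, ?_⟩
    intro p hp h3 h4
    have hp := hp h3 h4
    set x := ‖p.1 - p.2 - ω‖ with hx
    set y := ‖p.1 + p.2 - ω'‖ with hy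
    have hsum : ‖p.1 - p.2 - ω‖ₑ⁻¹ + ‖p.1 + p.2 - ω'‖ₑ⁻¹ ≤
        ∑ w ∈ {ω, ω'}, (‖p.1 - p.2 - w‖ₑ⁻¹ + ‖p.1 + p.2 - w‖ₑ⁻¹) := by
      by_cases hωω : ω = ω'
      · subst hωω; simp
      · rw [Finset.sum_pair hωω]
        exact add_le_add le_self_add le_add_self
    refine le_trans ?_ (mul_le_mul_right hsum _)
    rw [← ofReal_norm, ← ofReal_norm, ← hx, ← hy]
    have hκ0 : ENNReal.ofReal √(1 / κ) ≠ 0 := by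
      simp only [ne_eq, ENNReal.ofReal_eq_zero, not_le]; positivity
    have hxn : 0 ≤ x := norm_nonneg _
    have hyn : 0 ≤ y := norm_nonneg _
    rcases hxn.eq_or_lt with hx0 | hx0
    · rw [← hx0, ENNReal.ofReal_zero, ENNReal.inv_zero, top_add, ENNReal.mul_top hκ0]
      exact le_top
    rcases hyn.eq_or_lt with hy0 | hy0
    · rw [← hy0, ENNReal.ofReal_zero, ENNReal.inv_zero, add_top, ENNReal.mul_top hκ0]
      exact le_top
    rw [← ENNReal.ofReal_inv_of_pos hx0, ← ENNReal.ofReal_inv_of_pos hy0,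
      ← ENNReal.ofReal_add (by positivity) (by positivity), ← ENNReal.ofReal_mul (by positivity)]
    refine ENNReal.ofReal_le_ofReal ?_
    have hs : 0 < √(1 + ‖L.weierstrassP p.2‖ ^ 2) := by positivity
    have hN : 0 < ‖L.weierstrassP p.1 - L.weierstrassP p.2‖ := lt_of_lt_of_le (by positivity) hp
    refine Real.sqrt_le_iff.2 ⟨by positivity, ?_⟩
    rw [mul_pow, Real.sq_sqrt (by positivity), div_le_iff₀ hN]
    -- This separates the two zeros: the square root of `1 / (x y)` is at most `x⁻¹ + y⁻¹`,
    -- uniformly even when the zeros merge.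
    have h5 : 1 / (x * y) ≤ (x⁻¹ + y⁻¹) ^ 2 := by
      have : 1 / (x * y) = x⁻¹ * y⁻¹ := by field_simp
      rw [this]
      have hx' : 0 < x⁻¹ := by positivity
      have hy' : 0 < y⁻¹ := by positivity
      nlinarith
    calc √(1 + ‖L.weierstrassP p.2‖ ^ 2)
        = 1 / κ * (1 / (x * y)) * (κ * (x * y) * √(1 + ‖L.weierstrassP p.2‖ ^ 2)) := by
          field_simp
      _ ≤ 1 / κ * (x⁻¹ + y⁻¹) ^ 2 * ‖L.weierstrassP p.1 - L.weierstrassP p.2‖ := by gcongr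

/-- Growth of `℘` near its poles, on a compact set. -/
lemma exists_sqrt_weierstrassP_le {K : Set ℂ} (hK : IsCompact K) :
    ∃ (C : ℝ≥0∞) (Ω : Finset ℂ), C ≠ ⊤ ∧ ∀ z ∈ K, z ∉ L.lattice →
      ENNReal.ofReal √(1 + ‖L.weierstrassP z‖) ≤ C * (1 + ∑ ω ∈ Ω, ‖z - ω‖ₑ⁻¹) := by
  refine hK.induction_on ?_ ?_ ?_ ?_
  · exact ⟨0, ∅, by simp, by simp⟩
  · rintro S T hst ⟨C, Ω, hC, h⟩
    exact ⟨C, Ω, hC, fun p hp => h p (hst hp)⟩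
  · rintro S T ⟨C₁, Ω₁, hC₁, h₁⟩ ⟨C₂, Ω₂, hC₂, h₂⟩
    refine ⟨C₁ + C₂, Ω₁ ∪ Ω₂, ENNReal.add_ne_top.2 ⟨hC₁, hC₂⟩, ?_⟩
    rintro p (hp | hp) h3
    · refine (h₁ p hp h3).trans ?_
      gcongr
      · exact le_self_add
      · exact Finset.subset_union_left
    · refine (h₂ p hp h3).trans ?_
      gcongr
      · exact le_add_self
      · exact Finset.subset_union_right
  · intro z₀ hz₀
    by_cases hz : z₀ ∈ L.lattice
    · obtain ⟨u, hu, -, hPu⟩ :=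
        (meromorphicOrderAt_eq_int_iff (n := -2) (L.meromorphic_weierstrassP z₀)).1
          (L.order_weierstrassP z₀ hz)
      have hb : ∀ᶠ z in 𝓝 z₀, ‖u z‖ ≤ ‖u z₀‖ + 1 :=
        hu.continuousAt.norm.tendsto.eventually_le_const (by linarith)
      rw [eventually_nhdsWithin_iff] at hPu
      refine ⟨_, nhdsWithin_le_nhds (hb.and hPu),
        ENNReal.ofReal √(1 + (‖u z₀‖ + 1)), {z₀}, ENNReal.ofReal_ne_top, ?_⟩
      rintro z ⟨h1, h2⟩ hzL
      have hne : z ≠ z₀ := by rintro rfl; exact hzL hz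
      have h2 := h2 hne
      have hx : 0 < ‖z - z₀‖ := norm_pos_iff.2 (sub_ne_zero.2 hne)
      rw [Finset.sum_singleton, ← ofReal_norm, ← ENNReal.ofReal_inv_of_pos hx,
        ← ENNReal.ofReal_one, ← ENNReal.ofReal_add (by positivity) (by positivity),
        ← ENNReal.ofReal_mul (by positivity)]
      refine ENNReal.ofReal_le_ofReal (Real.sqrt_le_iff.2 ⟨by positivity, ?_⟩)
      rw [mul_pow, Real.sq_sqrt (by positivity), h2, norm_smul, norm_zpow]
      have h3 : ‖z - z₀‖ ^ (-2 : ℤ) = ‖z - z₀‖⁻¹ ^ 2 := by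
        rw [zpow_neg, inv_pow]; rfl
      rw [h3]
      set x := ‖z - z₀‖⁻¹
      have hx' : 0 < x := by positivity
      have h0 := norm_nonneg (u z₀)
      have h4 : x ^ 2 * ‖u z‖ ≤ x ^ 2 * (‖u z₀‖ + 1) := by gcongr
      nlinarith [mul_nonneg h0 hx'.le, sq_nonneg x]
    · have hc : ContinuousAt (fun z => √(1 + ‖L.weierstrassP z‖)) z₀ := by
        have := (L.analyticAt_weierstrassP hz).continuousAt
        fun_prop
      have hb := hc.tendsto.eventually_le_const (lt_add_one _)
      refine ⟨_, nhdsWithin_le_nhds hb, ENNReal.ofReal (√(1 + ‖L.weierstrassP z₀‖) + 1), ∅,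
        ENNReal.ofReal_ne_top, ?_⟩
      intro z hz _
      simpa using ENNReal.ofReal_le_ofReal hz

end PeriodPair

namespace TorusLump

lemma unitCell_subset_closedBall : unitCell ⊆ Metric.closedBall (0 : ℂ) 2 := by
  rintro z ⟨⟨h1, h2⟩, ⟨h3, h4⟩⟩
  rw [mem_closedBall_zero_iff]
  refine (Complex.norm_le_abs_re_add_abs_im z).trans ?_
  rw [abs_of_nonneg h1, abs_of_nonneg h3]; linarith

lemma sub_mem_closedBall {z s : ℂ} (hz : z ∈ unitCell) (hs : s ∈ unitCell) :
    z - s ∈ Metric.closedBall (0 : ℂ) 2 := by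
  obtain ⟨⟨h1, h2⟩, ⟨h3, h4⟩⟩ := hz
  obtain ⟨⟨h5, h6⟩, ⟨h7, h8⟩⟩ := hs
  rw [mem_closedBall_zero_iff]
  refine (Complex.norm_le_abs_re_add_abs_im _).trans ?_
  have a1 : |(z - s).re| ≤ 1 := by rw [Complex.sub_re, abs_le]; constructor <;> linarith
  have a2 : |(z - s).im| ≤ 1 := by rw [Complex.sub_im, abs_le]; constructor <;> linarith
  linarith

lemma measurableSet_unitCell : MeasurableSet unitCell :=
  (measurableSet_Ico.preimage Complex.measurable_re).inter
    (measurableSet_Ico.preimage Complex.measurable_im)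

lemma volume_unitCell_ne_top : volume unitCell ≠ ⊤ :=
  ne_top_of_le_ne_top (measure_closedBall_lt_top).ne (measure_mono unitCell_subset_closedBall)

/-- One fixed ball contains all the translated cells, so bounds on a compact set become uniform in
`s`. -/
lemma lintegral_unitCell_comp_sub_le (F : ℂ → ℝ≥0∞) {s : ℂ} (hs : s ∈ unitCell) :
    ∫⁻ z in unitCell, F (z - s) ≤ ∫⁻ z in Metric.closedBall (0 : ℂ) 2, F z := by
  rw [← lintegral_indicator measurableSet_unitCell,
    ← lintegral_indicator Metric.isClosed_closedBall.measurableSet,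
    ← lintegral_sub_right_eq_self ((Metric.closedBall (0 : ℂ) 2).indicator F) s]
  refine lintegral_mono fun z => ?_
  by_cases hz : z ∈ unitCell
  · rw [indicator_of_mem hz, indicator_of_mem (sub_mem_closedBall hz hs)]
  · rw [indicator_of_notMem hz]; exact zero_le

lemma ae_notMem_lattice (B : Set ℂ) : ∀ᵐ z ∂(volume.restrict B), z ∉ squarePeriods.lattice :=
  ae_restrict_of_ae (by
    rw [ae_iff]
    simpa using squarePeriods.countable_lattice.measure_zero volume)

/-- Uniform integrability of the negative square root of the chordal distance of `℘` to a point. -/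
lemma exists_lintegral_inv_chordal_le : ∃ K : ℝ≥0∞, K ≠ ⊤ ∧ ∀ (c : ℂ), ∀ s ∈ unitCell,
    ∫⁻ z in unitCell, ENNReal.ofReal √(√(1 + ‖c‖ ^ 2) /
      ‖squarePeriods.weierstrassP (z - s) - c‖) ≤ K := by
  set B := Metric.closedBall (0 : ℂ) 2 with hB
  have hBc : IsCompact B := isCompact_closedBall 0 2
  obtain ⟨C, Ω, hC, h⟩ := squarePeriods.exists_inv_chordal_le (hBc.prod hBc)
  obtain ⟨K, hK, hK'⟩ := exists_lintegral_inv_enorm_sub_le B hBc.measure_lt_top.ne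
  refine ⟨C * ∑ _ω ∈ Ω, (K + K), ENNReal.mul_ne_top hC ?_, fun c s hs => ?_⟩
  · exact ENNReal.sum_ne_top.2 fun _ _ => ENNReal.add_ne_top.2 ⟨hK, hK⟩
  -- Writing `c = ℘ a` with `a` in the period square turns uniformity over the noncompact range of
  -- `c` into uniformity over a compact set of `a`.
  obtain ⟨a', ha', hac'⟩ := squarePeriods.exists_weierstrassP_eq c
  obtain ⟨a, ha, haa'⟩ := exists_mem_unitCell a'
  have haL : a ∉ squarePeriods.lattice := fun h => ha' (by simpa using sub_mem h haa')
  have hac : squarePeriods.weierstrassP a = c := by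
    rw [← hac', squarePeriods.weierstrassP_eq_iff haL ha']; exact Or.inl haa'
  refine (lintegral_unitCell_comp_sub_le (fun y => ENNReal.ofReal √(√(1 + ‖c‖ ^ 2) /
      ‖squarePeriods.weierstrassP y - c‖)) hs).trans ?_
  calc ∫⁻ y in B, ENNReal.ofReal √(√(1 + ‖c‖ ^ 2) / ‖squarePeriods.weierstrassP y - c‖)
      ≤ ∫⁻ y in B, C * ∑ ω ∈ Ω, (‖y - (a + ω)‖ₑ⁻¹ + ‖y - (ω - a)‖ₑ⁻¹) := by
        refine lintegral_mono_ae ?_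
        filter_upwards [ae_notMem_lattice B,
          ae_restrict_mem (Metric.isClosed_closedBall.measurableSet)] with y hy hyB
        have := h (y, a) ⟨hyB, unitCell_subset_closedBall ha⟩ hy haL
        rw [← hac]
        refine this.trans (le_of_eq ?_)
        congr 1
        refine Finset.sum_congr rfl fun ω _ => ?_
        congr 3
        · ring
        · ring
    _ = C * ∑ ω ∈ Ω, ((∫⁻ y in B, ‖y - (a + ω)‖ₑ⁻¹) + ∫⁻ y in B, ‖y - (ω - a)‖ₑ⁻¹) := by
        rw [lintegral_const_mul' _ _ hC, lintegral_finsetSum _ (fun ω _ => by fun_prop)]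
        congr 1
        refine Finset.sum_congr rfl fun ω _ => ?_
        rw [lintegral_add_left (by fun_prop)]
    _ ≤ _ := by
        gcongr
        · exact hK' _
        · exact hK' _

lemma exists_lintegral_sqrt_weierstrassP_le : ∃ K : ℝ≥0∞, K ≠ ⊤ ∧ ∀ s ∈ unitCell,
    ∫⁻ z in unitCell, ENNReal.ofReal √(1 + ‖squarePeriods.weierstrassP (z - s)‖) ≤ K := by
  set B := Metric.closedBall (0 : ℂ) 2 with hB
  have hBc : IsCompact B := isCompact_closedBall 0 2
  obtain ⟨C, Ω, hC, h⟩ := squarePeriods.exists_sqrt_weierstrassP_le hBc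
  obtain ⟨K, hK, hK'⟩ := exists_lintegral_inv_enorm_sub_le B hBc.measure_lt_top.ne
  refine ⟨C * (volume B + ∑ _ω ∈ Ω, K), ENNReal.mul_ne_top hC (ENNReal.add_ne_top.2
    ⟨hBc.measure_lt_top.ne, ENNReal.sum_ne_top.2 fun _ _ => hK⟩), fun s hs => ?_⟩
  refine (lintegral_unitCell_comp_sub_le
    (fun y => ENNReal.ofReal √(1 + ‖squarePeriods.weierstrassP y‖)) hs).trans ?_
  calc ∫⁻ y in B, ENNReal.ofReal √(1 + ‖squarePeriods.weierstrassP y‖)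
      ≤ ∫⁻ y in B, C * (1 + ∑ ω ∈ Ω, ‖y - ω‖ₑ⁻¹) := by
        refine lintegral_mono_ae ?_
        filter_upwards [ae_notMem_lattice B,
          ae_restrict_mem (Metric.isClosed_closedBall.measurableSet)] with y hy hyB
        exact h y hyB hy
    _ = C * (volume B + ∑ ω ∈ Ω, ∫⁻ y in B, ‖y - ω‖ₑ⁻¹) := by
        rw [lintegral_const_mul' _ _ hC, lintegral_add_left measurable_const,
          lintegral_finsetSum _ (fun ω _ => by fun_prop)]
        simp
    _ ≤ _ := by
        gcongr
        exact hK' _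

/-! ### Paths with a global lift -/

lemma speed_congr {γ γ' : ℝ → ModuliSpace} {t : ℝ} (h : γ =ᶠ[𝓝 t] γ') : speed γ t = speed γ' t := by
  unfold speed
  congr 2
  · rw [h.self_of_nhds]
  · ext z
    exact Filter.EventuallyEq.deriv_eq (h.fun_comp fun W => coord (W.1 z))

lemma speed_comp_sub_const (γ : ℝ → ModuliSpace) (b t : ℝ) :
    speed (fun τ => γ (τ - b)) t = speed γ (t - b) := by
  unfold speed
  congr 2
  ext z
  exact deriv_comp_sub_const (f := fun τ => coord ((γ τ).1 z)) b t

lemma speed_comp_const_sub (γ : ℝ → ModuliSpace) (b t : ℝ) :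
    speed (fun τ => γ (b - τ)) t = speed γ (b - t) := by
  unfold speed metricSq
  congr 1
  refine lintegral_congr fun z => ?_
  have : deriv (fun τ => coord ((γ (b - τ)).1 z)) t =
      -deriv (fun τ => coord ((γ τ).1 z)) (b - t) :=
    deriv_comp_const_sub (f := fun τ => coord ((γ τ).1 z)) b t
  simp only [this, norm_neg]

/-- A curve in the moduli space, parametrized by `[0, 1]`, with a global continuously
differentiable lift to `SL(2, ℂ) × ℂ`. -/
structure Segment (W W' : ModuliSpace) where
  /-- the lift to `SL(2, ℂ)` -/
  M : ℝ → SL(2, ℂ)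
  /-- the lift of the translation parameter -/
  s : ℝ → ℂ
  contDiff_M : ∀ i j, ContDiff ℝ 1 (fun τ => M τ i j)
  contDiff_s : ContDiff ℝ 1 s
  source : lump (M 0) (s 0) = W
  target : lump (M 1) (s 1) = W'

namespace Segment

variable {W W' : ModuliSpace}

/-- The curve itself. -/
def curve (S : Segment W W') (τ : ℝ) : ModuliSpace := lump (S.M τ) (S.s τ)

/-- The length of the curve. -/
def length (S : Segment W W') : ℝ≥0∞ := ∫⁻ t in Icc 0 1, speed S.curve t

/-- The reversed curve. -/
def symm (S : Segment W W') : Segment W' W where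
  M τ := S.M (1 - τ)
  s τ := S.s (1 - τ)
  contDiff_M i j := (S.contDiff_M i j).comp (contDiff_const.sub contDiff_id)
  contDiff_s := S.contDiff_s.comp (contDiff_const.sub contDiff_id)
  source := by rw [sub_zero]; exact S.target
  target := by rw [sub_self]; exact S.source

lemma length_symm (S : Segment W W') : S.symm.length = S.length := by
  unfold length
  have h : ∀ t, speed S.symm.curve t = speed S.curve (1 - t) := fun t =>
    speed_comp_const_sub S.curve 1 t
  simp only [h]
  rw [← lintegral_indicator measurableSet_Icc, ← lintegral_indicator measurableSet_Icc,
    ← lintegral_sub_left_eq_self _ 1]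
  refine lintegral_congr fun t => ?_
  have : (1 - t ∈ Icc (0 : ℝ) 1) ↔ t ∈ Icc (0 : ℝ) 1 := by
    simp only [mem_Icc]; constructor <;> rintro ⟨h1, h2⟩ <;> constructor <;> linarith
  by_cases ht : t ∈ Icc (0 : ℝ) 1
  · rw [indicator_of_mem (this.2 ht), indicator_of_mem ht, sub_sub_cancel]
  · rw [indicator_of_notMem (fun h => ht (this.1 h)), indicator_of_notMem ht]

end Segment

lemma PiecewiseC1Path.p_le {W W' : ModuliSpace} (c : PiecewiseC1Path W W') {i j : ℕ} (hij : i ≤ j)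
    (hj : j ≤ c.n) : c.p i ≤ c.p j := by
  induction j, hij using Nat.le_induction with
  | base => exact le_rfl
  | succ j hij ih => exact (ih (by omega)).trans (c.lt_succ j (by omega)).le

lemma IsC1On.congr {γ γ' : ℝ → ModuliSpace} {a b : ℝ} (h : IsC1On γ a b)
    (heq : ∀ t ∈ Icc a b, γ' t = γ t) : IsC1On γ' a b := by
  intro t ht
  obtain ⟨M, s, hM, hs, hev⟩ := h t ht
  refine ⟨M, s, hM, hs, ?_⟩
  filter_upwards [hev, self_mem_nhdsWithin] with τ h1 h2
  rw [heq τ h2]; exact h1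

variable {W₀ W W' : ModuliSpace}

/-- A path followed by a segment. -/
def PiecewiseC1Path.extend (c : PiecewiseC1Path W₀ W) (S : Segment W W') :
    PiecewiseC1Path W₀ W' where
  γ t := if t ≤ c.p c.n then c.γ t else S.curve (t - c.p c.n)
  n := c.n + 1
  p i := if i ≤ c.n then c.p i else c.p c.n + 1
  lt_succ i hi := by
    rcases Nat.lt_succ_iff_lt_or_eq.1 hi with h | h
    · rw [if_pos h.le, if_pos (Nat.succ_le_of_lt h)]; exact c.lt_succ i h
    · subst h; simp
  c1 i hi := by
    rcases Nat.lt_succ_iff_lt_or_eq.1 hi with h | h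
    · rw [if_pos h.le, if_pos (Nat.succ_le_of_lt h)]
      refine (c.c1 i h).congr fun t ht => if_pos (ht.2.trans (c.p_le (Nat.succ_le_of_lt h) le_rfl))
    · subst h
      simp only [le_refl, if_true, Nat.not_succ_le_self, if_false]
      have h1 : IsC1On (fun t => S.curve (t - c.p c.n)) (c.p c.n) (c.p c.n + 1) := by
        intro t _
        refine ⟨fun τ => S.M (τ - c.p c.n), fun τ => S.s (τ - c.p c.n), fun i j => ?_, ?_, ?_⟩
        · exact ((S.contDiff_M i j).comp (contDiff_id.sub contDiff_const)).contDiffAt.contDiffWithinAt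
        · exact (S.contDiff_s.comp (contDiff_id.sub contDiff_const)).contDiffAt.contDiffWithinAt
        · exact Eventually.of_forall fun τ z => rfl
      refine h1.congr fun t ht => ?_
      split_ifs with h2
      · have : t = c.p c.n := le_antisymm h2 ht.1
        subst this
        rw [sub_self, c.target]; exact S.source.symm
      · rfl
  source := by
    simp only [Nat.zero_le, if_true]
    rw [if_pos (c.p_le (Nat.zero_le _) le_rfl), c.source]
  target := by
    simp only [Nat.not_succ_le_self, if_false]
    rw [if_neg (by linarith), add_sub_cancel_left]
    exact S.target

/-- Off the junction time the extended path agrees locally with one of its pieces. At the junction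
the two-sided derivative may be meaningless, but a single time is a null set. -/
lemma PiecewiseC1Path.length_extend_le (c : PiecewiseC1Path W₀ W) (S : Segment W W') :
    (c.extend S).length ≤ c.length + S.length := by
  set b := c.p c.n with hb
  have hp0 : (c.extend S).p 0 = c.p 0 := by simp [extend]
  have hpn : (c.extend S).p (c.extend S).n = b + 1 := by simp [extend, hb]
  have hle : c.p 0 ≤ b := c.p_le (Nat.zero_le _) le_rfl
  unfold length
  rw [hp0, hpn]
  have hsub : Icc (c.p 0) (b + 1) ⊆ Ico (c.p 0) b ∪ ({b} ∪ Ioc b (b + 1)) := by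
    intro t ht
    rcases lt_trichotomy t b with h | h | h
    · exact Or.inl ⟨ht.1, h⟩
    · exact Or.inr (Or.inl h)
    · exact Or.inr (Or.inr ⟨h, ht.2⟩)
  have h1 : ∫⁻ t in Ico (c.p 0) b, speed (c.extend S).γ t ≤ ∫⁻ t in Icc (c.p 0) b, speed c.γ t := by
    refine le_trans (le_of_eq ?_) (lintegral_mono_set Ico_subset_Icc_self)
    refine setLIntegral_congr_fun measurableSet_Ico fun t ht => speed_congr ?_
    filter_upwards [Iio_mem_nhds ht.2] with τ hτ
    exact if_pos (le_of_lt hτ)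
  have h2 : ∫⁻ t in Ioc b (b + 1), speed (c.extend S).γ t ≤ S.length := by
    have e1 : ∫⁻ t in Ioc b (b + 1), speed (c.extend S).γ t =
        ∫⁻ t in Ioc b (b + 1), speed S.curve (t - b) := by
      refine setLIntegral_congr_fun measurableSet_Ioc fun t ht => ?_
      rw [← speed_comp_sub_const]
      refine speed_congr ?_
      filter_upwards [Ioi_mem_nhds ht.1] with τ hτ
      exact if_neg (not_le.2 hτ)
    rw [e1]
    refine (lintegral_mono_set Ioc_subset_Icc_self).trans (le_of_eq ?_)
    unfold Segment.length
    rw [← lintegral_indicator measurableSet_Icc, ← lintegral_indicator measurableSet_Icc,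
      ← lintegral_sub_right_eq_self ((Icc (0 : ℝ) 1).indicator _) b]
    refine lintegral_congr fun t => ?_
    have : (t - b ∈ Icc (0 : ℝ) 1) ↔ t ∈ Icc b (b + 1) := by
      simp only [mem_Icc]; constructor <;> rintro ⟨h1, h2⟩ <;> constructor <;> linarith
    by_cases ht : t ∈ Icc b (b + 1)
    · rw [indicator_of_mem (this.2 ht), indicator_of_mem ht]
    · rw [indicator_of_notMem (fun h => ht (this.1 h)), indicator_of_notMem ht]
  calc ∫⁻ t in Icc (c.p 0) (b + 1), speed (c.extend S).γ t
      ≤ ∫⁻ t in Ico (c.p 0) b ∪ ({b} ∪ Ioc b (b + 1)), speed (c.extend S).γ t :=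
        lintegral_mono_set hsub
    _ ≤ (∫⁻ t in Ico (c.p 0) b, speed (c.extend S).γ t) +
        ∫⁻ t in {b} ∪ Ioc b (b + 1), speed (c.extend S).γ t := lintegral_union_le _ _ _
    _ ≤ (∫⁻ t in Ico (c.p 0) b, speed (c.extend S).γ t) +
        ((∫⁻ t in {b}, speed (c.extend S).γ t) +
          ∫⁻ t in Ioc b (b + 1), speed (c.extend S).γ t) := by
        gcongr; exact lintegral_union_le _ _ _
    _ ≤ _ := by
        rw [setLIntegral_measure_zero {b} _ (by simp), zero_add]
        exact add_le_add h1 h2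

lemma riemDist_self (W : ModuliSpace) : riemDist W W = 0 := by
  refine le_antisymm (iInf_le_of_le ⟨fun _ => W, 0, fun _ => 0, by simp, by simp, rfl, rfl⟩ ?_)
    zero_le
  simp [PiecewiseC1Path.length]

/-- This replaces the triangle inequality: paths are only ever extended at their end, by a segment.
-/
lemma Segment.riemDist_le (S : Segment W W') (W₀ : ModuliSpace) :
    riemDist W₀ W' ≤ riemDist W₀ W + S.length := by
  unfold riemDist
  rw [ENNReal.iInf_add]
  exact le_iInf fun c => iInf_le_of_le (c.extend S) (c.length_extend_le S)

/-! ### Bounds for the speed -/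

/-- The Fubini–Study density in homogeneous coordinates. The Wronskian in the numerator is invariant
under a constant matrix of determinant `1`, the denominator under a unitary one. -/
lemma norm_deriv_div_sq_div {y₁ y₂ : ℝ → ℂ} {y₁' y₂' : ℂ} {t : ℝ} (h₁ : HasDerivAt y₁ y₁' t)
    (h₂ : HasDerivAt y₂ y₂' t) (h0 : y₂ t ≠ 0) :
    ‖deriv (fun τ => y₁ τ / y₂ τ) t‖ ^ 2 / (1 + ‖y₁ t / y₂ t‖ ^ 2) ^ 2 =
      ‖y₁' * y₂ t - y₁ t * y₂'‖ ^ 2 / (‖y₁ t‖ ^ 2 + ‖y₂ t‖ ^ 2) ^ 2 := by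
  have e : HasDerivAt (fun τ => y₁ τ / y₂ τ) ((y₁' * y₂ t - y₁ t * y₂') / y₂ t ^ 2) t := h₁.div h₂ h0
  rw [e.deriv, norm_div, norm_div, norm_pow]
  have : 0 < ‖y₂ t‖ := norm_pos_iff.2 h0
  field_simp
  rw [add_comm]

/-- A bound for the speed of a curve from a pointwise bound of the kinetic energy density, in
homogeneous coordinates. -/
lemma speed_le {γ : ℝ → ModuliSpace} {t B : ℝ} (hB : 0 ≤ B) {G : ℂ → ℝ} {K : ℝ≥0∞}
    (hK : ∫⁻ z in unitCell, ENNReal.ofReal (G z) ≤ K)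
    (h : ∀ᵐ z ∂(volume.restrict unitCell), ∃ (y₁ y₂ : ℝ → ℂ) (y₁' y₂' : ℂ),
      HasDerivAt y₁ y₁' t ∧ HasDerivAt y₂ y₂' t ∧ y₂ t ≠ 0 ∧
      (∀ᶠ τ in 𝓝 t, (γ τ).1 z = ofHomog (y₁ τ) (y₂ τ)) ∧
      ‖y₁' * y₂ t - y₁ t * y₂'‖ ^ 2 / (‖y₁ t‖ ^ 2 + ‖y₂ t‖ ^ 2) ^ 2 ≤ B ^ 2 * G z) :
    speed γ t ≤ ENNReal.ofReal B * K ^ (1 / 2 : ℝ) := by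
  have h1 : metricSq (fun z => coord ((γ t).1 z)) (fun z => deriv (fun τ => coord ((γ τ).1 z)) t) ≤
      ENNReal.ofReal B ^ 2 * K := by
    unfold metricSq
    calc _ ≤ ∫⁻ z in unitCell, ENNReal.ofReal B ^ 2 * ENNReal.ofReal (G z) := by
          refine lintegral_mono_ae ?_
          filter_upwards [h] with z hz
          obtain ⟨y₁, y₂, y₁', y₂', d₁, d₂, h0, hev, hle⟩ := hz
          have hev' : (fun τ => coord ((γ τ).1 z)) =ᶠ[𝓝 t] fun τ => y₁ τ / y₂ τ := by
            filter_upwards [hev] with τ hτ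
            rw [hτ, coord_ofHomog]
          rw [hev'.deriv_eq, show coord ((γ t).1 z) = y₁ t / y₂ t from hev'.self_of_nhds,
            norm_deriv_div_sq_div d₁ d₂ h0, ← ENNReal.ofReal_pow hB,
            ← ENNReal.ofReal_mul (by positivity)]
          exact ENNReal.ofReal_le_ofReal hle
      _ = ENNReal.ofReal B ^ 2 * ∫⁻ z in unitCell, ENNReal.ofReal (G z) :=
          lintegral_const_mul' _ _ (ENNReal.pow_ne_top ENNReal.ofReal_ne_top)
      _ ≤ _ := by gcongr
  unfold speed
  refine (ENNReal.rpow_le_rpow h1 (by norm_num)).trans (le_of_eq ?_)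
  rw [ENNReal.mul_rpow_of_nonneg _ _ (by norm_num), ← ENNReal.rpow_natCast, ← ENNReal.rpow_mul]
  norm_num

lemma ae_notMem_lattice_and_ne_zero (U : SL(2, ℂ)) (r : ℝ) (c s : ℂ) :
    ∀ᵐ z ∂(volume.restrict unitCell), z - s ∉ squarePeriods.lattice ∧
      U 1 0 * (Real.exp (2 * r) * (squarePeriods.weierstrassP (z - s) - c)) + U 1 1 ≠ 0 := by
  have hU : U 0 0 * U 1 1 - U 0 1 * U 1 0 = 1 := by
    have := U.2; rwa [Matrix.det_fin_two] at this
  have hk : (Real.exp (2 * r) : ℂ) ≠ 0 := by exact_mod_cast (Real.exp_pos _).ne'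
  have hc : ∀ S : Set ℂ, S.Countable → ∀ᵐ z ∂(volume.restrict unitCell), z - s ∉ S := fun S hS => by
    refine ae_restrict_of_ae ?_
    have h2 : ((fun z => z - s) ⁻¹' S).Countable :=
      hS.preimage_of_injOn (fun a _ b _ h => sub_left_injective h)
    exact h2.ae_notMem volume
  filter_upwards [hc _ squarePeriods.countable_lattice, hc _ (squarePeriods.countable_weierstrassP_fiber
    (c - U 1 1 / (U 1 0 * Real.exp (2 * r))))] with z h1 h2
  refine ⟨h1, fun h0 => h2 ?_⟩
  have h10 : U 1 0 ≠ 0 := by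
    intro h
    rw [h, zero_mul, zero_add] at h0
    simp [h, h0] at hU
  change squarePeriods.weierstrassP (z - s) = _
  field_simp
  linear_combination h0

/-- Unitary matrices preserve the norm of `(f, 1)`; this is the source of the `SU(2)` invariance of
the energy density. -/
lemma norm_sq_add_norm_sq_suMat (θ φ ψ : ℝ) (f : ℂ) :
    ‖suMat θ φ ψ 0 0 * f + suMat θ φ ψ 0 1‖ ^ 2 + ‖suMat θ φ ψ 1 0 * f + suMat θ φ ψ 1 1‖ ^ 2 =
      1 + ‖f‖ ^ 2 := by
  have h01 : suMat θ φ ψ 0 1 = -(starRingEnd ℂ) (suMat θ φ ψ 1 0) := by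
    change -((Real.sin θ : ℂ) * Complex.exp (-(ψ * Complex.I))) =
      -(starRingEnd ℂ) ((Real.sin θ : ℂ) * Complex.exp (ψ * Complex.I))
    rw [map_mul, ← Complex.exp_conj, map_mul, Complex.conj_ofReal, Complex.conj_ofReal,
      Complex.conj_I, mul_neg]
  have h11 : suMat θ φ ψ 1 1 = (starRingEnd ℂ) (suMat θ φ ψ 0 0) := by
    change (Real.cos θ : ℂ) * Complex.exp (-(φ * Complex.I)) =
      (starRingEnd ℂ) ((Real.cos θ : ℂ) * Complex.exp (φ * Complex.I))
    rw [map_mul, ← Complex.exp_conj, map_mul, Complex.conj_ofReal, Complex.conj_ofReal,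
      Complex.conj_I, mul_neg]
  have hU : suMat θ φ ψ 0 0 * suMat θ φ ψ 1 1 - suMat θ φ ψ 0 1 * suMat θ φ ψ 1 0 = 1 := by
    have := (suMat θ φ ψ).2; rwa [Matrix.det_fin_two] at this
  rw [h01, h11] at hU ⊢
  generalize suMat θ φ ψ 0 0 = a at *
  generalize suMat θ φ ψ 1 0 = b at *
  have : ((‖a * f + -(starRingEnd ℂ) b‖ ^ 2 + ‖b * f + (starRingEnd ℂ) a‖ ^ 2 : ℝ) : ℂ) =
      ((1 + ‖f‖ ^ 2 : ℝ) : ℂ) := by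
    push_cast
    rw [← Complex.mul_conj', ← Complex.mul_conj', ← Complex.mul_conj']
    simp only [map_add, map_neg, map_mul, Complex.conj_conj]
    linear_combination (1 + f * (starRingEnd ℂ) f) * hU
  exact_mod_cast this

/-- The speed of a curve in a fibre of the `SU(2)` action. -/
lemma speed_le_of_affine {θ φ ψ : ℝ} {r : ℝ → ℝ} {c s : ℝ → ℂ} {t B : ℝ} (hB : 0 ≤ B)
    {G : ℂ → ℝ} {K : ℝ≥0∞} (hK : ∫⁻ z in unitCell, ENNReal.ofReal (G z) ≤ K)
    (hs : ContinuousAt s t)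
    (h : ∀ z, z - s t ∉ squarePeriods.lattice → ∃ (f : ℝ → ℂ) (f' : ℂ), HasDerivAt f f' t ∧
      (∀ τ, f τ = Real.exp (2 * r τ) * (squarePeriods.weierstrassP (z - s τ) - c τ)) ∧
      ‖f'‖ ^ 2 / (1 + ‖f t‖ ^ 2) ^ 2 ≤ B ^ 2 * G z) :
    speed (fun τ => lump (suMat θ φ ψ * triMat (r τ) (c τ)) (s τ)) t ≤
      ENNReal.ofReal B * K ^ (1 / 2 : ℝ) := by
  refine speed_le hB hK ?_
  filter_upwards [ae_notMem_lattice_and_ne_zero (suMat θ φ ψ) (r t) (c t) (s t)] with z ⟨h1, h2⟩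
  obtain ⟨f, f', hf, hfe, hle⟩ := h z h1
  set U := suMat θ φ ψ with hUdef
  have hU : U 0 0 * U 1 1 - U 0 1 * U 1 0 = 1 := by
    have := U.2; rwa [Matrix.det_fin_two] at this
  refine ⟨fun τ => U 0 0 * f τ + U 0 1, fun τ => U 1 0 * f τ + U 1 1, U 0 0 * f', U 1 0 * f',
    (hf.const_mul _).add_const _, (hf.const_mul _).add_const _, ?_, ?_, ?_⟩
  · simp only [hfe]; exact h2
  · have h3 : Tendsto (fun τ => z - s τ) (𝓝 t) (𝓝 (z - s t)) := tendsto_const_nhds.sub hs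
    filter_upwards [h3.eventually (squarePeriods.eventually_notMem_lattice h1)] with τ hτ
    rw [lump_apply, orbitMap_mul_triMat U _ _ _ hτ, hfe]
  · rw [norm_sq_add_norm_sq_suMat]
    refine le_trans (le_of_eq ?_) hle
    congr 3
    linear_combination f' * hU

/-- A bound for the length from a bound of the speed by a function with bounded primitive. -/
lemma Segment.length_le {W W' : ModuliSpace} (S : Segment W W') {F F' : ℝ → ℝ} {A : ℝ} {K : ℝ≥0∞}
    (hF : ∀ t ∈ Icc (0 : ℝ) 1, HasDerivAt F (F' t) t) (hF' : ContinuousOn F' (Icc 0 1))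
    (h0 : ∀ t ∈ Icc (0 : ℝ) 1, 0 ≤ F' t) (hA : F 1 - F 0 ≤ A)
    (hS : ∀ t ∈ Icc (0 : ℝ) 1, speed S.curve t ≤ ENNReal.ofReal (F' t) * K) :
    S.length ≤ ENNReal.ofReal A * K := by
  have hi : IntegrableOn F' (Icc 0 1) := hF'.integrableOn_Icc
  unfold length
  calc ∫⁻ t in Icc 0 1, speed S.curve t ≤ ∫⁻ t in Icc 0 1, ENNReal.ofReal (F' t) * K :=
        setLIntegral_mono' measurableSet_Icc hS
    _ = (∫⁻ t in Icc 0 1, ENNReal.ofReal (F' t)) * K :=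
        lintegral_mul_const'' _ hi.aemeasurable.ennreal_ofReal
    _ ≤ _ := by
        gcongr
        rw [← ofReal_integral_eq_lintegral_ofReal hi
          ((ae_restrict_iff' measurableSet_Icc).2 (Eventually.of_forall h0)),
          integral_Icc_eq_integral_Ioc, ← intervalIntegral.integral_of_le zero_le_one,
          intervalIntegral.integral_eq_sub_of_hasDerivAt]
        · exact ENNReal.ofReal_le_ofReal hA
        · rw [uIcc_of_le zero_le_one]; exact hF
        · exact ContinuousOn.intervalIntegrable (by rwa [uIcc_of_le zero_le_one])

lemma contDiff_suMat_mul_triMat {θ φ ψ r : ℝ → ℝ} {c : ℝ → ℂ} (hθ : ContDiff ℝ 1 θ)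
    (hφ : ContDiff ℝ 1 φ) (hψ : ContDiff ℝ 1 ψ) (hr : ContDiff ℝ 1 r) (hc : ContDiff ℝ 1 c)
    (i j : Fin 2) :
    ContDiff ℝ 1 fun τ => (suMat (θ τ) (φ τ) (ψ τ) * triMat (r τ) (c τ)) i j := by
  have hof : ∀ {g : ℝ → ℝ}, ContDiff ℝ 1 g → ContDiff ℝ 1 fun τ => (g τ : ℂ) := fun hg =>
    Complex.ofRealCLM.contDiff.comp hg
  have hU : ∀ i j, ContDiff ℝ 1 fun τ => suMat (θ τ) (φ τ) (ψ τ) i j := by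
    intro i j
    fin_cases i <;> fin_cases j
    · exact (hof hθ.cos).mul ((hof hφ).mul contDiff_const).cexp
    · exact ((hof hθ.sin).mul ((hof hψ).mul contDiff_const).neg.cexp).neg
    · exact (hof hθ.sin).mul ((hof hψ).mul contDiff_const).cexp
    · exact (hof hθ.cos).mul ((hof hφ).mul contDiff_const).neg.cexp
  have hT : ∀ i j, ContDiff ℝ 1 fun τ => triMat (r τ) (c τ) i j := by
    intro i j
    fin_cases i <;> fin_cases j
    · exact hof hr.exp
    · exact ((hof hr.exp).mul hc).neg
    · exact contDiff_const
    · exact hof hr.neg.exp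
  simp only [Matrix.SpecialLinearGroup.coe_mul, Matrix.mul_apply, Fin.sum_univ_two]
  exact ((hU i 0).mul (hT 0 j)).add ((hU i 1).mul (hT 1 j))

/-- The curve given by a family of parameters, with a bound for its length from a bound of the
speed by a function with bounded primitive. -/
lemma exists_segment {W W' : ModuliSpace} {θ φ ψ r : ℝ → ℝ} {c s : ℝ → ℂ} (hθ : ContDiff ℝ 1 θ)
    (hφ : ContDiff ℝ 1 φ) (hψ : ContDiff ℝ 1 ψ) (hr : ContDiff ℝ 1 r) (hc : ContDiff ℝ 1 c)
    (hs : ContDiff ℝ 1 s) (hW : lump (suMat (θ 0) (φ 0) (ψ 0) * triMat (r 0) (c 0)) (s 0) = W)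
    (hW' : lump (suMat (θ 1) (φ 1) (ψ 1) * triMat (r 1) (c 1)) (s 1) = W')
    {F F' : ℝ → ℝ} {A : ℝ} {K : ℝ≥0∞}
    (hF : ∀ t ∈ Icc (0 : ℝ) 1, HasDerivAt F (F' t) t) (hF' : ContinuousOn F' (Icc 0 1))
    (h0 : ∀ t ∈ Icc (0 : ℝ) 1, 0 ≤ F' t) (hA : F 1 - F 0 ≤ A)
    (hS : ∀ t ∈ Icc (0 : ℝ) 1, speed (fun τ => lump (suMat (θ τ) (φ τ) (ψ τ) *
      triMat (r τ) (c τ)) (s τ)) t ≤ ENNReal.ofReal (F' t) * K) :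
    ∃ S : Segment W W', S.length ≤ ENNReal.ofReal A * K :=
  ⟨⟨fun τ => suMat (θ τ) (φ τ) (ψ τ) * triMat (r τ) (c τ), s,
    contDiff_suMat_mul_triMat hθ hφ hψ hr hc, hs, hW, hW'⟩,
    Segment.length_le _ hF hF' h0 hA hS⟩

/-! ### The four stages of a path from `℘` to an arbitrary lump -/

/-- Any positive power of `u` would give exponential decay along contractions. The power `1 / 2`
turns a double pole into an integrable singularity `1 / ‖z‖`; the inverse version below does the
same for double zeros. -/
lemma sq_div_le_sqrt {u : ℝ} (hu : 0 ≤ u) : u ^ 2 / (1 + u ^ 2) ^ 2 ≤ √u := by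
  obtain ⟨v, hv, rfl⟩ : ∃ v, 0 ≤ v ∧ u = v ^ 2 := ⟨√u, Real.sqrt_nonneg _, (Real.sq_sqrt hu).symm⟩
  rw [Real.sqrt_sq hv, div_le_iff₀ (by positivity)]
  have : v ^ 3 ≤ (1 + (v ^ 2) ^ 2) ^ 2 := by
    nlinarith [sq_nonneg (v ^ 2 - v), sq_nonneg (v ^ 2), sq_nonneg v, sq_nonneg (v - 1),
      sq_nonneg (v ^ 4), sq_nonneg (v * (v - 1))]
  calc (v ^ 2) ^ 2 = v * v ^ 3 := by ring
    _ ≤ _ := by gcongr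

lemma sq_div_le_sqrt_inv {u : ℝ} (hu : 0 ≤ u) : u ^ 2 / (1 + u ^ 2) ^ 2 ≤ √u⁻¹ := by
  rcases hu.eq_or_lt with rfl | hu'
  · simp
  have := sq_div_le_sqrt (inv_nonneg.2 hu)
  refine le_trans (le_of_eq ?_) this
  field_simp
  ring

lemma exp_mul_sqrt {x y : ℝ} : √(Real.exp x * y) = Real.exp (x / 2) * √y := by
  rw [Real.sqrt_mul (Real.exp_pos _).le, ← Real.exp_half]

/-- Dilations: the density is controlled by the two integrable functions of the lemmas above. -/
lemma dilation_density_le {c p : ℂ} {T τ : ℝ} :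
    ‖(T * Real.exp (T * τ) / √(1 + ‖c‖ ^ 2) : ℝ) * (p - c)‖ ^ 2 /
      (1 + ‖(Real.exp (T * τ) / √(1 + ‖c‖ ^ 2) : ℝ) * (p - c)‖ ^ 2) ^ 2 ≤
    (|T| * Real.exp (-|T| * τ / 4)) ^ 2 *
      (√(1 + ‖p‖) + √(√(1 + ‖c‖ ^ 2) / ‖p - c‖)) := by
  set N := √(1 + ‖c‖ ^ 2) with hN
  have hN1 : 1 ≤ N := Real.one_le_sqrt.2 (by nlinarith [sq_nonneg ‖c‖])
  have hNc : ‖c‖ ≤ N := Real.le_sqrt_of_sq_le (by linarith)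
  set g := ‖p - c‖ / N with hg
  have hg0 : 0 ≤ g := by positivity
  have hgP : g ≤ 1 + ‖p‖ := by
    rw [hg, div_le_iff₀ (by positivity)]
    nlinarith [norm_sub_le p c, norm_nonneg p]
  set u := Real.exp (T * τ) * g with hu
  have hu0 : 0 ≤ u := by positivity
  have e1 : ‖((Real.exp (T * τ) / N : ℝ) : ℂ) * (p - c)‖ = u := by
    rw [norm_mul, Complex.norm_real, Real.norm_of_nonneg (by positivity)]
    rw [hu, hg]; ring
  have e2 : ‖((T * Real.exp (T * τ) / N : ℝ) : ℂ) * (p - c)‖ = |T| * u := by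
    rw [mul_div_assoc, Complex.ofReal_mul, mul_assoc, norm_mul, e1, Complex.norm_real,
      Real.norm_eq_abs]
  have e3 : (|T| * Real.exp (-|T| * τ / 4)) ^ 2 = |T| ^ 2 * Real.exp (-|T| * τ / 2) := by
    rw [mul_pow, ← Real.exp_nat_mul]; congr 2; push_cast; ring
  rw [e1, e2, e3, mul_pow, mul_div_assoc, mul_assoc]
  refine mul_le_mul_of_nonneg_left ?_ (by positivity)
  have hs1 := Real.sqrt_nonneg (1 + ‖p‖)
  have hs2 := Real.sqrt_nonneg (N / ‖p - c‖)
  -- Expansion is controlled by the bound `√u⁻¹`, contraction by `√u`; each yields the factor `exp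
  -- (-|T| τ / 2)`.
  rcases le_total 0 T with hT | hT
  · rw [abs_of_nonneg hT]
    refine (sq_div_le_sqrt_inv hu0).trans ?_
    rw [hu, mul_inv, ← Real.exp_neg, exp_mul_sqrt, hg, inv_div,
      show -(T * τ) / 2 = -T * τ / 2 by ring]
    gcongr
    linarith
  · rw [abs_of_nonpos hT, neg_neg]
    refine (sq_div_le_sqrt hu0).trans ?_
    rw [hu, exp_mul_sqrt]
    gcongr
    linarith [Real.sqrt_le_sqrt hgP]

/-- The logarithm of the scale moves linearly by `T`, starting from the scale `1 / √(1 + ‖c‖²)`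
adapted to `c`. The integral of `|T| exp (-|T| τ / 4)` is at most `4`, however large `T` is. -/
lemma exists_segment_dilation : ∃ C : ℝ≥0∞, C ≠ ⊤ ∧ ∀ (θ φ ψ r : ℝ) (c : ℂ), ∀ s ∈ unitCell,
    ∃ S : Segment (lump (suMat θ φ ψ * triMat (-(Real.log (1 + ‖c‖ ^ 2) / 4)) c) s)
      (lump (suMat θ φ ψ * triMat r c) s), S.length ≤ C := by
  obtain ⟨K₁, hK₁, h₁⟩ := exists_lintegral_sqrt_weierstrassP_le
  obtain ⟨K₂, hK₂, h₂⟩ := exists_lintegral_inv_chordal_le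
  refine ⟨ENNReal.ofReal 4 * (K₁ + K₂) ^ (1 / 2 : ℝ), ENNReal.mul_ne_top ENNReal.ofReal_ne_top
    (ENNReal.rpow_ne_top_of_nonneg (by norm_num) (ENNReal.add_ne_top.2 ⟨hK₁, hK₂⟩)), ?_⟩
  intro θ φ ψ r c s hs
  set L := Real.log (1 + ‖c‖ ^ 2) with hL
  set T := 2 * r + L / 2 with hT
  have hpos : 0 < 1 + ‖c‖ ^ 2 := by positivity
  have hexpL : Real.exp (-(L / 2)) = (√(1 + ‖c‖ ^ 2))⁻¹ := by
    rw [Real.exp_neg, ← Real.exp_log (Real.sqrt_pos.2 hpos), Real.log_sqrt hpos.le]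
  refine exists_segment (θ := fun _ => θ) (φ := fun _ => φ) (ψ := fun _ => ψ)
    (r := fun τ => (T * τ - L / 2) / 2) (c := fun _ => c) (s := fun _ => s)
    contDiff_const contDiff_const contDiff_const (by fun_prop) contDiff_const contDiff_const
    (by rw [show (T * 0 - L / 2) / 2 = -(L / 4) by ring])
    (by rw [show (T * 1 - L / 2) / 2 = r by rw [hT]; ring])
    (F := fun τ => -(4 * Real.exp (-|T| * τ / 4)))
    (F' := fun τ => |T| * Real.exp (-|T| * τ / 4)) ?_ (by fun_prop) (fun _ _ => by positivity)
    ?_ ?_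
  · intro t _
    have h := ((((hasDerivAt_id t).const_mul (-|T|)).div_const 4).exp.const_mul 4).neg
    refine h.congr_deriv ?_
    simp only [id]; ring
  · simp only [mul_zero, zero_div, Real.exp_zero, mul_one]
    linarith [Real.exp_pos (-|T| / 4)]
  · intro t _
    refine speed_le_of_affine (G := fun z => √(1 + ‖squarePeriods.weierstrassP (z - s)‖) +
      √(√(1 + ‖c‖ ^ 2) / ‖squarePeriods.weierstrassP (z - s) - c‖)) (by positivity) ?_
      continuousAt_const ?_
    · simp only [ENNReal.ofReal_add (Real.sqrt_nonneg _) (Real.sqrt_nonneg _)]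
      have hm : Measurable fun z => squarePeriods.weierstrassP (z - s) :=
        squarePeriods.meromorphic_weierstrassP.measurable.comp (measurable_id.sub_const s)
      rw [lintegral_add_left (hm.norm.const_add 1).sqrt.ennreal_ofReal]
      exact add_le_add (h₁ s hs) (h₂ c s hs)
    · intro z _
      refine ⟨fun τ => (Real.exp (T * τ) / √(1 + ‖c‖ ^ 2) : ℝ) *
        (squarePeriods.weierstrassP (z - s) - c), (T * Real.exp (T * t) / √(1 + ‖c‖ ^ 2) : ℝ) *
        (squarePeriods.weierstrassP (z - s) - c), ?_, ?_, dilation_density_le⟩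
      · refine HasDerivAt.mul_const ?_ _
        refine HasDerivAt.ofReal_comp ?_
        have h := ((hasDerivAt_id t).const_mul T).exp.div_const (√(1 + ‖c‖ ^ 2))
        refine h.congr_deriv ?_
        simp only [id]; ring
      · intro τ
        rw [show 2 * ((T * τ - L / 2) / 2) = T * τ + -(L / 2) by ring, Real.exp_add, hexpL,
          ← div_eq_mul_inv]

lemma shift_density_le {c p : ℂ} {t N : ℝ} (ht : 0 ≤ t) (hN : N = √(1 + t ^ 2 * ‖c‖ ^ 2)) :
    ‖((-(t * ‖c‖ ^ 2 / N) / N ^ 2 : ℝ) : ℂ) * (p - t * c) + ((N⁻¹ : ℝ) : ℂ) * -c‖ ^ 2 /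
      (1 + ‖((N⁻¹ : ℝ) : ℂ) * (p - t * c)‖ ^ 2) ^ 2 ≤
    (8 * ‖c‖ * (1 + t * ‖c‖) ^ (-(5 / 4) : ℝ)) ^ 2 * √(1 + ‖p‖) := by
  set x := t * ‖c‖ with hx
  have hx0 : 0 ≤ x := by positivity
  have hN2 : N ^ 2 = 1 + x ^ 2 := by rw [hN, Real.sq_sqrt (by positivity)]; ring
  have hN0 : 0 ≤ N := hN ▸ Real.sqrt_nonneg _
  have hN1 : 1 ≤ N := by nlinarith [sq_nonneg x]
  have hNx : x ≤ N := abs_le_of_sq_le_sq' (by linarith) hN0 |>.2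
  have hNpos : 0 < N := by linarith
  have hNC : (N : ℂ) ≠ 0 := by exact_mod_cast hNpos.ne'
  set P := 1 + ‖p‖ with hP
  have hp0 := norm_nonneg p
  have hP1 : 1 ≤ P := by linarith
  set u := ‖((N⁻¹ : ℝ) : ℂ) * (p - t * c)‖ with hu
  have hu0 : 0 ≤ u := norm_nonneg _
  have hu' : ‖p - t * c‖ = N * u := by
    rw [hu, norm_mul, Complex.norm_real, Real.norm_of_nonneg (by positivity)]
    field_simp
  -- The contributions `t² ‖c‖² c` of the contraction and of the shift cancel. This gain makes the
  -- velocity at most `‖c‖ P / N²`.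
  have hnum : ((-(t * ‖c‖ ^ 2 / N) / N ^ 2 : ℝ) : ℂ) * (p - t * c) + ((N⁻¹ : ℝ) : ℂ) * -c =
      (-c - (t * ‖c‖ ^ 2 : ℝ) * p) / (N ^ 3 : ℝ) := by
    have h : (N : ℂ) ^ 2 = 1 + t ^ 2 * (‖c‖ : ℂ) ^ 2 := by
      have : N ^ 2 = 1 + t ^ 2 * ‖c‖ ^ 2 := by rw [hN2, hx]; ring
      exact_mod_cast this
    push_cast
    field_simp
    linear_combination (-c) * h
  have hn : ‖(-c - (t * ‖c‖ ^ 2 : ℝ) * p) / (N ^ 3 : ℝ)‖ ≤ ‖c‖ * P / N ^ 2 := by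
    rw [norm_div, Complex.norm_real, Real.norm_of_nonneg (by positivity),
      div_le_div_iff₀ (by positivity) (by positivity)]
    have : ‖-c - (t * ‖c‖ ^ 2 : ℝ) * p‖ ≤ ‖c‖ * (P * N) := by
      refine (norm_sub_le _ _).trans ?_
      rw [norm_neg, norm_mul, Complex.norm_real, Real.norm_of_nonneg (by positivity)]
      calc ‖c‖ + t * ‖c‖ ^ 2 * ‖p‖ = ‖c‖ * (1 + x * ‖p‖) := by rw [hx]; ring
        _ ≤ ‖c‖ * (P * N) := by
          gcongr
          rw [hP]; nlinarith
    calc _ ≤ ‖c‖ * (P * N) * N ^ 2 := by gcongr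
      _ = _ := by ring
  have hPN : P ≤ N * (2 + u) := by
    have h1 : ‖p‖ ≤ ‖p - t * c‖ + x := by
      calc ‖p‖ = ‖(p - t * c) + t * c‖ := by rw [sub_add_cancel]
        _ ≤ ‖p - t * c‖ + ‖(t : ℂ) * c‖ := norm_add_le _ _
        _ = _ := by rw [norm_mul, Complex.norm_real, Real.norm_of_nonneg ht]
    rw [hu'] at h1
    nlinarith
  -- Of the factor `P²` in the squared velocity, only `√P` is integrable; the remaining `P ^ (3/2)`
  -- is absorbed by `N ^ (3/2)` and by the denominator of the density.
  have hPs : P * √P ≤ N * √N * (8 * (1 + u ^ 2) ^ 2) := by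
    have h1 : √P ≤ √N * (2 + u) := by
      refine (Real.sqrt_le_sqrt hPN).trans ?_
      rw [Real.sqrt_mul hN0]
      gcongr
      exact Real.sqrt_le_iff.2 ⟨by positivity, by nlinarith⟩
    calc P * √P ≤ (N * (2 + u)) * (√N * (2 + u)) := by gcongr
      _ = N * √N * (2 + u) ^ 2 := by ring
      _ ≤ _ := by
        gcongr
        nlinarith [sq_nonneg (u - 2), sq_nonneg (u ^ 2), sq_nonneg u]
  -- The remaining power `N ^ (-5/2)` and `1 + x ≤ 2 N` give the decay exponent `5/4 > 1` of the
  -- speed.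
  have hNN : N * √N / N ^ 4 ≤ 8 * ((1 + x) ^ (-(5 / 4) : ℝ)) ^ 2 := by
    have h1 : N * √N / N ^ 4 = N ^ (-(5 / 2) : ℝ) := by
      rw [Real.sqrt_eq_rpow, ← Real.rpow_one_add' hN0 (by norm_num), ← Real.rpow_natCast,
        ← Real.rpow_sub hNpos]
      norm_num
    have h2 : ((1 + x) ^ (-(5 / 4) : ℝ)) ^ 2 = (1 + x) ^ (-(5 / 2) : ℝ) := by
      rw [← Real.rpow_natCast, ← Real.rpow_mul (by positivity)]
      norm_num
    have h3 : (1 + x) / 2 ≤ N := by linarith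
    have h4 : (2 : ℝ) ^ (5 / 2 : ℝ) ≤ 8 := by
      calc (2 : ℝ) ^ (5 / 2 : ℝ) ≤ 2 ^ (3 : ℝ) :=
            Real.rpow_le_rpow_of_exponent_le (by norm_num) (by norm_num)
        _ = 8 := by norm_num
    rw [h1, h2]
    calc N ^ (-(5 / 2) : ℝ) ≤ ((1 + x) / 2) ^ (-(5 / 2) : ℝ) :=
          Real.rpow_le_rpow_of_nonpos (by positivity) h3 (by norm_num)
      _ = 2 ^ (5 / 2 : ℝ) * (1 + x) ^ (-(5 / 2) : ℝ) := by
          rw [Real.div_rpow (by positivity) (by norm_num), Real.rpow_neg zero_le_two, div_inv_eq_mul,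
            mul_comm]
      _ ≤ _ := by gcongr
  rw [hnum, div_le_iff₀ (by positivity)]
  calc ‖(-c - (t * ‖c‖ ^ 2 : ℝ) * p) / (N ^ 3 : ℝ)‖ ^ 2 ≤ (‖c‖ * P / N ^ 2) ^ 2 := by gcongr
    _ = ‖c‖ ^ 2 / N ^ 4 * (P * √P) * √P := by
        have h : √P * √P = P := Real.mul_self_sqrt (by linarith)
        rw [mul_assoc _ _ (√P), mul_assoc P, h]
        ring
    _ ≤ ‖c‖ ^ 2 / N ^ 4 * (N * √N * (8 * (1 + u ^ 2) ^ 2)) * √P := by gcongr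
    _ = ‖c‖ ^ 2 * (N * √N / N ^ 4) * (8 * (1 + u ^ 2) ^ 2) * √P := by ring
    _ ≤ ‖c‖ ^ 2 * (8 * ((1 + x) ^ (-(5 / 4) : ℝ)) ^ 2) * (8 * (1 + u ^ 2) ^ 2) * √P := by gcongr
    _ = _ := by ring

/-- The speed is integrable in the variable `t ‖c‖`, with primitive `-32 (1 + t ‖c‖) ^ (-1/4)`; its
total variation is at most `32` for every `c`. -/
lemma exists_segment_shift : ∃ C : ℝ≥0∞, C ≠ ⊤ ∧ ∀ (θ φ ψ : ℝ) (c : ℂ), ∀ s ∈ unitCell,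
    ∃ S : Segment (lump (suMat θ φ ψ * triMat 0 0) s)
      (lump (suMat θ φ ψ * triMat (-(Real.log (1 + ‖c‖ ^ 2) / 4)) c) s), S.length ≤ C := by
  obtain ⟨K, hK, h⟩ := exists_lintegral_sqrt_weierstrassP_le
  refine ⟨ENNReal.ofReal 32 * K ^ (1 / 2 : ℝ), ENNReal.mul_ne_top ENNReal.ofReal_ne_top
    (ENNReal.rpow_ne_top_of_nonneg (by norm_num) hK), ?_⟩
  intro θ φ ψ c s hs
  have hpos : ∀ τ : ℝ, 0 < 1 + τ ^ 2 * ‖c‖ ^ 2 := fun τ => by positivity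
  refine exists_segment (θ := fun _ => θ) (φ := fun _ => φ) (ψ := fun _ => ψ)
    (r := fun τ => -(Real.log (1 + τ ^ 2 * ‖c‖ ^ 2) / 4)) (c := fun τ => τ * c) (s := fun _ => s)
    contDiff_const contDiff_const contDiff_const ?_ ?_ contDiff_const (by simp) (by simp)
    (F := fun τ => -(32 * (1 + τ * ‖c‖) ^ (-(1 / 4) : ℝ)))
    (F' := fun τ => 8 * ‖c‖ * (1 + τ * ‖c‖) ^ (-(5 / 4) : ℝ)) ?_ ?_ ?_ ?_ ?_
  · refine ContDiff.neg (ContDiff.div_const (ContDiff.log (by fun_prop) fun τ => (hpos τ).ne') _)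
  · exact Complex.ofRealCLM.contDiff.mul contDiff_const
  · intro t ht
    have h1 : 0 < 1 + t * ‖c‖ := by have := mul_nonneg ht.1 (norm_nonneg c); linarith
    have h2 : HasDerivAt (fun τ => 1 + τ * ‖c‖) ‖c‖ t := by
      simpa using ((hasDerivAt_id t).mul_const ‖c‖).const_add 1
    refine ((h2.rpow_const (p := -(1 / 4)) (Or.inl h1.ne')).const_mul 32).neg.congr_deriv ?_
    norm_num
    ring
  · refine ContinuousOn.mul continuousOn_const (ContinuousOn.rpow_const (by fun_prop) ?_)
    intro t ht
    have := mul_nonneg ht.1 (norm_nonneg c)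
    exact Or.inl (by linarith)
  · intro t ht
    have := mul_nonneg ht.1 (norm_nonneg c)
    positivity
  · simp only [zero_mul, add_zero, Real.one_rpow, mul_one, one_mul]
    have : 0 ≤ (1 + ‖c‖) ^ (-(1 / 4) : ℝ) := by positivity
    linarith
  · intro t ht
    refine speed_le_of_affine (G := fun z => √(1 + ‖squarePeriods.weierstrassP (z - s)‖))
      ?_ (h s hs) continuousAt_const ?_
    · have := mul_nonneg ht.1 (norm_nonneg c)
      positivity
    · intro z _
      set p := squarePeriods.weierstrassP (z - s)
      refine ⟨fun τ => ((√(1 + τ ^ 2 * ‖c‖ ^ 2))⁻¹ : ℝ) * (p - τ * c), _, ?_, ?_,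
        shift_density_le ht.1 rfl⟩
      · refine HasDerivAt.mul (HasDerivAt.ofReal_comp ?_) ?_
        · have h1 : HasDerivAt (fun τ : ℝ => 1 + τ ^ 2 * ‖c‖ ^ 2) (2 * t * ‖c‖ ^ 2) t := by
            simpa using (((hasDerivAt_id t).pow 2).mul_const (‖c‖ ^ 2)).const_add 1
          refine ((h1.sqrt (hpos t).ne').inv (Real.sqrt_pos.2 (hpos t)).ne').congr_deriv ?_
          congr 2
          field_simp
        · simpa using ((Complex.ofRealCLM.hasDerivAt (x := t)).mul_const c).const_sub p
      · intro τ
        have : Real.exp (2 * -(Real.log (1 + τ ^ 2 * ‖c‖ ^ 2) / 4)) =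
            (√(1 + τ ^ 2 * ‖c‖ ^ 2))⁻¹ := by
          rw [← Real.exp_log (Real.sqrt_pos.2 (hpos τ)), Real.log_sqrt (hpos τ).le, ← Real.exp_neg]
          congr 1; ring
        rw [this]

/-- `℘'²` is a cubic polynomial in `℘`, so `‖℘'‖² / (1 + ‖℘‖²)²` is at most `4 + ‖g₂‖ + ‖g₃‖`, even
near the poles. The factor `2` in `B` bounds `‖s‖`. -/
lemma exists_segment_translation : ∃ C : ℝ≥0∞, C ≠ ⊤ ∧ ∀ (θ φ ψ : ℝ), ∀ s ∈ unitCell,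
    ∃ S : Segment (lump (suMat θ φ ψ * triMat 0 0) 0) (lump (suMat θ φ ψ * triMat 0 0) s),
      S.length ≤ C := by
  set B : ℝ := 2 * √(4 + ‖squarePeriods.g₂‖ + ‖squarePeriods.g₃‖) with hB
  refine ⟨ENNReal.ofReal B * (volume unitCell) ^ (1 / 2 : ℝ), ENNReal.mul_ne_top
    ENNReal.ofReal_ne_top (ENNReal.rpow_ne_top_of_nonneg (by norm_num) volume_unitCell_ne_top), ?_⟩
  intro θ φ ψ s hs
  have hs2 : ‖s‖ ≤ 2 := by simpa using unitCell_subset_closedBall hs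
  have hsd : ContDiff ℝ 1 fun τ : ℝ => (τ : ℂ) * s := by
    exact Complex.ofRealCLM.contDiff.mul contDiff_const
  refine exists_segment (θ := fun _ => θ) (φ := fun _ => φ) (ψ := fun _ => ψ)
    (r := fun _ => 0) (c := fun _ => 0) (s := fun τ => τ * s)
    contDiff_const contDiff_const contDiff_const contDiff_const contDiff_const hsd
    (by simp) (by simp) (F := fun τ => τ * B) (F' := fun _ => B) ?_ continuousOn_const
    (fun _ _ => by positivity) (by simp) ?_
  · intro t _
    simpa using (hasDerivAt_id t).mul_const B
  · intro t _
    refine speed_le_of_affine (G := fun _ => 1) (by positivity) (by simp)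
      (hsd.continuous.continuousAt) ?_
    intro z hz
    have hd : HasDerivAt (fun τ : ℝ => squarePeriods.weierstrassP (z - τ * s))
        (squarePeriods.derivWeierstrassP (z - t * s) * -s) t := by
      have h1 := (squarePeriods.analyticAt_weierstrassP hz).differentiableAt.hasDerivAt
      rw [squarePeriods.deriv_weierstrassP] at h1
      have h2 : HasDerivAt (fun τ : ℝ => z - (τ : ℂ) * s) (-s) t := by
        simpa using ((Complex.ofRealCLM.hasDerivAt (x := t)).mul_const s).const_sub z
      exact h1.comp t h2
    refine ⟨_, _, hd, fun τ => by simp, ?_⟩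
    set p := squarePeriods.weierstrassP (z - t * s) with hp
    have hsq := squarePeriods.derivWeierstrassP_sq (z - t * s) hz
    rw [← hp] at hsq
    have h3 : ‖squarePeriods.derivWeierstrassP (z - t * s)‖ ^ 2 ≤
        4 * ‖p‖ ^ 3 + ‖squarePeriods.g₂‖ * ‖p‖ + ‖squarePeriods.g₃‖ := by
      rw [← norm_pow, hsq]
      refine (norm_sub_le _ _).trans (add_le_add_left ((norm_sub_le _ _).trans ?_) _)
      simp
    rw [div_le_iff₀ (by positivity), norm_mul, norm_neg, mul_pow, hB, mul_pow, mul_one,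
      Real.sq_sqrt (by positivity)]
    have q0 := norm_nonneg p
    have q1 : ‖p‖ ^ 3 ≤ (1 + ‖p‖ ^ 2) ^ 2 := by
      nlinarith [sq_nonneg (‖p‖ ^ 2 - ‖p‖), sq_nonneg (‖p‖ ^ 2), sq_nonneg ‖p‖]
    have q2 : ‖p‖ ≤ (1 + ‖p‖ ^ 2) ^ 2 := by
      nlinarith [sq_nonneg (‖p‖ - 1), sq_nonneg (‖p‖ ^ 2), sq_nonneg ‖p‖]
    have q3 : 1 ≤ (1 + ‖p‖ ^ 2) ^ 2 := by nlinarith [sq_nonneg (‖p‖ ^ 2), sq_nonneg ‖p‖]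
    calc _ ≤ (4 * ‖p‖ ^ 3 + ‖squarePeriods.g₂‖ * ‖p‖ + ‖squarePeriods.g₃‖) * 2 ^ 2 := by
          gcongr
      _ ≤ (4 * (1 + ‖p‖ ^ 2) ^ 2 + ‖squarePeriods.g₂‖ * (1 + ‖p‖ ^ 2) ^ 2 +
          ‖squarePeriods.g₃‖ * (1 + ‖p‖ ^ 2) ^ 2) * 2 ^ 2 := by
          gcongr
          exact le_mul_of_one_le_right (norm_nonneg _) q3
      _ = _ := by ring

lemma exists_hasDerivAt_suMat (θ φ ψ t : ℝ) (i j : Fin 2) : ∃ u : ℂ,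
    HasDerivAt (fun τ : ℝ => suMat (τ * θ) (τ * φ) (τ * ψ) i j) u t ∧ ‖u‖ ≤ |θ| + |φ| + |ψ| := by
  have hc : HasDerivAt (fun τ : ℝ => (Real.cos (τ * θ) : ℂ)) ((-Real.sin (t * θ) * θ : ℝ) : ℂ) t :=
    HasDerivAt.ofReal_comp (by simpa using ((hasDerivAt_id t).mul_const θ).cos)
  have hs : HasDerivAt (fun τ : ℝ => (Real.sin (τ * θ) : ℂ)) ((Real.cos (t * θ) * θ : ℝ) : ℂ) t :=
    HasDerivAt.ofReal_comp (by simpa using ((hasDerivAt_id t).mul_const θ).sin)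
  have he : ∀ x : ℝ, HasDerivAt (fun τ : ℝ => Complex.exp ((τ * x : ℝ) * Complex.I))
      (Complex.exp ((t * x : ℝ) * Complex.I) * (x * Complex.I)) t := fun x => by
    refine HasDerivAt.cexp ?_
    have := (HasDerivAt.ofReal_comp ((hasDerivAt_id t).mul_const x)).mul_const Complex.I
    simpa using this
  have he' : ∀ x : ℝ, HasDerivAt (fun τ : ℝ => Complex.exp (-((τ * x : ℝ) * Complex.I)))
      (Complex.exp (-((t * x : ℝ) * Complex.I)) * -(x * Complex.I)) t := fun x => by
    refine HasDerivAt.cexp ?_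
    have := (HasDerivAt.ofReal_comp ((hasDerivAt_id t).mul_const x)).mul_const Complex.I
    refine this.neg.congr_deriv ?_
    simp
  have n1 : ∀ x : ℝ, ‖Complex.exp ((t * x : ℝ) * Complex.I)‖ = 1 := fun x =>
    Complex.norm_exp_ofReal_mul_I _
  have n2 : ∀ x : ℝ, ‖Complex.exp (-((t * x : ℝ) * Complex.I))‖ = 1 := fun x => by
    rw [Complex.exp_neg, norm_inv, n1, inv_one]
  have nc : |Real.cos (t * θ)| ≤ 1 := Real.abs_cos_le_one _
  have ns : |Real.sin (t * θ)| ≤ 1 := Real.abs_sin_le_one _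
  have hθ := abs_nonneg θ
  have hφ := abs_nonneg φ
  have hψ := abs_nonneg ψ
  have bd : ∀ (a b x : ℝ) (e v : ℂ), |a| ≤ 1 → |b| ≤ 1 → ‖e‖ = 1 → ‖v‖ = |x| →
      ‖((a * θ : ℝ) : ℂ) * e + (b : ℂ) * (e * v)‖ ≤ |θ| + |x| := by
    intro a b x e v ha hb hee hv
    refine (norm_add_le _ _).trans ?_
    rw [norm_mul, norm_mul, norm_mul, hee, hv, Complex.norm_real, Complex.norm_real,
      Real.norm_eq_abs, Real.norm_eq_abs, abs_mul, mul_one, one_mul]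
    have := mul_le_mul_of_nonneg_right ha (abs_nonneg θ)
    have := mul_le_mul_of_nonneg_right hb (abs_nonneg x)
    linarith
  have ns' : |-Real.sin (t * θ)| ≤ 1 := by rwa [abs_neg]
  fin_cases i <;> fin_cases j
  · refine ⟨_, hc.mul (he φ), (bd _ _ φ _ _ ns' nc (n1 φ) (by simp)).trans (by linarith)⟩
  · refine ⟨_, (hs.mul (he' ψ)).neg, ?_⟩
    rw [norm_neg]
    exact (bd _ _ ψ _ _ nc ns (n2 ψ) (by simp)).trans (by linarith)
  · refine ⟨_, hs.mul (he ψ), (bd _ _ ψ _ _ nc ns (n1 ψ) (by simp)).trans (by linarith)⟩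
  · refine ⟨_, hc.mul (he' φ), (bd _ _ φ _ _ ns' nc (n2 φ) (by simp)).trans (by linarith)⟩

/-- The entries of the velocity of `U` are at most `4 + 4 + 4 = 12`, so the Wronskian is at most `24
(1 + ‖f‖²)` pointwise; the constant `48` is ample. -/
lemma exists_segment_rotation : ∃ C : ℝ≥0∞, C ≠ ⊤ ∧ ∀ (θ φ ψ : ℝ), |θ| ≤ 4 → |φ| ≤ 4 → |ψ| ≤ 4 →
    ∃ S : Segment (lump (suMat 0 0 0 * triMat 0 0) 0) (lump (suMat θ φ ψ * triMat 0 0) 0),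
      S.length ≤ C := by
  refine ⟨ENNReal.ofReal 48 * (volume unitCell) ^ (1 / 2 : ℝ), ENNReal.mul_ne_top
    ENNReal.ofReal_ne_top (ENNReal.rpow_ne_top_of_nonneg (by norm_num) volume_unitCell_ne_top), ?_⟩
  intro θ φ ψ hθ hφ hψ
  refine exists_segment (θ := fun τ => τ * θ) (φ := fun τ => τ * φ) (ψ := fun τ => τ * ψ)
    (r := fun _ => 0) (c := fun _ => 0) (s := fun _ => 0)
    (by fun_prop) (by fun_prop) (by fun_prop) contDiff_const contDiff_const contDiff_const
    (by simp) (by simp) (F := fun τ => τ * 48) (F' := fun _ => 48) ?_ continuousOn_const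
    (fun _ _ => by norm_num) (by simp) ?_
  · intro t _
    simpa using (hasDerivAt_id t).mul_const (48 : ℝ)
  · intro t _
    refine speed_le (G := fun _ => 1) (by norm_num) (by simp) ?_
    filter_upwards [ae_notMem_lattice_and_ne_zero (suMat (t * θ) (t * φ) (t * ψ)) 0 0 0] with z
      ⟨h1, h2⟩
    set f : ℂ := Real.exp (2 * 0) * (squarePeriods.weierstrassP (z - 0) - 0) with hf
    obtain ⟨a, ha, ha'⟩ := exists_hasDerivAt_suMat θ φ ψ t 0 0
    obtain ⟨b, hb, hb'⟩ := exists_hasDerivAt_suMat θ φ ψ t 0 1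
    obtain ⟨c, hc, hc'⟩ := exists_hasDerivAt_suMat θ φ ψ t 1 0
    obtain ⟨d, hd, hd'⟩ := exists_hasDerivAt_suMat θ φ ψ t 1 1
    refine ⟨_, _, _, _, (ha.mul_const f).add hb, (hc.mul_const f).add hd, h2,
      Eventually.of_forall fun τ => ?_, ?_⟩
    · rw [lump_apply, orbitMap_mul_triMat _ _ _ _ h1]
      rfl
    · simp only [Pi.add_apply]
      rw [norm_sq_add_norm_sq_suMat, div_le_iff₀ (by positivity)]
      have hn := norm_sq_add_norm_sq_suMat (t * θ) (t * φ) (t * ψ) f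
      set y₁ := suMat (t * θ) (t * φ) (t * ψ) 0 0 * f + suMat (t * θ) (t * φ) (t * ψ) 0 1
      set y₂ := suMat (t * θ) (t * φ) (t * ψ) 1 0 * f + suMat (t * θ) (t * φ) (t * ψ) 1 1
      have bd : ∀ x y : ℂ, ‖x‖ ≤ |θ| + |φ| + |ψ| → ‖y‖ ≤ |θ| + |φ| + |ψ| →
          ‖x * f + y‖ ≤ 12 * (‖f‖ + 1) := by
        intro x y hx hy
        refine (norm_add_le _ _).trans ?_
        rw [norm_mul]
        nlinarith [norm_nonneg f]
      have h3 : ‖(a * f + b) * y₂ - y₁ * (c * f + d)‖ ≤ 12 * (‖f‖ + 1) * (‖y₁‖ + ‖y₂‖) := by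
        refine (norm_sub_le _ _).trans ?_
        rw [norm_mul, norm_mul]
        have := mul_le_mul_of_nonneg_right (bd a b ha' hb') (norm_nonneg y₂)
        have := mul_le_mul_of_nonneg_left (bd c d hc' hd') (norm_nonneg y₁)
        linarith
      have h4 : (‖f‖ + 1) ^ 2 ≤ 2 * (1 + ‖f‖ ^ 2) := by nlinarith [sq_nonneg (‖f‖ - 1)]
      have h5 : (‖y₁‖ + ‖y₂‖) ^ 2 ≤ 2 * (1 + ‖f‖ ^ 2) := by nlinarith [sq_nonneg (‖y₁‖ - ‖y₂‖)]
      calc _ ≤ (12 * (‖f‖ + 1) * (‖y₁‖ + ‖y₂‖)) ^ 2 := by gcongr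
        _ = 144 * ((‖f‖ + 1) ^ 2 * (‖y₁‖ + ‖y₂‖) ^ 2) := by ring
        _ ≤ 144 * ((2 * (1 + ‖f‖ ^ 2)) * (2 * (1 + ‖f‖ ^ 2))) := by gcongr
        _ ≤ _ := by nlinarith [sq_nonneg (1 + ‖f‖ ^ 2)]

/-! ### The diameter -/

theorem diameter_lt_top : diameter < ⊤ := by
  obtain ⟨C₁, hC₁, h₁⟩ := exists_segment_dilation
  obtain ⟨C₂, hC₂, h₂⟩ := exists_segment_shift
  obtain ⟨C₃, hC₃, h₃⟩ := exists_segment_translation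
  obtain ⟨C₄, hC₄, h₄⟩ := exists_segment_rotation
  set C := C₄ + C₃ + C₂ + C₁ with hC
  set W₀ := lump (suMat 0 0 0 * triMat 0 0) 0
  -- Both directions are used in place of symmetry of the distance: the second with `W = V` bounds
  -- `riemDist V W₀` by `C`, and the first then bounds `riemDist V W` by `C + C`.
  have key : ∀ V W : ModuliSpace, riemDist V W ≤ riemDist V W₀ + C ∧
      riemDist V W₀ ≤ riemDist V W + C := by
    intro V W
    obtain ⟨M, s', rfl⟩ := exists_eq_lump W
    obtain ⟨s, hs, hl⟩ := exists_mem_unitCell s'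
    obtain ⟨θ, φ, ψ, r, c, hθ, hφ, hψ, rfl⟩ := exists_eq_suMat_mul_triMat M
    rw [← lump_add_lattice _ s' hl, add_sub_cancel]
    obtain ⟨S₁, hS₁⟩ := h₁ θ φ ψ r c s hs
    obtain ⟨S₂, hS₂⟩ := h₂ θ φ ψ c s hs
    obtain ⟨S₃, hS₃⟩ := h₃ θ φ ψ s hs
    obtain ⟨S₄, hS₄⟩ := h₄ θ φ ψ hθ hφ hψ
    refine ⟨?_, ?_⟩
    · calc _ ≤ riemDist V W₀ + S₄.length + S₃.length + S₂.length + S₁.length := by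
            refine (S₁.riemDist_le V).trans (add_le_add_left ?_ _)
            refine (S₂.riemDist_le V).trans (add_le_add_left ?_ _)
            refine (S₃.riemDist_le V).trans (add_le_add_left ?_ _)
            exact S₄.riemDist_le V
        _ ≤ riemDist V W₀ + C₄ + C₃ + C₂ + C₁ := by gcongr
        _ = _ := by rw [hC]; ring
    · calc _ ≤ riemDist V _ + S₁.symm.length + S₂.symm.length + S₃.symm.length +
            S₄.symm.length := by
            refine (S₄.symm.riemDist_le V).trans (add_le_add_left ?_ _)
            refine (S₃.symm.riemDist_le V).trans (add_le_add_left ?_ _)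
            refine (S₂.symm.riemDist_le V).trans (add_le_add_left ?_ _)
            exact S₁.symm.riemDist_le V
        _ ≤ riemDist V (lump (suMat θ φ ψ * triMat r c) s) + C₁ + C₂ + C₃ + C₄ := by
            simp only [Segment.length_symm]
            gcongr
        _ = _ := by rw [hC]; ring
  have hCt : C + C < ⊤ := by simp [hC, hC₁, hC₂, hC₃, hC₄, lt_top_iff_ne_top]
  refine lt_of_le_of_lt (iSup₂_le fun V W => ?_) hCt
  calc riemDist V W ≤ riemDist V W₀ + C := (key V W).1
    _ ≤ riemDist V V + C + C := add_le_add_left (key V V).2 _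
    _ = C + C := by rw [riemDist_self, zero_add]

end TorusLump

end

theorem theorem3 :
    NoncompactSpace TorusLump.ModuliSpace ∧ TorusLump.diameter < ⊤ :=
  ⟨TorusLump.noncompactSpace_moduliSpace, TorusLump.diameter_lt_top⟩
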